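/- Let $\tau$ be a point of the upper half-plane, let $\wp(x)=\wp(x;\tau)$ be the Weierstrass function of the lattice $\mathbb Z+\mathbb Z\tau$ with invariants $g_2=g_2(\tau)$, $g_3=g_3(\tau)$, let $C\in\mathbb C$ and $f(x)=C\,\wp(x;\tau)$, for $x\in\mathbb C\setminus(\mathbb Z+\mathbb Z\tau)$. Let $\partial$ be the derivation of $\mathbb C[u_0,u_1,u_2,\dots]$ with $\partial(u_i)=u_{i+1}$, and let $R(\lambda)$ be the basic matrix resolvent, that is, the unique $2\times2$ matrix of trace zero whose entries are Laurent series in $\lambda^{-1}$ over $\mathbb C[u_0,u_1,\dots]$ such that $$\Bigl[\partial+\begin{pmatrix}0&1\\ \lambda-2u_0&0\end{pmatrix},R(\lambda)\Bigr]=0,\qquad R(\lambda)=\begin{pmatrix}0&1\\ \lambda&0\end{pmatrix}+\text{lower order terms},\qquad \operatorname{Tr}R(\lambda)^2=2\lambda,$$ where the order is taken in the principal gradation, in which $\lambda^k$ in the entry $(i,j)$ has degree $2k+j-i$. Let $b(\lambda,x)$, a power series in $\lambda^{-1}$, be the upper right entry of $R(\lambda)$ with $u_i$ replaced by $f^{(i)}(x)$.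 The square root of a Laurent series in $\lambda^{-1}$ with positive leading coefficient, of even degree in $\lambda$, is the one with positive leading coefficient. Suppose that $C=-\frac{p(p+1)}2$ with an integer $p\ge0$, and let $y^2=S_p(\lambda)$ be the spectral curve of $L=\partial_x^2+2f(x)$: $A^2=S_p(L)$, where $A$ is a monic differential operator in $x$ of odd order, with coefficients analytic on $\mathbb C\setminus(\mathbb Z+\mathbb Z\tau)$, that commutes with $L$, and no such operator of smaller odd order commutes with $L$. This polynomial $S_p$ exists, is unique, and is monic of degree $2p+1$. The product $\sqrt{S_p(\lambda)/\lambda}\;b(\lambda,x)$ is given by a polynomial in $\lambda$ and $\wp(x)$ with complex coefficients independent of $x$; as a polynomial in $\lambda$ it has degree $p$ and leading coefficient $1$, and as a polynomial in $\wp$ it has degree $p$. Moreover, for $p=1$, $$b=2\sqrt\lambda\,\frac{\lambda-\wp}{\sqrt{4\lambda^3-g_2\lambda-g_3}}\,;$$ for $p=2$, $$b=\frac12\sqrt\lambda\,\frac{4\lambda^2-12\wp\lambda+36\wp^2-9g_2}{\sqrt{(\lambda^2-3g_2)(4\lambda^3-9g_2\lambda+27g_3)}}\,;$$ for $p=3$,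 $$b=\frac{4\lambda^3-24\wp\lambda^2+60(3\wp^2-g_2)\lambda-900\wp^3+225g_2\wp+225g_3}{\sqrt{16\lambda^6-504g_2\lambda^4+2376g_3\lambda^3+4185g_2^2\lambda^2-36450g_2g_3\lambda-3375g_2^3+91125g_3^2}}\,.$$ Here $\sqrt\lambda/\sqrt{P(\lambda)}$ means $1/\sqrt{P(\lambda)/\lambda}$. -/

import Mathlib

noncomputable section

namespace KdVLame

open scoped Polynomial

/-! ## The basic matrix resolvent of the abstract KdV hierarchy -/

/-- The differential polynomial ring `ℂ[u₀, u₁, u₂, …]`. -/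
abbrev DiffPoly : Type := MvPolynomial ℕ ℂ

/-- The derivation `∂` of `ℂ[u₀, u₁, …]` with `∂ uᵢ = uᵢ₊₁`. -/
def diffPolyD : Derivation ℂ DiffPoly DiffPoly :=
  MvPolynomial.mkDerivation ℂ (fun i : ℕ => (MvPolynomial.X (i + 1) : DiffPoly))

/-- Formal Laurent series in `λ⁻¹`: the variable of `LaurentSeries A` is read as `λ⁻¹`, so that the
coefficient of `λ ^ k` is `coeff (-k)`. This is the element `λ`. -/
def lam (A : Type) [CommRing A] : LaurentSeries A := HahnSeries.single (-1 : ℤ) (1 : A)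

/-- `∂`, acting on each coefficient of a Laurent series in `λ⁻¹`. -/
def serD (s : LaurentSeries DiffPoly) : LaurentSeries DiffPoly := HahnSeries.map s diffPolyD

/-- `Λ(λ) = (0 1; λ 0)`. -/
def LambdaMat : Matrix (Fin 2) (Fin 2) (LaurentSeries DiffPoly) := !![0, 1; lam DiffPoly, 0]

/-- `q = (0 0; -2u₀ 0)`. -/
def qMat : Matrix (Fin 2) (Fin 2) (LaurentSeries DiffPoly) :=
  !![0, 0; HahnSeries.C (-2 * (MvPolynomial.X 0 : DiffPoly)), 0]

/-- `R` is an `sl₂`-valued Laurent series in `λ⁻¹` with `[∂ + Λ + q, R] = 0`,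
`R = Λ + lower order terms` for the principal gradation (`deg E = 1`, `deg F = -1`, `deg λ = 2`,
so that `λ ^ k` in the entry `(i, j)` has degree `2k + j - i`), and `Tr R² = 2λ`. -/
structure IsBasicMatrixResolvent (R : Matrix (Fin 2) (Fin 2) (LaurentSeries DiffPoly)) :
    Prop where
  trace_eq_zero : R.trace = 0
  commute : R.map serD + ((LambdaMat + qMat) * R - R * (LambdaMat + qMat)) = 0
  leading : ∀ (i j : Fin 2) (k : ℤ), 1 ≤ 2 * k + ((j : ℕ) : ℤ) - ((i : ℕ) : ℤ) →
    ((R - LambdaMat) i j).coeff (-k) = 0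
  trace_sq : (R * R).trace = 2 * lam DiffPoly

/-! ### Existence and uniqueness of the basic matrix resolvent -/

/-- The coefficients of the upper right entry `b = ∑ βₙ λ⁻ⁿ`. -/
def bCoeff : ℕ → DiffPoly
  | 0 => 1
  | n + 1 =>
      (∑ i : Fin (n + 1),
        (MvPolynomial.C (1 / 4 : ℂ) * (bCoeff i * diffPolyD (diffPolyD (bCoeff (n - i))))
          - MvPolynomial.C (1 / 8 : ℂ) * (diffPolyD (bCoeff i) * diffPolyD (bCoeff (n - i)))
          + MvPolynomial.X 0 * (bCoeff i * bCoeff (n - i))))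
      - MvPolynomial.C (1 / 2 : ℂ) * ∑ i : Fin n, bCoeff (i + 1) * bCoeff (n - i)
  termination_by n => n
  decreasing_by all_goals omega

theorem serD_coeff (s : LaurentSeries DiffPoly) (n : ℤ) :
    (serD s).coeff n = diffPolyD (s.coeff n) := rfl

theorem serD_add (x y : LaurentSeries DiffPoly) : serD (x + y) = serD x + serD y := by
  ext1; funext n; simp [serD_coeff]

theorem serD_sub (x y : LaurentSeries DiffPoly) : serD (x - y) = serD x - serD y := by
  ext1; funext n; simp [serD_coeff]

theorem serD_neg (x : LaurentSeries DiffPoly) : serD (-x) = -serD x := by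
  ext1; funext n; simp [serD_coeff]

theorem serD_single (k : ℤ) (a : DiffPoly) :
    serD (HahnSeries.single k a) = HahnSeries.single k (diffPolyD a) := by
  ext1; funext n
  rw [serD_coeff, HahnSeries.coeff_single, HahnSeries.coeff_single]
  split_ifs <;> simp

theorem serD_mul (x y : LaurentSeries DiffPoly) :
    serD (x * y) = serD x * y + x * serD y := by
  have hx : (serD x).support ⊆ x.support := by
    intro n hn h0
    apply hn
    simp [serD_coeff, h0]
  have hy : (serD y).support ⊆ y.support := by
    intro n hn h0
    apply hn
    simp [serD_coeff, h0]
  ext1; funext n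
  rw [serD_coeff, HahnSeries.coeff_add,
    HahnSeries.coeff_mul_left' x.isPWO_support hx, HahnSeries.coeff_mul_right' y.isPWO_support hy,
    HahnSeries.coeff_mul, map_sum, ← Finset.sum_add_distrib]
  refine Finset.sum_congr rfl fun ij _ => ?_
  simp only [serD_coeff, Derivation.leibniz, smul_eq_mul]
  ring

theorem serD_lam : serD (lam DiffPoly) = 0 := by simp [lam, serD_single]

theorem serD_C (a : DiffPoly) : serD (HahnSeries.C a) = HahnSeries.C (diffPolyD a) :=
  serD_single 0 a

theorem serD_const (c : ℂ) : serD (HahnSeries.C (MvPolynomial.C c : DiffPoly)) = 0 := by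
  rw [serD_C]
  simp [diffPolyD]

theorem diffPolyD_X (i : ℕ) : diffPolyD (MvPolynomial.X i) = MvPolynomial.X (i + 1) := by
  simp [diffPolyD, MvPolynomial.mkDerivation_X]

/-- The series `b = ∑ βₙ λ⁻ⁿ`. -/
def bSeries : LaurentSeries DiffPoly :=
  HahnSeries.ofPowerSeries ℤ DiffPoly (PowerSeries.mk bCoeff)

theorem bSeries_coeff (n : ℕ) : bSeries.coeff (n : ℤ) = bCoeff n := by
  rw [bSeries, HahnSeries.ofPowerSeries_apply_coeff, PowerSeries.coeff_mk]

theorem bSeries_coeff_neg (n : ℤ) (hn : n < 0) : bSeries.coeff n = 0 := by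
  rw [bSeries, PowerSeries.coeff_coe, if_pos hn]

theorem serD_ofPowerSeries (g : ℕ → DiffPoly) :
    serD (HahnSeries.ofPowerSeries ℤ DiffPoly (PowerSeries.mk g)) =
      HahnSeries.ofPowerSeries ℤ DiffPoly (PowerSeries.mk fun n => diffPolyD (g n)) := by
  ext1; funext n
  rw [serD_coeff, PowerSeries.coeff_coe, PowerSeries.coeff_coe]
  split_ifs <;> simp

theorem lam_mul_single : lam DiffPoly * HahnSeries.single (1 : ℤ) (1 : DiffPoly) = 1 := by
  simp [lam]

theorem bCoeff_quadratic :
    (PowerSeries.mk bCoeff) * (PowerSeries.mk bCoeff) = 1 + PowerSeries.X *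
      (PowerSeries.C (MvPolynomial.C (1 / 2 : ℂ)) * (PowerSeries.mk bCoeff *
          PowerSeries.mk fun n => diffPolyD (diffPolyD (bCoeff n)))
        - PowerSeries.C (MvPolynomial.C (1 / 4 : ℂ)) *
          ((PowerSeries.mk fun n => diffPolyD (bCoeff n)) *
            PowerSeries.mk fun n => diffPolyD (bCoeff n))
        + PowerSeries.C (2 * MvPolynomial.X 0 : DiffPoly) *
          (PowerSeries.mk bCoeff * PowerSeries.mk bCoeff)) := by
  have h0 : bCoeff 0 = 1 := by rw [bCoeff]
  have c2 : (MvPolynomial.C (1 / 2 : ℂ) : DiffPoly) * 2 = 1 := by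
    rw [← map_ofNat (MvPolynomial.C : ℂ →+* DiffPoly) 2, ← map_mul]; norm_num
  have c4 : (MvPolynomial.C (1 / 4 : ℂ) : DiffPoly) * 2 = MvPolynomial.C (1 / 2 : ℂ) := by
    rw [← map_ofNat (MvPolynomial.C : ℂ →+* DiffPoly) 2, ← map_mul]; norm_num
  have c8 : (MvPolynomial.C (1 / 8 : ℂ) : DiffPoly) * 2 = MvPolynomial.C (1 / 4 : ℂ) := by
    rw [← map_ofNat (MvPolynomial.C : ℂ →+* DiffPoly) 2, ← map_mul]; norm_num
  ext1 n
  cases n with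
  | zero => simp [h0]
  | succ n =>
    rw [map_add, PowerSeries.coeff_succ_X_mul, map_add, map_sub, PowerSeries.coeff_C_mul,
      PowerSeries.coeff_C_mul, PowerSeries.coeff_C_mul]
    simp only [PowerSeries.coeff_mul, PowerSeries.coeff_mk, PowerSeries.coeff_one]
    simp only [Finset.Nat.sum_antidiagonal_eq_sum_range_succ_mk]
    rw [Finset.sum_range_succ (n := n + 1), Finset.sum_range_succ' (n := n)]
    have hrec := bCoeff.eq_2 n
    simp only [Finset.sum_add_distrib, Finset.sum_sub_distrib, ← Finset.mul_sum] at hrec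
    rw [Finset.sum_range, Finset.sum_range, Finset.sum_range, Finset.sum_range]
    have e : ∀ i : Fin n, n + 1 - ((i : ℕ) + 1) = n - i := fun i => by omega
    simp only [e, h0, Nat.sub_self, Nat.sub_zero]
    simp only [Nat.succ_eq_add_one, if_neg (Nat.succ_ne_zero n)]
    generalize (∑ i : Fin n, bCoeff (i + 1) * bCoeff (n - i)) = s1 at *
    generalize (∑ i : Fin (n + 1), bCoeff i * bCoeff (n - i)) = s2 at *
    generalize (∑ i : Fin (n + 1), bCoeff i * diffPolyD (diffPolyD (bCoeff (n - i)))) = s3 at *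
    generalize (∑ i : Fin (n + 1), diffPolyD (bCoeff i) * diffPolyD (bCoeff (n - i))) = s4 at *
    rw [hrec]
    linear_combination (s3 * c4 - s4 * c8 - s1 * c2)

/-- `λ - 2u₀`. -/
def lamSub : LaurentSeries DiffPoly :=
  lam DiffPoly + HahnSeries.C (-2 * (MvPolynomial.X 0 : DiffPoly))

/-- The constant `1/2`. -/
def half : LaurentSeries DiffPoly := HahnSeries.C (MvPolynomial.C (1 / 2 : ℂ) : DiffPoly)

theorem half_two : half * 2 = 1 := by
  rw [half, ← map_ofNat (HahnSeries.C : DiffPoly →+* LaurentSeries DiffPoly) 2, ← map_mul,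
    ← map_ofNat (MvPolynomial.C : ℂ →+* DiffPoly) 2, ← map_mul]
  norm_num

theorem half_half_quarter :
    (HahnSeries.C (MvPolynomial.C (1 / 4 : ℂ) : DiffPoly) : LaurentSeries DiffPoly) =
      half * half := by
  rw [half, ← map_mul, ← map_mul]; norm_num

theorem serD_half_mul (x : LaurentSeries DiffPoly) : serD (half * x) = half * serD x := by
  rw [serD_mul, half, serD_const]; ring

theorem bSeries_quadratic :
    half * half * (serD bSeries * serD bSeries) + lamSub * (bSeries * bSeries)
      - half * (bSeries * serD (serD bSeries)) = lam DiffPoly := by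
  have h := congrArg (HahnSeries.ofPowerSeries ℤ DiffPoly) bCoeff_quadratic
  simp only [map_add, map_mul, map_sub, map_one, HahnSeries.ofPowerSeries_X,
    HahnSeries.ofPowerSeries_C] at h
  rw [← serD_ofPowerSeries (fun n => diffPolyD (bCoeff n)), ← serD_ofPowerSeries] at h
  change bSeries * bSeries = 1 + HahnSeries.single 1 1 * (half * (bSeries * serD (serD bSeries))
    - _ * (serD bSeries * serD bSeries) + _ * (bSeries * bSeries)) at h
  rw [half_half_quarter] at h
  have hu : lamSub = lam DiffPoly -
      HahnSeries.C 2 * HahnSeries.C (MvPolynomial.X 0 : DiffPoly) := by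
    rw [lamSub, ← map_mul, sub_eq_add_neg, ← map_neg, neg_mul]
  rw [hu]
  linear_combination (lam DiffPoly) * h + (half * (bSeries * serD (serD bSeries))
    - half * half * (serD bSeries * serD bSeries)
    + HahnSeries.C 2 * HahnSeries.C (MvPolynomial.X 0 : DiffPoly) * (bSeries * bSeries))
    * lam_mul_single

theorem serD_lamSub : serD lamSub = HahnSeries.C (-2 * (MvPolynomial.X 1 : DiffPoly)) := by
  rw [lamSub, serD_add, serD_lam, serD_C, zero_add]
  congr 1
  have : (-2 * (MvPolynomial.X 0 : DiffPoly)) =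
      MvPolynomial.C (-2 : ℂ) * MvPolynomial.X 0 := by
    rw [map_neg, map_ofNat]
  rw [this, Derivation.leibniz, diffPolyD_X]
  have h2 : ∀ c : ℂ, diffPolyD (MvPolynomial.C c) = 0 := fun c => by simp [diffPolyD]
  rw [h2, map_neg, map_ofNat, smul_zero, add_zero, smul_eq_mul]

theorem bSeries_ne_zero : bSeries ≠ 0 := by
  intro h
  have h1 := bSeries_coeff 0
  rw [h, bCoeff] at h1
  simp at h1

theorem bSeries_linear :
    half * serD (serD (serD bSeries)) = 2 * (lamSub * serD bSeries) + serD lamSub * bSeries := by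
  have h := congrArg serD bSeries_quadratic
  simp only [serD_add, serD_sub, serD_mul, serD_lam] at h
  have hh : serD half = 0 := serD_const _
  rw [hh] at h
  have : bSeries * (half * serD (serD (serD bSeries)) -
      (2 * (lamSub * serD bSeries) + serD lamSub * bSeries)) = 0 := by
    linear_combination -h + half * serD bSeries * serD (serD bSeries) * half_two
  rcases mul_eq_zero.mp this with h0 | h0
  · exact absurd h0 bSeries_ne_zero
  · exact sub_eq_zero.mp h0

/-- The basic matrix resolvent with upper right entry `b`. -/
def resolventOf (b : LaurentSeries DiffPoly) : Matrix (Fin 2) (Fin 2) (LaurentSeries DiffPoly) :=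
  !![half * serD b, b; lamSub * b - half * serD (serD b), -(half * serD b)]

theorem LambdaMat_add_qMat : LambdaMat + qMat = !![0, 1; lamSub, 0] := by
  rw [LambdaMat, qMat, lamSub]
  ext i j; fin_cases i <;> fin_cases j <;> simp

theorem half_mul_coeff (x : LaurentSeries DiffPoly) (n : ℤ) :
    (half * x).coeff n = MvPolynomial.C (1 / 2 : ℂ) * x.coeff n := by
  rw [half, HahnSeries.C_mul_eq_smul, HahnSeries.coeff_smul, smul_eq_mul]

theorem lam_mul_coeff (x : LaurentSeries DiffPoly) (n : ℤ) :
    (lam DiffPoly * x).coeff n = x.coeff (n + 1) := by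
  rw [lam, HahnSeries.coeff_single_mul, one_mul, sub_neg_eq_add]

theorem lamSub_mul_coeff (x : LaurentSeries DiffPoly) (n : ℤ) :
    (lamSub * x).coeff n = x.coeff (n + 1) + -2 * (MvPolynomial.X 0 : DiffPoly) * x.coeff n := by
  rw [lamSub, add_mul, HahnSeries.coeff_add, lam_mul_coeff, HahnSeries.C_mul_eq_smul,
    HahnSeries.coeff_smul, smul_eq_mul]

theorem serD_half : serD half = 0 := serD_const _

theorem isBasicMatrixResolvent_resolventOf : IsBasicMatrixResolvent (resolventOf bSeries) where
  trace_eq_zero := by simp [resolventOf, Matrix.trace_fin_two]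
  commute := by
    have hl := bSeries_linear
    rw [LambdaMat_add_qMat]
    ext1 i j
    fin_cases i <;> fin_cases j <;>
      simp [resolventOf, serD_neg, serD_sub, serD_mul, serD_half]
    · ring
    · linear_combination (-serD bSeries) * half_two
    · linear_combination (lamSub * serD bSeries) * half_two - hl
  leading := by
    intro i j k hk
    have hneg : ∀ n : ℤ, n < 0 → bSeries.coeff n = 0 := bSeries_coeff_neg
    have hzero : bSeries.coeff 0 = 1 := by
      have := bSeries_coeff 0
      rwa [bCoeff, Nat.cast_zero] at this
    fin_cases i <;> fin_cases j <;> simp at hk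
    · simp [resolventOf, LambdaMat, half_mul_coeff, serD_coeff, hneg (-k) (by omega)]
    · rcases eq_or_lt_of_le hk with h0 | h0
      · have h0' : k = 0 := by omega
        simp [resolventOf, LambdaMat, h0', hzero]
      · have h0' : k ≠ 0 := by omega
        simp [resolventOf, LambdaMat, hneg (-k) (by omega), HahnSeries.coeff_one, h0']
    · simp [resolventOf, LambdaMat, half_mul_coeff, lamSub_mul_coeff, serD_coeff,
        hneg (-k) (by omega), lam, HahnSeries.coeff_single]
      by_cases h1 : k = 1
      · simp [h1, hzero]
      · rw [hneg _ (by omega), if_neg h1]; simp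
    · simp [resolventOf, LambdaMat, half_mul_coeff, serD_coeff, hneg (-k) (by omega)]
  trace_sq := by
    have hq := bSeries_quadratic
    simp [resolventOf, Matrix.trace_fin_two]
    linear_combination 2 * hq

theorem IsBasicMatrixResolvent.eq_resolventOf {R : Matrix (Fin 2) (Fin 2) (LaurentSeries DiffPoly)}
    (h : IsBasicMatrixResolvent R) : R = resolventOf (R 0 1) := by
  have ht := h.trace_eq_zero
  have hc := h.commute
  rw [LambdaMat_add_qMat] at hc
  rw [Matrix.trace_fin_two] at ht
  have h01 := congrFun (congrFun hc 0) 1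
  have h00 := congrFun (congrFun hc 0) 0
  simp [Matrix.mul_apply, Matrix.vecMul, dotProduct, Fin.sum_univ_two] at h01 h00
  have ha : R 0 0 = half * serD (R 0 1) := by
    linear_combination -half * h01 + half * ht - R 0 0 * half_two
  have hd : R 1 1 = -(half * serD (R 0 1)) := by linear_combination ht - ha
  have hcc : R 1 0 = lamSub * R 0 1 - half * serD (serD (R 0 1)) := by
    rw [ha, serD_half_mul] at h00
    linear_combination h00
  ext1 i j
  fin_cases i <;> fin_cases j <;> simp [resolventOf]
  · exact ha
  · exact hcc
  · exact hd

theorem vanish_mul {x y : LaurentSeries DiffPoly} {n m : ℤ} (hx : ∀ k < n, x.coeff k = 0)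
    (hy : ∀ k < m, y.coeff k = 0) : ∀ k < n + m, (x * y).coeff k = 0 := by
  intro k hk
  rw [HahnSeries.coeff_mul]
  refine Finset.sum_eq_zero fun ij hij => ?_
  rw [Finset.mem_antidiagonal] at hij
  by_cases h1 : ij.1 < n
  · rw [hx _ h1, zero_mul]
  · rw [hy _ (by omega), mul_zero]

theorem quadratic_unique {b c : LaurentSeries DiffPoly}
    (hb : half * half * (serD b * serD b) + lamSub * (b * b)
      - half * (b * serD (serD b)) = lam DiffPoly)
    (hc : half * half * (serD c * serD c) + lamSub * (c * c)
      - half * (c * serD (serD c)) = lam DiffPoly)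
    (hb1 : ∀ k < 1, (b - 1).coeff k = 0) (hc1 : ∀ k < 1, (c - 1).coeff k = 0) : b = c := by
  have h1 : ∀ k < (0 : ℤ), (1 : LaurentSeries DiffPoly).coeff k = 0 := by
    intro k hk
    rw [HahnSeries.coeff_one, if_neg (by omega)]
  have vb : ∀ k < (0 : ℤ), b.coeff k = 0 := by
    intro k hk
    have := hb1 k (by omega)
    rwa [HahnSeries.coeff_sub, h1 k hk, sub_zero] at this
  have vc : ∀ k < (0 : ℤ), c.coeff k = 0 := by
    intro k hk
    have := hc1 k (by omega)
    rwa [HahnSeries.coeff_sub, h1 k hk, sub_zero] at this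
  have vD : ∀ (x : LaurentSeries DiffPoly) (n : ℤ), (∀ k < n, x.coeff k = 0) →
      ∀ k < n, (serD x).coeff k = 0 := by
    intro x n hx k hk
    rw [serD_coeff, hx k hk, map_zero]
  have vs : ∀ (x y : LaurentSeries DiffPoly) (n : ℤ), (∀ k < n, x.coeff k = 0) →
      (∀ k < n, y.coeff k = 0) → ∀ k < n, (x + y).coeff k = 0 := by
    intro x y n hx hy k hk
    rw [HahnSeries.coeff_add, hx k hk, hy k hk, add_zero]
  have vm : ∀ (x : LaurentSeries DiffPoly) (n : ℤ), (∀ k < n, x.coeff k = 0) →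
      ∀ k < n, (-x).coeff k = 0 := by
    intro x n hx k hk
    rw [HahnSeries.coeff_neg, hx k hk, neg_zero]
  have vC : ∀ (a : DiffPoly), ∀ k < (0 : ℤ), (HahnSeries.C a : LaurentSeries DiffPoly).coeff k = 0 := by
    intro a k hk
    rw [HahnSeries.C_apply, HahnSeries.coeff_single, if_neg (by omega)]
  set t : LaurentSeries DiffPoly := HahnSeries.single (1 : ℤ) (1 : DiffPoly) with ht
  have vt : ∀ k < (1 : ℤ), t.coeff k = 0 := by
    intro k hk
    rw [ht, HahnSeries.coeff_single, if_neg (by omega)]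
  set δ := b - c with hδ
  set M : LaurentSeries DiffPoly := half * (b * serD (serD δ)) + half * (serD (serD c) * δ)
    + -(half * half * ((serD b + serD c) * serD δ))
    + -(HahnSeries.C (-2 * (MvPolynomial.X 0 : DiffPoly)) * ((b + c) * δ)) with hM
  have hD : serD δ = serD b - serD c := serD_sub b c
  have hDD : serD (serD δ) = serD (serD b) - serD (serD c) := by rw [hD, serD_sub]
  have key : δ = half * (t * M + -(((b - 1) + (c - 1)) * δ)) := by
    have e1 : (b + c) * δ = t * M := by
      rw [hM, hDD, hD, hδ]
      rw [lamSub] at hb hc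
      linear_combination t * hb - t * hc - (b + c) * (b - c) * lam_mul_single
    linear_combination half * e1 - δ * half_two
  have main : ∀ n : ℕ, ∀ k < (n : ℤ), δ.coeff k = 0 := by
    intro n
    induction n with
    | zero =>
      intro k hk
      rw [hδ, HahnSeries.coeff_sub, vb k (by simpa using hk), vc k (by simpa using hk), sub_zero]
    | succ n ih =>
      have z : ∀ x : LaurentSeries DiffPoly, (∀ k < (0 : ℤ), x.coeff k = 0) →
          ∀ y : LaurentSeries DiffPoly, (∀ k < (n : ℤ), y.coeff k = 0) →
          ∀ k < (n : ℤ), (x * y).coeff k = 0 := by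
        intro x hx y hy k hk
        exact vanish_mul hx hy k (by omega)
      have hh : ∀ k < (0 : ℤ), half.coeff k = 0 := vC _
      have hMv : ∀ k < (n : ℤ), M.coeff k = 0 := by
        refine vs _ _ _ (vs _ _ _ (vs _ _ _ ?_ ?_) (vm _ _ ?_)) (vm _ _ ?_)
        · exact z _ hh _ (z _ vb _ (vD _ _ (vD _ _ ih)))
        · exact z _ hh _ (z _ (vD _ _ (vD _ _ vc)) _ ih)
        · refine z _ (fun k hk => vanish_mul hh hh k (by omega)) _
            (z _ (vs _ _ _ (vD _ _ vb) (vD _ _ vc)) _ (vD _ _ ih))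
        · exact z _ (vC _) _ (z _ (vs _ _ _ vb vc) _ ih)
      intro k hk
      rw [key, half_mul_coeff, vs _ _ (1 + n) (vanish_mul vt hMv)
        (vm _ _ (vanish_mul (vs _ _ _ hb1 hc1) ih)) k (by push_cast at hk; omega), mul_zero]
  have : δ = 0 := by
    ext1; funext k
    rw [main (k.toNat + 1) k (by push_cast; omega)]; rfl
  exact sub_eq_zero.mp this

theorem IsBasicMatrixResolvent.quadratic {R : Matrix (Fin 2) (Fin 2) (LaurentSeries DiffPoly)}
    (h : IsBasicMatrixResolvent R) :
    half * half * (serD (R 0 1) * serD (R 0 1)) + lamSub * (R 0 1 * R 0 1)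
      - half * (R 0 1 * serD (serD (R 0 1))) = lam DiffPoly := by
  have hs := h.trace_sq
  have e := h.eq_resolventOf
  have e00 : R 0 0 = half * serD (R 0 1) := by
    simpa [resolventOf] using congrFun (congrFun e 0) 0
  have e10 : R 1 0 = lamSub * R 0 1 - half * serD (serD (R 0 1)) := by
    simpa [resolventOf] using congrFun (congrFun e 1) 0
  have e11 : R 1 1 = -(half * serD (R 0 1)) := by
    simpa [resolventOf] using congrFun (congrFun e 1) 1
  simp only [Matrix.trace_fin_two, Matrix.mul_apply, Fin.sum_univ_two, e00, e10, e11] at hs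
  linear_combination half * hs + (lam DiffPoly - (half * half * (serD (R 0 1) * serD (R 0 1))
    + lamSub * (R 0 1 * R 0 1) - half * (R 0 1 * serD (serD (R 0 1))))) * half_two

theorem IsBasicMatrixResolvent.leading_b {R : Matrix (Fin 2) (Fin 2) (LaurentSeries DiffPoly)}
    (h : IsBasicMatrixResolvent R) : ∀ k < 1, (R 0 1 - 1).coeff k = 0 := by
  intro k hk
  have := h.leading 0 1 (-k) (by simp; omega)
  simpa [LambdaMat] using this

/-- The basic matrix resolvent exists and is unique. -/
theorem existsUnique_basicMatrixResolvent :
    ∃! R : Matrix (Fin 2) (Fin 2) (LaurentSeries DiffPoly), IsBasicMatrixResolvent R := by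
  refine ⟨_, isBasicMatrixResolvent_resolventOf, fun R hR => ?_⟩
  have h0 := isBasicMatrixResolvent_resolventOf
  have hb : R 0 1 = bSeries :=
    quadratic_unique hR.quadratic bSeries_quadratic hR.leading_b
      (by simpa [resolventOf] using h0.leading_b)
  rw [hR.eq_resolventOf, hb]

/-- The basic matrix resolvent `R(λ)` of `∂ + Λ(λ) + q`. -/
def basicMatrixResolvent : Matrix (Fin 2) (Fin 2) (LaurentSeries DiffPoly) :=
  existsUnique_basicMatrixResolvent.choose

theorem basicMatrixResolvent_spec : IsBasicMatrixResolvent basicMatrixResolvent :=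
  existsUnique_basicMatrixResolvent.choose_spec.1

/-- The series `b(λ, x)` of the KdV solution with initial data `f`: the upper right entry of the
basic matrix resolvent with `f⁽ⁱ⁾(x)` substituted for `uᵢ` in each coefficient. -/
def bAt (f : ℂ → ℂ) (x : ℂ) : LaurentSeries ℂ :=
  HahnSeries.map (basicMatrixResolvent 0 1) (MvPolynomial.eval fun i : ℕ => iteratedDeriv i f x)

/-! ## Square roots of Laurent series in `λ⁻¹` -/

/-- `r` is the square root of `F` with positive leading coefficient
(the coefficient of the highest power of `λ`). -/
def IsSeriesSqrt (r F : LaurentSeries ℂ) : Prop :=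
  r ^ 2 = F ∧ ∃ c : ℝ, 0 < c ∧ r.leadingCoeff = (c : ℂ)

/-! ## The spectral curve -/

/-- The action of the operator `∑_{j ≤ n} aⱼ(x) ∂ₓʲ` on a function `ψ`. -/
def diffOp (a : ℕ → ℂ → ℂ) (n : ℕ) (ψ : ℂ → ℂ) : ℂ → ℂ :=
  fun x => ∑ j ∈ Finset.range (n + 1), a j x * iteratedDeriv j ψ x

/-- The Lax (Schrödinger) operator `L = ∂ₓ² + 2f(x)`. -/
def laxOp (f : ℂ → ℂ) (ψ : ℂ → ℂ) : ℂ → ℂ :=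
  fun x => iteratedDeriv 2 ψ x + 2 * f x * ψ x

/-- The operator `S(L)`, for a polynomial `S` and `L = ∂ₓ² + 2f(x)`. -/
def polyLaxOp (f : ℂ → ℂ) (S : ℂ[X]) (ψ : ℂ → ℂ) : ℂ → ℂ :=
  fun x => ∑ k ∈ Finset.range (S.natDegree + 1), S.coeff k * ((laxOp f)^[k] ψ) x

/-- `∑_{j ≤ n} aⱼ(x) ∂ₓʲ` is a monic operator of order `n` with coefficients analytic on `U`, and it
commutes with `L = ∂ₓ² + 2f(x)` on `U`. -/
structure IsCommutingOp (U : Set ℂ) (f : ℂ → ℂ) (a : ℕ → ℂ → ℂ) (n : ℕ) : Prop where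
  analytic : ∀ j ≤ n, AnalyticOnNhd ℂ (a j) U
  monic : ∀ x ∈ U, a n x = 1
  commute : ∀ ψ : ℂ → ℂ, AnalyticOnNhd ℂ ψ U → ∀ x ∈ U,
    diffOp a n (laxOp f ψ) x = laxOp f (diffOp a n ψ) x

/-- `y² = S(λ)` is the spectral curve of the finite-gap (algebro-geometric) potential `f` on `U`:
`A² = S(L)` for some monic operator `A` of odd order `2g + 1` commuting with `L = ∂ₓ² + 2f(x)`,
where no monic operator of smaller odd order commutes with `L`. -/
def IsSpectralPolynomial (U : Set ℂ) (f : ℂ → ℂ) (S : ℂ[X]) : Prop :=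
  ∃ (g : ℕ) (a : ℕ → ℂ → ℂ), IsCommutingOp U f a (2 * g + 1) ∧
    (∀ ψ : ℂ → ℂ, AnalyticOnNhd ℂ ψ U → ∀ x ∈ U,
      diffOp a (2 * g + 1) (diffOp a (2 * g + 1) ψ) x = polyLaxOp f S ψ x) ∧
    ∀ g' < g, ¬ ∃ a' : ℕ → ℂ → ℂ, IsCommutingOp U f a' (2 * g' + 1)

/-! ## Lamé initial data -/

/-- The periods `1` and `τ`. -/
def tauPeriods (τ : UpperHalfPlane) : PeriodPair where
  ω₁ := 1
  ω₂ := (τ : ℂ)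
  indep := by
    rw [LinearIndependent.pair_iff]
    intro s t h
    have him := congrArg Complex.im h
    have hre := congrArg Complex.re h
    simp at him hre
    have ht : t = 0 := by
      rcases him with h1 | h1
      · exact h1
      · exact absurd h1 τ.im_ne_zero
    refine ⟨?_, ht⟩
    rw [ht] at hre
    simpa using hre

/-- The complement of the lattice `ℤ + ℤτ`, where `℘(·; τ)` is analytic. -/
def regularSet (τ : UpperHalfPlane) : Set ℂ := ((tauPeriods τ).lattice : Set ℂ)ᶜ

/-- The Lamé initial data `f(x) = C ℘(x; τ)`. -/
def lameData (C : ℂ) (τ : UpperHalfPlane) : ℂ → ℂ :=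
  fun x => C * (tauPeriods τ).weierstrassP x

/-- The value at `(X, λ)` of a polynomial in `λ` whose coefficients are polynomials in `X`, where
`X` is a number and `λ` stays the formal variable. -/
def evalXLam (Q : Polynomial ℂ[X]) (X : ℂ) : LaurentSeries ℂ :=
  Polynomial.aeval (lam ℂ) (Q.map (Polynomial.evalRingHom X))

/-- The invariant `g₂ = 60 G₄` of the lattice `ℤ + ℤτ`, as a constant series. -/
def serG₂ (τ : UpperHalfPlane) : LaurentSeries ℂ := HahnSeries.C (tauPeriods τ).g₂

/-- The invariant `g₃ = 140 G₆` of the lattice `ℤ + ℤτ`, as a constant series. -/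
def serG₃ (τ : UpperHalfPlane) : LaurentSeries ℂ := HahnSeries.C (tauPeriods τ).g₃

/-- The value `℘(x; τ)`, as a constant series. -/
def serP (τ : UpperHalfPlane) (x : ℂ) : LaurentSeries ℂ :=
  HahnSeries.C ((tauPeriods τ).weierstrassP x)

end KdVLame

end

/-! Write `N = p(p+1)`, `v = 2f = -N℘` and `L = D² + v`. The defining equations of the resolvent
reduce to one quadratic equation for its upper right entry, `b'² - 2bb'' + 4(λ - v)b² = 4λ`, whose
solution with leading term `1` is unique, because each coefficient is given by a recursion in the
previous ones. So if `F(λ, x)` is polynomial in `λ`, monic, and satisfies `F'² - 2FF'' + 4(λ - v)F²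
= 4S(λ)`, then `b = F / √(S/λ)`.

Such an `F` comes from the products of solutions of the Lamé equation `ψ'' = (N℘ + λ)ψ`. They
satisfy a linear third-order equation (`lameThird`), and the left side above is its first integral
(`derivative_lameQuad`). In the variable `X = ℘` the equation is a recursion for the coefficients,
descending in the power of `X`, with indicial factor `(2j+1)(j(j+1) - N)`. The only natural root is
`j = p`, so the polynomial solutions are exactly the `ℂ[λ]`-multiples of one polynomial `Q`, of
degree `p` in `X` and monic of degree `p` in `λ` (`exists_lamePolynomial`). Its first integral is
`4S` with `S` monic of degree `2p + 1` (`exists_lameQuad_eq`).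

The same `S` is the spectral curve. Every differential operator is uniquely of the form `∑ (F_k D +
G_k) L^k`. With `F = ∑ F_k λ^k` and `G = ∑ G_k λ^k`, it commutes with `L` exactly when `F'' + 2G' =
0` and `2(λ - v)F' - v'F + G'' = 0`. Eliminating `G` gives the third-order equation for `F`. For an
operator that is monic of odd order, `F` is monic in `λ`; its coefficients can then be integrated
one after the other, and each is a polynomial in `℘` (`coeff_mem_range`). Hence `F = q(λ) Q`, and
the order is at least `2p + 1`. In order `2p + 1` one has `F = Q`. If moreover the square is a
polynomial in `L`, then `G = -Q'/2` and that polynomial is `S`. This argument is carried out in a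
differential domain with field of constants `ℂ`, and then applied to the analytic functions off the
lattice.

For `p = 1, 2, 3` the formulas follow by exhibiting `Q` and expanding its first integral. -/

noncomputable section

open Polynomial

namespace KdVLame

/-! ### The symmetric square of the Lamé equation in the variable `X = ℘`, and its first integral.
-/

section LameEquation

variable {R R' : Type*} [CommRing R] [CommRing R']

/-- The cubic `4X³ - g₂X - g₃`. -/
def weierstrassCubic (g₂ g₃ : R) : R[X] := 4 * X ^ 3 - C g₂ * X - C g₃

theorem derivative_weierstrassCubic (g₂ g₃ : R) :
    derivative (weierstrassCubic g₂ g₃) = 12 * X ^ 2 - C g₂ := by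
  simp [weierstrassCubic]
  rw [C_ofNat]
  ring

/-- If `℘'² = 4℘³ - g₂℘ - g₃`, then `2 ∂²(W(℘)) = (flowTwice W)(℘)`. -/
def flowTwice (g₂ g₃ : R) (W : R[X]) : R[X] :=
  2 * derivative (derivative W) * weierstrassCubic g₂ g₃
    + derivative W * derivative (weierstrassCubic g₂ g₃)

/-- The symmetric square of the Lamé equation `ψ'' = (N℘ + ℓ)ψ`, in the variable `X = ℘`. -/
def lameThird (g₂ g₃ ℓ : R) (N : ℕ) (W : R[X]) : R[X] :=
  derivative (flowTwice g₂ g₃ W) - 4 * (N : R[X]) * (2 * X * derivative W + W)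
    - 8 * C ℓ * derivative W

/-- The first integral of `lameThird`. -/
def lameQuad (g₂ g₃ ℓ : R) (N : ℕ) (W : R[X]) : R[X] :=
  derivative W ^ 2 * weierstrassCubic g₂ g₃ - W * flowTwice g₂ g₃ W
    + 4 * (C ℓ + (N : R[X]) * X) * W ^ 2

/-- A third-order equation that is a symmetric square becomes a total derivative after
multiplication by its solution. Thus `lameQuad` is free of `X` on solutions; conversely, over a
domain, a nonzero `W` with `lameQuad` free of `X` is a solution. -/
theorem derivative_lameQuad (g₂ g₃ ℓ : R) (N : ℕ) (W : R[X]) :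
    derivative (lameQuad g₂ g₃ ℓ N W) = -W * lameThird g₂ g₃ ℓ N W := by
  rw [lameQuad, lameThird]
  simp only [derivative_add, derivative_sub, derivative_mul, derivative_pow, derivative_C,
    derivative_X, derivative_natCast, derivative_ofNat]
  rw [flowTwice]
  simp only [Nat.cast_ofNat, map_ofNat]
  ring

/-- Read as a recursion descending in `j`: the factor of `W.coeff j` vanishes, in characteristic
zero, only if `j(j+1) = N`, and all other terms have higher index. -/
theorem coeff_lameThird (g₂ g₃ ℓ : R) (N : ℕ) (W : R[X]) (j : ℕ) :
    (lameThird g₂ g₃ ℓ N W).coeff j =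
      4 * (2 * j + 1) * (j * (j + 1) - N) * W.coeff j - 8 * ℓ * (j + 1) * W.coeff (j + 1)
        - g₂ * (j + 1) * (j + 2) * (2 * j + 3) * W.coeff (j + 2)
        - 2 * g₃ * (j + 1) * (j + 2) * (j + 3) * W.coeff (j + 3) := by
  have e : flowTwice g₂ g₃ W = C 8 * (derivative (derivative W) * X ^ 3)
      - C (2 * g₂) * (derivative (derivative W) * X ^ 1) - C (2 * g₃) * derivative (derivative W)
      + C 12 * (derivative W * X ^ 2) - C g₂ * derivative W := by
    rw [flowTwice, derivative_weierstrassCubic, weierstrassCubic]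
    simp only [map_mul, map_ofNat]
    ring
  have e' : lameThird g₂ g₃ ℓ N W = derivative (flowTwice g₂ g₃ W)
      - C (8 * (N : R)) * (derivative W * X ^ 1) - C (4 * (N : R)) * W
      - C (8 * ℓ) * derivative W := by
    rw [lameThird]
    simp only [map_mul, map_ofNat, map_natCast]
    ring
  rw [e']
  simp only [coeff_sub, coeff_derivative, e, coeff_add, coeff_C_mul, coeff_mul_X_pow']
  rcases j with _ | _ | j
  -- For `j = 0, 1` some of the shifts by powers of `X` fall below degree zero, so these cases are
  -- separate.
  · simp
    ring
  · simp
    ring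
  · have h1 : j + 1 + 1 + 1 - 3 = j := by omega
    have h2 : j + 1 + 1 + 1 - 2 = j + 1 := by omega
    have h3 : j + 1 + 1 + 1 - 1 = j + 2 := by omega
    have h4 : j + 1 + 1 - 1 = j + 1 := by omega
    have h5 : 3 ≤ j + 1 + 1 + 1 := by omega
    have h6 : 2 ≤ j + 1 + 1 + 1 := by omega
    have h7 : 1 ≤ j + 1 + 1 + 1 := by omega
    have h8 : 1 ≤ j + 1 + 1 := by omega
    simp only [h1, h2, h3, h4, if_pos h5, if_pos h6, if_pos h7, if_pos h8]
    push_cast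
    ring

theorem map_weierstrassCubic (φ : R →+* R') (g₂ g₃ : R) :
    (weierstrassCubic g₂ g₃).map φ = weierstrassCubic (φ g₂) (φ g₃) := by
  simp [weierstrassCubic]

theorem map_flowTwice (φ : R →+* R') (g₂ g₃ : R) (W : R[X]) :
    (flowTwice g₂ g₃ W).map φ = flowTwice (φ g₂) (φ g₃) (W.map φ) := by
  simp [flowTwice, map_weierstrassCubic, ← derivative_map]

theorem map_lameQuad (φ : R →+* R') (g₂ g₃ ℓ : R) (N : ℕ) (W : R[X]) :
    (lameQuad g₂ g₃ ℓ N W).map φ = lameQuad (φ g₂) (φ g₃) (φ ℓ) N (W.map φ) := by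
  simp [lameQuad, map_flowTwice, map_weierstrassCubic, ← derivative_map]

theorem lameThird_sub (g₂ g₃ ℓ : R) (N : ℕ) (V W : R[X]) :
    lameThird g₂ g₃ ℓ N (V - W) = lameThird g₂ g₃ ℓ N V - lameThird g₂ g₃ ℓ N W := by
  simp only [lameThird, flowTwice, derivative_sub, derivative_add, derivative_mul]
  ring

theorem lameThird_C_mul (g₂ g₃ ℓ : R) (N : ℕ) (a : R) (W : R[X]) :
    lameThird g₂ g₃ ℓ N (C a * W) = C a * lameThird g₂ g₃ ℓ N W := by
  simp only [lameThird, flowTwice, derivative_add, derivative_mul, derivative_C, zero_mul,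
    zero_add]
  ring

theorem lameQuad_C_mul (g₂ g₃ ℓ : R) (N : ℕ) (a : R) (W : R[X]) :
    lameQuad g₂ g₃ ℓ N (C a * W) = C (a ^ 2) * lameQuad g₂ g₃ ℓ N W := by
  simp only [lameQuad, flowTwice, derivative_mul, derivative_C, map_pow, zero_mul, zero_add]
  ring

end LameEquation

/-! ### The polynomial solution: existence, uniqueness up to a factor in `ℂ[λ]`, and degrees. -/

section LamePolynomial

variable (g₂ g₃ : ℂ) (p : ℕ)

/-- Three consecutive coefficients, in decreasing order of the exponent of `X`, of the
unnormalised polynomial solution of `lameThird`. -/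
def lameState : ℕ → ℂ[X] × ℂ[X] × ℂ[X]
  | 0 => (1, 0, 0)
  | i + 1 =>
    let s := lameState i
    let j : ℂ := (p : ℂ) - (i + 1)
    (C (4 * (2 * j + 1) * (j * (j + 1) - p * (p + 1)))⁻¹ *
      (C (8 * (j + 1)) * (X * s.1) + C (g₂ * (j + 1) * (j + 2) * (2 * j + 3)) * s.2.1
        + C (2 * g₃ * (j + 1) * (j + 2) * (j + 3)) * s.2.2), s.1, s.2.1)

/-- The inner variable is `λ`. Only the term from the next higher power of `℘` carries a factor `λ`,
so each step raises the degree in `λ` by at most one. -/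
theorem lameState_natDegree (i : ℕ) : (lameState g₂ g₃ p i).1.natDegree ≤ i ∧
    (lameState g₂ g₃ p i).2.1.natDegree ≤ i ∧ (lameState g₂ g₃ p i).2.2.natDegree ≤ i := by
  induction i with
  | zero => simp [lameState]
  | succ i ih =>
    obtain ⟨h1, h2, h3⟩ := ih
    refine ⟨?_, by simp only [lameState]; omega, by simp only [lameState]; omega⟩
    simp only [lameState]
    refine (natDegree_C_mul_le _ _).trans (natDegree_add_le_of_degree_le
      (natDegree_add_le_of_degree_le ?_ ?_) ?_)
    · refine (natDegree_C_mul_le _ _).trans (natDegree_mul_le.trans ?_)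
      have := natDegree_X_le (R := ℂ)
      omega
    · exact (natDegree_C_mul_le _ _).trans (by omega)
    · exact (natDegree_C_mul_le _ _).trans (by omega)

/-- The exponent `j = p - (i + 1)` is a natural number below `p`, so `j(j+1) < p(p+1)`. -/
theorem lame_indicial_ne_zero {i : ℕ} (hi : i < p) :
    (4 * (2 * ((p : ℂ) - (i + 1)) + 1) *
      (((p : ℂ) - (i + 1)) * (((p : ℂ) - (i + 1)) + 1) - p * (p + 1))) ≠ 0 := by
  obtain ⟨j, rfl⟩ : ∃ j, p = i + 1 + j := ⟨p - (i + 1), by omega⟩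
  have e1 : ((i + 1 + j : ℕ) : ℂ) - (i + 1) = j := by push_cast; ring
  rw [e1]
  refine mul_ne_zero (mul_ne_zero (by norm_num) (by exact_mod_cast Nat.succ_ne_zero (2 * j))) ?_
  intro h
  have h' : ((j * (j + 1) : ℕ) : ℂ) = ((i + 1 + j) * (i + 1 + j + 1) : ℕ) := by
    push_cast at h ⊢
    linear_combination h
  have h'' := Nat.cast_injective h'
  nlinarith

/-- The top coefficient in `λ` is multiplied at each step by `8(j+1)` over the indicial factor; the
other two terms have too small a degree in `λ`. -/
theorem lameState_coeff_ne_zero (i : ℕ) (hi : i ≤ p) : (lameState g₂ g₃ p i).1.coeff i ≠ 0 := by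
  induction i with
  | zero => simp [lameState]
  | succ i ih =>
    obtain ⟨-, h2, h3⟩ := lameState_natDegree g₂ g₃ p i
    simp only [lameState, coeff_C_mul, coeff_add, coeff_X_mul]
    rw [coeff_eq_zero_of_natDegree_lt (p := (lameState g₂ g₃ p i).2.1) (by omega),
      coeff_eq_zero_of_natDegree_lt (p := (lameState g₂ g₃ p i).2.2) (by omega)]
    have hj : (8 : ℂ) * ((p : ℂ) - (i + 1) + 1) ≠ 0 := by
      obtain ⟨j, rfl⟩ : ∃ j, p = i + 1 + j := ⟨p - (i + 1), by omega⟩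
      have e1 : ((i + 1 + j : ℕ) : ℂ) - (i + 1) + 1 = ((j + 1 : ℕ) : ℂ) := by push_cast; ring
      rw [e1]
      exact mul_ne_zero (by norm_num) (by exact_mod_cast Nat.succ_ne_zero j)
    simpa only [mul_zero, add_zero] using mul_ne_zero
      (inv_ne_zero (lame_indicial_ne_zero p (show i < p by omega))) (mul_ne_zero hj (ih (by omega)))

/-- The unnormalised polynomial solution of `lameThird`. -/
def lameSol : (ℂ[X])[X] := ∑ j ∈ Finset.range (p + 1), monomial j (lameState g₂ g₃ p (p - j)).1

theorem coeff_lameSol (j : ℕ) : (lameSol g₂ g₃ p).coeff j =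
    if j ≤ p then (lameState g₂ g₃ p (p - j)).1 else 0 := by
  simp only [lameSol, finsetSum_coeff, coeff_monomial, Finset.sum_ite_eq', Finset.mem_range,
    Nat.lt_succ_iff]

theorem lameThird_lameSol :
    lameThird (C g₂) (C g₃) X (p * (p + 1)) (lameSol g₂ g₃ p) = 0 := by
  ext1 j
  rw [coeff_lameThird]
  rcases lt_trichotomy j p with h | rfl | h
  · obtain ⟨i, rfl⟩ : ∃ i, p = i + 1 + j := ⟨p - (j + 1), by omega⟩
    set p := i + 1 + j with hp
    have s0 : (lameSol g₂ g₃ p).coeff j = (lameState g₂ g₃ p (i + 1)).1 := by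
      rw [coeff_lameSol, if_pos (by omega)]
      congr 2; omega
    have s1 : (lameSol g₂ g₃ p).coeff (j + 1) = (lameState g₂ g₃ p i).1 := by
      rw [coeff_lameSol, if_pos (by omega)]
      congr 2; omega
    -- For small `i` the exponents `j + 2` and `j + 3` exceed `p`; the zeros of the initial state
    -- stand for these coefficients.
    have s2 : (lameSol g₂ g₃ p).coeff (j + 2) = (lameState g₂ g₃ p i).2.1 := by
      rcases i with _ | i
      · rw [coeff_lameSol, if_neg (by omega)]; rfl
      · rw [coeff_lameSol, if_pos (by omega), show p - (j + 2) = i by omega]; rfl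
    have s3 : (lameSol g₂ g₃ p).coeff (j + 3) = (lameState g₂ g₃ p i).2.2 := by
      rcases i with _ | _ | i
      · rw [coeff_lameSol, if_neg (by omega)]; rfl
      · rw [coeff_lameSol, if_neg (by omega)]; rfl
      · rw [coeff_lameSol, if_pos (by omega), show p - (j + 3) = i by omega]; rfl
    have hj : (p : ℂ) - (i + 1) = j := by rw [hp]; push_cast; ring
    have hne := lame_indicial_ne_zero p (show i < p by omega)
    rw [s0, s1, s2, s3, coeff_zero]
    simp only [lameState]
    rw [hj] at hne ⊢
    have hc := congrArg (C : ℂ → ℂ[X]) (mul_inv_cancel₀ hne)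
    rw [C_mul] at hc
    generalize (C (4 * (2 * (j : ℂ) + 1) * (j * (j + 1) - p * (p + 1)))⁻¹ : ℂ[X]) = c at hc ⊢
    simp only [map_mul, map_add, map_sub, map_ofNat, map_natCast, map_one] at hc ⊢
    push_cast
    linear_combination (8 * (j + 1) * (X * (lameState g₂ g₃ p i).1)
      + C g₂ * (j + 1) * (j + 2) * (2 * j + 3) * (lameState g₂ g₃ p i).2.1
      + 2 * C g₃ * (j + 1) * (j + 2) * (j + 3) * (lameState g₂ g₃ p i).2.2) * hc
  -- At `j = p` the indicial factor vanishes, so the top coefficient is free.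
  · simp [coeff_lameSol]
  · simp [coeff_lameSol, show ¬ j ≤ p by omega, show ¬ j + 1 ≤ p by omega,
      show ¬ j + 2 ≤ p by omega, show ¬ j + 3 ≤ p by omega]

/-- In the top degree only the indicial term survives, so a nonzero solution has degree exactly `p`.
-/
theorem eq_zero_of_lameThird_eq_zero {W : (ℂ[X])[X]} {g₂ g₃ : ℂ} {p : ℕ}
    (hW : lameThird (C g₂) (C g₃) X (p * (p + 1)) W = 0) (hp : W.coeff p = 0) : W = 0 := by
  by_contra hne
  have h := congrArg (fun V => coeff V W.natDegree) hW
  simp only [coeff_lameThird, coeff_zero] at h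
  rw [coeff_eq_zero_of_natDegree_lt (show W.natDegree < W.natDegree + 1 by omega),
    coeff_eq_zero_of_natDegree_lt (show W.natDegree < W.natDegree + 2 by omega),
    coeff_eq_zero_of_natDegree_lt (show W.natDegree < W.natDegree + 3 by omega)] at h
  simp only [mul_zero, sub_zero, mul_eq_zero, coeff_natDegree, leadingCoeff_eq_zero, hne,
    or_false] at h
  have hd : W.natDegree ≠ p := fun h => hne (leadingCoeff_eq_zero.mp (by rwa [← h] at hp))
  rcases h with (h | h) | h
  · norm_num at h
  · exact_mod_cast h
  · rw [sub_eq_zero] at h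
    have h' : W.natDegree * (W.natDegree + 1) = p * (p + 1) := by exact_mod_cast h
    rcases lt_or_gt_of_ne hd with h1 | h1 <;> nlinarith

/-- The Lamé polynomial: the polynomial solution of `lameThird`, of degree `p` in `X` and monic of
degree `p` in `λ`. -/
theorem exists_lamePolynomial : ∃ Q : (ℂ[X])[X],
    lameThird (C g₂) (C g₃) X (p * (p + 1)) Q = 0 ∧ Q.natDegree = p ∧
    (∀ j, (Q.coeff j).natDegree ≤ p) ∧ (∀ j, (Q.coeff j).coeff p = if j = 0 then 1 else 0) ∧
    ∀ W, lameThird (C g₂) (C g₃) X (p * (p + 1)) W = 0 → ∃ q : ℂ[X], W = C q * Q := by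
  -- `lameSol` has coefficient `1` at `X ^ p`. Dividing by its coefficient at `λ ^ p X ^ 0` makes it
  -- monic in `λ`; no other power of `X` reaches the degree `p` in `λ`.
  set a := (lameState g₂ g₃ p p).1.coeff p with ha
  have ha0 : a ≠ 0 := lameState_coeff_ne_zero g₂ g₃ p p le_rfl
  have hp : (C (C a⁻¹) * lameSol g₂ g₃ p).coeff p = C a⁻¹ := by
    simp [coeff_C_mul, coeff_lameSol, lameState]
  refine ⟨C (C a⁻¹) * lameSol g₂ g₃ p, ?_, ?_, ?_, ?_, ?_⟩
  · rw [lameThird_C_mul, lameThird_lameSol, mul_zero]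
  · refine le_antisymm (natDegree_le_iff_coeff_eq_zero.mpr fun j hj => ?_)
      (le_natDegree_of_ne_zero ?_)
    · rw [coeff_C_mul, coeff_lameSol, if_neg (by omega), mul_zero]
    · rw [hp]; simpa using ha0
  · intro j
    rw [coeff_C_mul, coeff_lameSol]
    split_ifs
    · exact (natDegree_C_mul_le _ _).trans
        ((lameState_natDegree g₂ g₃ p _).1.trans (Nat.sub_le _ _))
    · simp
  · intro j
    rw [coeff_C_mul, coeff_lameSol, coeff_C_mul]
    rcases eq_or_ne j 0 with rfl | hj
    · simp [← ha, ha0]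
    · rw [if_neg hj]
      split_ifs
      · rw [coeff_eq_zero_of_natDegree_lt, mul_zero]
        exact (lameState_natDegree g₂ g₃ p _).1.trans_lt (by omega)
      · simp
  · intro W hW
    -- This factor makes the coefficients of `X ^ p` agree, so the difference vanishes by
    -- uniqueness.
    refine ⟨C a * W.coeff p, sub_eq_zero.mp (eq_zero_of_lameThird_eq_zero (g₂ := g₂) (g₃ := g₃)
      (p := p) ?_ ?_)⟩
    · rw [lameThird_sub, lameThird_C_mul, lameThird_C_mul, lameThird_lameSol, hW]
      simp
    · have : (C a : ℂ[X]) * C a⁻¹ = 1 := by rw [← C_mul, mul_inv_cancel₀ ha0, C_1]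
      rw [coeff_sub, coeff_C_mul, hp]
      linear_combination -W.coeff p * this

/-- The first integral of the Lamé polynomial is `4S(λ)` with `S` monic of degree `2p + 1`. -/
theorem exists_lameQuad_eq {Q : (ℂ[X])[X]} {N : ℕ}
    (hQ : lameThird (C g₂) (C g₃) X N Q = 0)
    (hdeg : ∀ j, (Q.coeff j).natDegree ≤ p)
    (hlead : ∀ j, (Q.coeff j).coeff p = if j = 0 then 1 else 0) :
    ∃ S : ℂ[X], lameQuad (C g₂) (C g₃) X N Q = C (C 4 * S) ∧ S.Monic ∧
      S.natDegree = 2 * p + 1 := by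
  have h0 := eq_C_of_derivative_eq_zero
    (show derivative (lameQuad (C g₂) (C g₃) X N Q) = 0 by rw [derivative_lameQuad, hQ, mul_zero])
  set s := (lameQuad (C g₂) (C g₃) X N Q).coeff 0 with hs
  have h4 : (C 4 * C 4⁻¹ : ℂ[X]) = 1 := by rw [← C_mul]; norm_num
  refine ⟨C 4⁻¹ * s, by rw [← mul_assoc, h4, one_mul, h0], ?_⟩
  -- The first integral is free of `X`, so its value at `X = 0` is enough. There `4λ Q₀²` has degree
  -- `2p + 1` in `λ` and the rest at most `2p`.
  have hc : s = Q.coeff 1 ^ 2 * C (-g₃) - Q.coeff 0 * (C (-4 * g₃) * Q.coeff 2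
      + C (-g₂) * Q.coeff 1) + C 4 * X * Q.coeff 0 ^ 2 := by
    rw [hs, lameQuad, flowTwice, derivative_weierstrassCubic, weierstrassCubic]
    simp only [coeff_zero_eq_eval_zero]
    simp [eval_mul, ← coeff_zero_eq_eval_zero, coeff_derivative]
    rw [C_ofNat]
    ring
  set A := Q.coeff 0
  have hA : A.Monic := monic_of_natDegree_le_of_coeff_eq_one p (hdeg 0) (by simpa using hlead 0)
  have hAd : A.degree = p := by
    rw [degree_eq_natDegree hA.ne_zero]
    exact_mod_cast le_antisymm (hdeg 0) (le_natDegree_of_ne_zero (by simp [hlead 0]))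
  have e : C 4⁻¹ * s = X * A ^ 2 + C 4⁻¹ * (Q.coeff 1 ^ 2 * C (-g₃) - A * (C (-4 * g₃) * Q.coeff 2
      + C (-g₂) * Q.coeff 1)) := by
    rw [hc]
    linear_combination X * A ^ 2 * h4
  have hM : (X * A ^ 2).Monic := monic_X.mul (hA.pow 2)
  have hMd : (X * A ^ 2).degree = ((2 * p + 1 : ℕ) : WithBot ℕ) := by
    rw [degree_mul, degree_X, degree_pow, hAd, ← Nat.cast_one (R := WithBot ℕ), nsmul_eq_mul,
      ← Nat.cast_mul, ← Nat.cast_add, add_comm]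
  have hr : (C 4⁻¹ * (Q.coeff 1 ^ 2 * C (-g₃) - A * (C (-4 * g₃) * Q.coeff 2
      + C (-g₂) * Q.coeff 1))).degree < (X * A ^ 2).degree := by
    rw [hMd]
    have h1 := hdeg 1
    have h2 := hdeg 2
    have h3 : A.natDegree ≤ p := hdeg 0
    refine lt_of_le_of_lt degree_le_natDegree (Nat.cast_lt.mpr (Nat.lt_succ_of_le ?_))
    refine (natDegree_C_mul_le _ _).trans ((natDegree_sub_le _ _).trans (max_le ?_ ?_))
    · refine (natDegree_mul_C_le _ _).trans (natDegree_pow_le.trans (by omega))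
    · refine natDegree_mul_le.trans ?_
      have : (C (-4 * g₃) * Q.coeff 2 + C (-g₂) * Q.coeff 1).natDegree ≤ p :=
        natDegree_add_le_of_degree_le ((natDegree_C_mul_le _ _).trans h2)
          ((natDegree_C_mul_le _ _).trans h1)
      omega
  rw [e]
  refine ⟨hM.add_of_left hr, natDegree_eq_of_degree_eq_some ?_⟩
  rw [degree_add_eq_left_of_degree_lt hr, hMd]

end LamePolynomial

/-! ### Change of basis along a family of monic polynomials of increasing degrees. -/

section ExpandSum

variable {A : Type*} [CommRing A]

/-- `∑ F_k e_k`. -/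
def expandSum (e : ℕ → A[X]) (F : A[X]) : A[X] := F.sum fun k h => C h * e k

theorem expandSum_natDegree {e : ℕ → A[X]} {F : A[X]} {d : ℕ → ℕ} {n : ℕ}
    (hF : F.natDegree ≤ n) (he : ∀ k, (e k).natDegree ≤ d k) (hd : StrictMono d) :
    (expandSum e F).natDegree ≤ d n := by
  rw [expandSum, sum_def]
  refine natDegree_sum_le_of_forall_le _ _ fun k hk => ?_
  refine (natDegree_C_mul_le _ _).trans ((he k).trans (hd.monotone ?_))
  exact (le_natDegree_of_mem_supp k hk).trans hF

/-- The change of basis is triangular: since `d` is strictly increasing, only the term with `k = n`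
reaches degree `d n`. -/
theorem expandSum_coeff {e : ℕ → A[X]} {F : A[X]} {d : ℕ → ℕ} {n : ℕ}
    (hF : F.natDegree ≤ n) (he : ∀ k, (e k).natDegree ≤ d k) (hd : StrictMono d)
    (h1 : ∀ k, (e k).coeff (d k) = 1) : (expandSum e F).coeff (d n) = F.coeff n := by
  rw [expandSum, sum_over_range' _ _ (n + 1) (by omega), finsetSum_coeff,
    Finset.sum_eq_single n]
  · rw [coeff_C_mul, h1, mul_one]
  · intro k hk hkn
    have : k < n := by have := Finset.mem_range.mp hk; omega
    rw [coeff_C_mul, coeff_eq_zero_of_natDegree_lt ((he k).trans_lt (hd this)), mul_zero]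
  · simp
  · simp

end ExpandSum

/-! ### Differential operators over a differential algebra, and their expansion in powers of `L = D²
+ v`. -/

section DifferentialOperators

variable {A : Type*} [CommRing A] [Algebra ℂ A]

/-- Multiplication operators. -/
abbrev mulOp : A →ₐ[ℂ] Module.End ℂ A := Algebra.lmul ℂ A

/-- A derivation as an element of the ring of endomorphisms. -/
abbrev derOp (D : Derivation ℂ A A) : Module.End ℂ A := (D : A →ₗ[ℂ] A)

theorem derOp_mul_mulOp (D : Derivation ℂ A A) (h : A) :
    derOp D * mulOp h = mulOp h * derOp D + mulOp (D h) := by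
  ext ψ
  simp [mul_comm]

/-- The operator `∑ F_k B L^k`. -/
def opSum (B L : Module.End ℂ A) : A[X] →ₗ[ℂ] Module.End ℂ A :=
  lsum fun k => LinearMap.mulRight ℂ (B * L ^ k) ∘ₗ mulOp.toLinearMap

theorem opSum_eq_sum (B L : Module.End ℂ A) (F : A[X]) :
    opSum B L F = F.sum fun k h => mulOp h * (B * L ^ k) := rfl

theorem opSum_monomial (B L : Module.End ℂ A) (k : ℕ) (h : A) :
    opSum B L (monomial k h) = mulOp h * (B * L ^ k) := by
  rw [opSum_eq_sum, sum_monomial_index]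
  simp

theorem mulOp_mul_opSum (B L : Module.End ℂ A) (h : A) (F : A[X]) :
    mulOp h * opSum B L F = opSum B L (C h * F) := by
  induction F using Polynomial.induction_on' with
  | add p q hp hq => rw [map_add, mul_add, hp, hq, mul_add, map_add]
  | monomial n a => rw [C_mul_monomial, opSum_monomial, opSum_monomial, map_mul, mul_assoc]

/-- Coefficients stand on the left, so composing with `L` on the right only shifts the powers; `X`
thus plays the role of `λ`. -/
theorem opSum_mul_right (B L : Module.End ℂ A) (F : A[X]) :
    opSum B L F * L = opSum B L (X * F) := by
  induction F using Polynomial.induction_on' with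
  | add p q hp hq => rw [map_add, add_mul, hp, hq, mul_add, map_add]
  | monomial n a =>
    rw [X_mul_monomial, opSum_monomial, opSum_monomial, pow_succ]
    simp only [mul_assoc]

theorem opSum_one_map (L : Module.End ℂ A) (S : ℂ[X]) :
    opSum 1 L (S.map (algebraMap ℂ A)) = aeval L S := by
  induction S using Polynomial.induction_on' with
  | add p q hp hq => rw [Polynomial.map_add, map_add, hp, hq, map_add]
  | monomial n a =>
    rw [map_monomial, opSum_monomial, aeval_monomial, one_mul, AlgHom.commutes]

/-- The derivation of `A[X]` acting on coefficients. -/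
def coeffDer (D : Derivation ℂ A A) : Derivation ℂ A[X] A[X] :=
  Derivation.mk' (lsum fun k => ((monomial k : A →ₗ[A] A[X]).restrictScalars ℂ) ∘ₗ (D : A →ₗ[ℂ] A))
    fun a b => by
      have hm : ∀ k h, lsum (fun k => ((monomial k : A →ₗ[A] A[X]).restrictScalars ℂ) ∘ₗ
          (D : A →ₗ[ℂ] A)) (monomial k h) = monomial k (D h) := fun k h => by
        simp [lsum, sum_monomial_index]
      induction a using Polynomial.induction_on' with
      | add p q hp hq => rw [add_mul, map_add, hp, hq, map_add, add_smul, smul_add]; abel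
      | monomial n a =>
        induction b using Polynomial.induction_on' with
        | add p q hp hq => rw [mul_add, map_add, hp, hq, map_add, add_smul, smul_add]; abel
        | monomial m b =>
          rw [monomial_mul_monomial, hm, hm, hm, Derivation.leibniz]
          simp [monomial_mul_monomial, add_comm]

theorem coeffDer_monomial (D : Derivation ℂ A A) (k : ℕ) (h : A) :
    coeffDer D (monomial k h) = monomial k (D h) := by
  change lsum _ (monomial k h) = _
  simp [lsum, sum_monomial_index]

theorem coeffDer_C (D : Derivation ℂ A A) (h : A) : coeffDer D (C h) = C (D h) :=
  coeffDer_monomial D 0 h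

theorem coeffDer_X (D : Derivation ℂ A A) : coeffDer D X = 0 := by
  rw [← monomial_one_one_eq_X, coeffDer_monomial, Derivation.map_one_eq_zero, map_zero]

theorem coeff_coeffDer (D : Derivation ℂ A A) (F : A[X]) (k : ℕ) :
    (coeffDer D F).coeff k = D (F.coeff k) := by
  induction F using Polynomial.induction_on' with
  | add p q hp hq => simp [hp, hq]
  | monomial n a =>
    rw [coeffDer_monomial, coeff_monomial, coeff_monomial]
    split_ifs <;> simp

/-- The Leibniz rule `D ∘ h = h D + D h`, on symbols. -/
theorem derOp_mul_opSum_of_commute (D : Derivation ℂ A A) (F : A[X]) :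
    derOp D * opSum 1 (derOp D) F = opSum 1 (derOp D) (X * F + coeffDer D F) := by
  rw [map_add, ← opSum_mul_right]
  induction F using Polynomial.induction_on' with
  | add p q hp hq => simp only [map_add, mul_add, add_mul, hp, hq]; abel
  | monomial n a =>
    rw [opSum_monomial, coeffDer_monomial, opSum_monomial, ← mul_assoc, derOp_mul_mulOp, one_mul,
      add_mul, mul_assoc, mul_assoc, ← pow_succ, ← pow_succ']

/-- The Schrödinger operator `D² + v`. -/
def schrOp (D : Derivation ℂ A A) (v : A) : Module.End ℂ A := derOp D * derOp D + mulOp v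

/-- The operator `∑ (F_k D + G_k) L^k`, for `L = D² + v`. -/
def pairOp (D : Derivation ℂ A A) (v : A) (F G : A[X]) : Module.End ℂ A :=
  opSum (derOp D) (schrOp D v) F + opSum 1 (schrOp D v) G

variable (D : Derivation ℂ A A) (v : A)

theorem pairOp_add (F₁ F₂ G₁ G₂ : A[X]) :
    pairOp D v (F₁ + F₂) (G₁ + G₂) = pairOp D v F₁ G₁ + pairOp D v F₂ G₂ := by
  simp only [pairOp, map_add]; abel

theorem pairOp_sub (F₁ F₂ G₁ G₂ : A[X]) :
    pairOp D v (F₁ - F₂) (G₁ - G₂) = pairOp D v F₁ G₁ - pairOp D v F₂ G₂ := by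
  simp only [pairOp, map_sub]; abel

theorem pairOp_zero_one : pairOp D v 0 1 = 1 := by
  rw [pairOp, map_zero, zero_add, ← C_1, ← monomial_zero_left, opSum_monomial,
    map_one, pow_zero, one_mul, one_mul]

theorem mulOp_mul_pairOp (h : A) (F G : A[X]) :
    mulOp h * pairOp D v F G = pairOp D v (C h * F) (C h * G) := by
  rw [pairOp, mul_add, mulOp_mul_opSum, mulOp_mul_opSum, pairOp]

theorem pairOp_mul_schrOp (F G : A[X]) :
    pairOp D v F G * schrOp D v = pairOp D v (X * F) (X * G) := by
  rw [pairOp, add_mul, opSum_mul_right, opSum_mul_right, pairOp]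

/-- Composition with `D` produces `F D²`, and `D² = L - v` restores the form with at most one `D` in
each term; this is the source of `X - C v`. -/
theorem derOp_mul_pairOp (F G : A[X]) :
    derOp D * pairOp D v F G =
      pairOp D v (coeffDer D F + G) ((X - C v) * F + coeffDer D G) := by
  have h1 : derOp D * opSum (derOp D) (schrOp D v) F =
      pairOp D v (coeffDer D F) ((X - C v) * F) := by
    rw [pairOp, sub_mul, map_sub, ← opSum_mul_right, ← mulOp_mul_opSum]
    induction F using Polynomial.induction_on' with
    | add p q hp hq => simp only [map_add, mul_add, add_mul, hp, hq]; abel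
    | monomial n a =>
      have hc : mulOp v * mulOp a = mulOp a * mulOp v := by rw [← map_mul, mul_comm, map_mul]
      have hD : derOp D * derOp D = schrOp D v - mulOp v := by rw [schrOp, add_sub_cancel_right]
      rw [coeffDer_monomial, opSum_monomial, opSum_monomial, opSum_monomial, ← mul_assoc,
        derOp_mul_mulOp, add_mul, one_mul, mul_assoc _ (derOp D), ← mul_assoc (derOp D) (derOp D),
        hD, sub_mul, mul_sub, mul_assoc _ _ (schrOp D v), ← pow_succ, ← pow_succ',
        ← mul_assoc (mulOp v), hc, mul_assoc (mulOp a) (mulOp v), add_comm]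
  have h2 : derOp D * opSum 1 (schrOp D v) G = pairOp D v G (coeffDer D G) := by
    rw [pairOp]
    induction G using Polynomial.induction_on' with
    | add p q hp hq => simp only [map_add, mul_add, hp, hq]; abel
    | monomial n a =>
      rw [coeffDer_monomial, opSum_monomial, opSum_monomial, opSum_monomial, ← mul_assoc,
        derOp_mul_mulOp, one_mul, add_mul, mul_assoc]
  rw [pairOp, mul_add, h1, h2, pairOp_add]

/-- The commutator with `L` is again in normal form. By uniqueness of that form, commuting with `L`
becomes a pair of differential equations for `F` and `G`. -/
theorem schrOp_mul_pairOp (F G : A[X]) :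
    schrOp D v * pairOp D v F G - pairOp D v F G * schrOp D v =
      pairOp D v (coeffDer D (coeffDer D F) + 2 * coeffDer D G)
        (2 * (X - C v) * coeffDer D F - C (D v) * F + coeffDer D (coeffDer D G)) := by
  rw [pairOp_mul_schrOp]
  nth_rewrite 1 [schrOp]
  rw [add_mul, mul_assoc, derOp_mul_pairOp, derOp_mul_pairOp, mulOp_mul_pairOp, ← pairOp_add,
    ← pairOp_sub]
  simp only [map_add, map_sub, Derivation.leibniz, coeffDer_X, coeffDer_C, smul_eq_mul]
  congr 1 <;> ring

/-- Since `T` commutes with `L`, it can be moved through `L ^ k` until it meets `B`. -/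
theorem opSum_mul_of_commute {B T : Module.End ℂ A} (hT : schrOp D v * T = T * schrOp D v)
    {F₁ G₁ : A[X]} (hB : B * T = pairOp D v F₁ G₁) (F : A[X]) :
    opSum B (schrOp D v) F * T = pairOp D v (F * F₁) (F * G₁) := by
  have hk : ∀ (n : ℕ) (F G : A[X]), pairOp D v F G * schrOp D v ^ n =
      pairOp D v (X ^ n * F) (X ^ n * G) := by
    intro n
    induction n with
    | zero => simp
    | succ n ih =>
      intro F G
      rw [pow_succ, ← mul_assoc, ih, pairOp_mul_schrOp, pow_succ', mul_assoc, mul_assoc]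
  induction F using Polynomial.induction_on' with
  | add p q hp hq => rw [map_add, add_mul, hp, hq, add_mul, add_mul, pairOp_add]
  | monomial n a =>
    have hc : schrOp D v ^ n * T = T * schrOp D v ^ n := (show Commute _ T from hT).pow_left n
    rw [opSum_monomial, mul_assoc, mul_assoc, hc, ← mul_assoc B, hB, hk, mulOp_mul_pairOp,
      ← C_mul_X_pow_eq_monomial, mul_assoc, mul_assoc]

theorem pairOp_mul_of_commute {T : Module.End ℂ A} (hT : schrOp D v * T = T * schrOp D v)
    {F₁ G₁ : A[X]} (hFG : T = pairOp D v F₁ G₁) (F G : A[X]) :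
    pairOp D v F G * T = pairOp D v (F * (coeffDer D F₁ + G₁) + G * F₁)
      (F * ((X - C v) * F₁ + coeffDer D G₁) + G * G₁) := by
  rw [pairOp, add_mul,
    opSum_mul_of_commute D v hT (by rw [hFG, derOp_mul_pairOp]) F,
    opSum_mul_of_commute D v hT (by rw [hFG, one_mul]) G, pairOp_add]

/-! ### Normal forms -/

variable {D}

theorem iterate_derivation_pow {x : A} (hx : D x = 1) (n j : ℕ) :
    (derOp D ^ j) (x ^ n) = (n.descFactorial j : A) * x ^ (n - j) := by
  induction j with
  | zero => simp
  | succ j ih =>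
    rw [pow_succ', Module.End.mul_apply, ih]
    change D _ = _
    rw [Derivation.leibniz, Derivation.leibniz_pow, hx, Derivation.map_natCast,
      Nat.descFactorial_succ, Nat.sub_sub]
    simp
    ring

/-- On `x ^ n`, with `D x = 1`, the powers `D ^ j` with `j > n` vanish and `D ^ n` gives `n!`. Once
the lower coefficients are known to be zero, this isolates the `n`-th one. -/
theorem opSum_one_derOp_injective {x : A} (hx : D x = 1) {H : A[X]}
    (h : opSum 1 (derOp D) H = 0) : H = 0 := by
  ext n
  induction n using Nat.strong_induction_on with
  | _ n ih =>
    have h1 := LinearMap.congr_fun h (x ^ n)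
    rw [opSum_eq_sum, sum_over_range' _ _ (max n H.natDegree + 1) (by omega),
      LinearMap.sum_apply, Finset.sum_eq_single n] at h1
    · simp only [one_mul, Module.End.mul_apply, iterate_derivation_pow hx,
        Nat.descFactorial_self, Nat.sub_self, pow_zero, mul_one, LinearMap.zero_apply] at h1
      have h2 : H.coeff n * ((n.factorial : ℕ) : A) = 0 := h1
      have h3 : ((n.factorial : ℕ) : A) * algebraMap ℂ A (n.factorial : ℂ)⁻¹ = 1 := by
        rw [← map_natCast (algebraMap ℂ A), ← map_mul, mul_inv_cancel₀, map_one]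
        exact_mod_cast n.factorial_ne_zero
      rw [coeff_zero]
      linear_combination algebraMap ℂ A (n.factorial : ℂ)⁻¹ * h2 - H.coeff n * h3
    · intro j _ hj
      rcases lt_or_gt_of_ne hj with hj | hj
      · rw [ih j hj]; simp
      · simp only [one_mul, Module.End.mul_apply, iterate_derivation_pow hx,
          Nat.descFactorial_of_lt hj]
        simp
    · intro hn
      exact absurd (Finset.mem_range.mpr (by omega)) hn
    · simp

theorem opSum_expandSum {B L B' L' : Module.End ℂ A} {e : ℕ → A[X]}
    (he : ∀ k, opSum B L (e k) = B' * L' ^ k) (F : A[X]) :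
    opSum B L (expandSum e F) = opSum B' L' F := by
  rw [expandSum, opSum_eq_sum B', sum_def, sum_def, map_sum]
  refine Finset.sum_congr rfl fun k _ => ?_
  rw [← mulOp_mul_opSum, he]

variable (D)

/-- The symbol of `D ∘ T`, from the one of `T`. -/
def symStep (H : A[X]) : A[X] := X * H + coeffDer D H

/-- The symbol of `(D² + v)^k`. -/
def schrSym (k : ℕ) : A[X] := (fun H => symStep D (symStep D H) + C v * H)^[k] 1

variable {D v}

theorem symStep_order {H : A[X]} {n : ℕ} (h : H.natDegree ≤ n) (h1 : H.coeff n = 1) :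
    (symStep D H).natDegree ≤ n + 1 ∧ (symStep D H).coeff (n + 1) = 1 := by
  constructor
  · rw [natDegree_le_iff_coeff_eq_zero] at h ⊢
    intro m hm
    obtain ⟨m, rfl⟩ : ∃ i, m = i + 1 := ⟨m - 1, by omega⟩
    rw [symStep, coeff_add, coeff_X_mul, coeff_coeffDer, h m (by omega), h (m + 1) (by omega),
      map_zero, add_zero]
  · rw [symStep, coeff_add, coeff_X_mul, coeff_coeffDer, h1,
      coeff_eq_zero_of_natDegree_lt (show H.natDegree < n + 1 by omega), map_zero, add_zero]

theorem schrSym_order (k : ℕ) :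
    (schrSym D v k).natDegree ≤ 2 * k ∧ (schrSym D v k).coeff (2 * k) = 1 := by
  induction k with
  | zero => simp [schrSym]
  | succ k ih =>
    obtain ⟨h1, h2⟩ := symStep_order (D := D) ih.1 ih.2
    obtain ⟨h3, h4⟩ := symStep_order (D := D) h1 h2
    rw [schrSym, Function.iterate_succ_apply', ← schrSym]
    refine ⟨natDegree_add_le_of_degree_le h3
      ((natDegree_C_mul_le _ _).trans (ih.1.trans (by omega))), ?_⟩
    rw [coeff_add, coeff_C_mul, coeff_eq_zero_of_natDegree_lt (ih.1.trans_lt (by omega)),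
      mul_zero, add_zero]
    exact h4

theorem opSum_schrSym (k : ℕ) : opSum 1 (derOp D) (schrSym D v k) = 1 * schrOp D v ^ k := by
  rw [one_mul]
  induction k with
  | zero =>
    rw [schrSym, Function.iterate_zero, id, ← C_1, ← monomial_zero_left, opSum_monomial,
      map_one, pow_zero, pow_zero, one_mul, one_mul]
  | succ k ih =>
    rw [schrSym, Function.iterate_succ_apply', ← schrSym, map_add, ← mulOp_mul_opSum, symStep,
      ← derOp_mul_opSum_of_commute, symStep, ← derOp_mul_opSum_of_commute, ih, pow_succ', ← mul_assoc,
      ← add_mul, ← schrOp]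

theorem opSum_symStep_schrSym (k : ℕ) :
    opSum 1 (derOp D) (symStep D (schrSym D v k)) = derOp D * schrOp D v ^ k := by
  rw [symStep, ← derOp_mul_opSum_of_commute, opSum_schrSym, one_mul]

theorem opSum_expand_pair (F G : A[X]) :
    opSum 1 (derOp D) (expandSum (fun k => symStep D (schrSym D v k)) F
      + expandSum (schrSym D v) G) = pairOp D v F G := by
  rw [map_add, opSum_expandSum opSum_symStep_schrSym, opSum_expandSum opSum_schrSym, pairOp]

theorem strictMono_two_mul_add (c : ℕ) : StrictMono fun k : ℕ => 2 * k + c := by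
  intro a b h
  simp only
  omega

theorem expand_odd {F : A[X]} {m : ℕ} (h : F.natDegree ≤ m) :
    (expandSum (fun k => symStep D (schrSym D v k)) F).natDegree ≤ 2 * m + 1 ∧
      (expandSum (fun k => symStep D (schrSym D v k)) F).coeff (2 * m + 1) = F.coeff m :=
  have hs k := symStep_order (D := D) (schrSym_order (D := D) (v := v) k).1 (schrSym_order k).2
  ⟨expandSum_natDegree (d := fun k => 2 * k + 1) h (fun k => (hs k).1) (strictMono_two_mul_add 1),
    expandSum_coeff (d := fun k => 2 * k + 1) h (fun k => (hs k).1) (strictMono_two_mul_add 1)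
      fun k => (hs k).2⟩

theorem expand_even {G : A[X]} {m : ℕ} (h : G.natDegree ≤ m) :
    (expandSum (schrSym D v) G).natDegree ≤ 2 * m ∧
      (expandSum (schrSym D v) G).coeff (2 * m) = G.coeff m :=
  ⟨expandSum_natDegree (d := fun k => 2 * k) h (fun k => (schrSym_order k).1)
    (strictMono_two_mul_add 0),
    expandSum_coeff (d := fun k => 2 * k) h (fun k => (schrSym_order k).1)
      (strictMono_two_mul_add 0) fun k => (schrSym_order k).2⟩

/-- `D L^k` is monic of odd order `2k + 1` and `L^k` monic of even order `2k`, so the leading terms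
of the two sums cannot cancel. -/
theorem pairOp_eq_zero {x : A} (hx : D x = 1) {F G : A[X]} (h : pairOp D v F G = 0) :
    F = 0 ∧ G = 0 := by
  rw [← opSum_expand_pair] at h
  have h0 := opSum_one_derOp_injective hx h
  obtain ⟨a1, a2⟩ := expand_odd (D := D) (v := v) (le_refl F.natDegree)
  obtain ⟨b1, b2⟩ := expand_even (D := D) (v := v) (le_refl G.natDegree)
  by_cases hF : F = 0
  · refine ⟨hF, ?_⟩
    rw [hF] at h0
    have h1 := congrArg (fun P => coeff P (2 * G.natDegree)) h0
    simp only [coeff_add, b2, coeff_zero] at h1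
    rw [show expandSum (fun k => symStep D (schrSym D v k)) 0 = 0 from sum_zero_index _, coeff_zero,
      zero_add] at h1
    exact leadingCoeff_eq_zero.mp h1
  · exfalso
    -- The highest order present is `2 deg F + 1` in the first case and `2 deg G` in the second.
    rcases le_or_gt G.natDegree F.natDegree with hle | hlt
    · have h1 := congrArg (fun P => coeff P (2 * F.natDegree + 1)) h0
      simp only [coeff_add, a2, coeff_zero] at h1
      rw [coeff_eq_zero_of_natDegree_lt (b1.trans_lt (by omega)), add_zero] at h1
      exact hF (leadingCoeff_eq_zero.mp h1)
    · have h1 := congrArg (fun P => coeff P (2 * G.natDegree)) h0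
      simp only [coeff_add, b2, coeff_zero] at h1
      rw [coeff_eq_zero_of_natDegree_lt (a1.trans_lt (by omega)), zero_add] at h1
      rw [leadingCoeff_eq_zero.mp h1] at hlt
      simp at hlt

theorem pairOp_inj {x : A} (hx : D x = 1) {F G F' G' : A[X]}
    (h : pairOp D v F G = pairOp D v F' G') : F = F' ∧ G = G' := by
  have := pairOp_eq_zero (v := v) hx (F := F - F') (G := G - G') (by rw [pairOp_sub, h, sub_self])
  exact ⟨sub_eq_zero.mp this.1, sub_eq_zero.mp this.2⟩

theorem exists_symbol_of_pairOp {F G : A[X]} {g : ℕ} (hF : F.natDegree ≤ g) (h1 : F.coeff g = 1)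
    (hG : G.natDegree ≤ g) : ∃ H : A[X], opSum 1 (derOp D) H = pairOp D v F G ∧
      H.natDegree ≤ 2 * g + 1 ∧ H.coeff (2 * g + 1) = 1 := by
  obtain ⟨a1, a2⟩ := expand_odd (D := D) (v := v) hF
  obtain ⟨b1, -⟩ := expand_even (D := D) (v := v) hG
  refine ⟨_, opSum_expand_pair F G, natDegree_add_le_of_degree_le a1 (b1.trans (by omega)), ?_⟩
  rw [coeff_add, a2, h1, coeff_eq_zero_of_natDegree_lt (b1.trans_lt (by omega)), add_zero]

variable (D v)

/-- The pair representing `D^j`. -/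
def derPair (j : ℕ) : A[X] × A[X] :=
  (fun P => (coeffDer D P.1 + P.2, (X - C v) * P.1 + coeffDer D P.2))^[j] (0, 1)

theorem derPair_succ (j : ℕ) : derPair D v (j + 1) =
    (coeffDer D (derPair D v j).1 + (derPair D v j).2,
      (X - C v) * (derPair D v j).1 + coeffDer D (derPair D v j).2) :=
  Function.iterate_succ_apply' _ _ _

theorem pairOp_derPair (j : ℕ) :
    pairOp D v (derPair D v j).1 (derPair D v j).2 = derOp D ^ j := by
  induction j with
  | zero => exact pairOp_zero_one D v
  | succ j ih => rw [derPair_succ, ← derOp_mul_pairOp, ih, pow_succ']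

/-- Up to terms of lower order, `D^(2i)` is `L^i` and `D^(2i+1)` is `D L^i`. -/
theorem derPair_coeff (j i : ℕ) :
    (j < 2 * i + 1 → (derPair D v j).1.coeff i = 0) ∧ (j < 2 * i → (derPair D v j).2.coeff i = 0) ∧
    (j = 2 * i + 1 → (derPair D v j).1.coeff i = 1) ∧
    (j = 2 * i → (derPair D v j).2.coeff i = 1) := by
  induction j generalizing i with
  | zero =>
    refine ⟨fun _ => by simp [derPair], fun h => ?_, fun h => by omega, fun h => ?_⟩
    · simp [derPair, coeff_one, show i ≠ 0 by omega]
    · simp [derPair, show i = 0 by omega]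
  | succ j ih =>
    obtain ⟨h1, h2, h3, h4⟩ := ih i
    simp only [derPair_succ, coeff_add, coeff_coeffDer, sub_mul, coeff_sub, coeff_C_mul]
    refine ⟨fun h => ?_, fun h => ?_, fun h => ?_, fun h => ?_⟩
    · rw [h1 (by omega), h2 (by omega)]; simp
    · obtain ⟨i, rfl⟩ : ∃ k, i = k + 1 := ⟨i - 1, by omega⟩
      rw [coeff_X_mul, h1 (by omega), h2 (by omega), (ih i).1 (by omega)]; simp
    · rw [h1 (by omega), h4 (by omega)]; simp
    · obtain ⟨i, rfl⟩ : ∃ k, i = k + 1 := ⟨i - 1, by omega⟩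
      rw [coeff_X_mul, h1 (by omega), h2 (by omega), (ih i).2.2.1 (by omega)]; simp

/-- Each `D^j` is replaced by its normal form. Only the top power `D^(2g+1)` contributes to `F.coeff
g`, so `F` inherits leading coefficient `1`. -/
theorem exists_pairOp_of_symbol {H : A[X]} {g : ℕ} (hH : H.natDegree ≤ 2 * g + 1)
    (h1 : H.coeff (2 * g + 1) = 1) : ∃ F G : A[X], opSum 1 (derOp D) H = pairOp D v F G ∧
      F.natDegree ≤ g ∧ F.coeff g = 1 := by
  refine ⟨∑ j ∈ Finset.range (2 * g + 2), C (H.coeff j) * (derPair D v j).1,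
    ∑ j ∈ Finset.range (2 * g + 2), C (H.coeff j) * (derPair D v j).2, ?_, ?_, ?_⟩
  · rw [opSum_eq_sum, sum_over_range' _ _ (2 * g + 2) (by omega)]
    · rw [pairOp, map_sum, map_sum, ← Finset.sum_add_distrib]
      refine Finset.sum_congr rfl fun j _ => ?_
      rw [one_mul, ← pairOp_derPair D v j, mulOp_mul_pairOp, pairOp]
    · simp
  · rw [natDegree_le_iff_coeff_eq_zero]
    intro i hi
    rw [finsetSum_coeff]
    refine Finset.sum_eq_zero fun j hj => ?_
    have := Finset.mem_range.mp hj
    rw [coeff_C_mul, (derPair_coeff D v j i).1 (by omega), mul_zero]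
  · rw [finsetSum_coeff, Finset.sum_range_succ, Finset.sum_eq_zero, coeff_C_mul,
      (derPair_coeff D v _ g).2.2.1 rfl, h1, zero_add, mul_one]
    intro j hj
    have := Finset.mem_range.mp hj
    rw [coeff_C_mul, (derPair_coeff D v j g).1 (by omega), mul_zero]

end DifferentialOperators

/-! ### Operators commuting with the Lamé operator, over an abstract Weierstrass element. -/

section LameOperators

variable {A : Type*} [CommRing A] [Algebra ℂ A]

/-- `P` satisfies the differential equation of the Weierstrass function, in a differential algebra
with a coordinate function and field of constants `ℂ`. -/
structure IsWeierstrassElement (D : Derivation ℂ A A) (P : A) (g₂ g₃ : ℂ) : Prop where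
  sq : D P ^ 2 = 4 * P ^ 3 - algebraMap ℂ A g₂ * P - algebraMap ℂ A g₃
  ne_zero : D P ≠ 0
  const : ∀ h, D h = 0 → ∃ c : ℂ, algebraMap ℂ A c = h
  coord : ∃ x, D x = 1

/-- Substitution of `P` for the variable of a polynomial over `ℂ[λ]`. -/
def substP (P : A) : (ℂ[X])[X] →+* A[X] := eval₂RingHom (mapRingHom (algebraMap ℂ A)) (C P)

theorem substP_monomial (P : A) (n : ℕ) (q : ℂ[X]) :
    substP P (monomial n q) = q.map (algebraMap ℂ A) * C P ^ n := by
  simp [substP]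

theorem substP_C (P : A) (q : ℂ[X]) : substP P (C q) = q.map (algebraMap ℂ A) := by
  simp [substP]

theorem substP_X (P : A) : substP P X = C P := by
  simp [substP]

theorem coeffDer_map (D : Derivation ℂ A A) (q : ℂ[X]) :
    coeffDer D (q.map (algebraMap ℂ A)) = 0 := by
  ext k
  rw [coeff_coeffDer, coeff_map, Derivation.map_algebraMap, coeff_zero]

/-- The chain rule: coefficients in `ℂ[λ]` are constants of the derivation. -/
theorem coeffDer_substP (D : Derivation ℂ A A) (P : A) (W : (ℂ[X])[X]) :
    coeffDer D (substP P W) = substP P (derivative W) * C (D P) := by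
  induction W using Polynomial.induction_on' with
  | add p q hp hq => simp only [map_add, hp, hq, add_mul]
  | monomial n q =>
    rw [derivative_monomial, substP_monomial, substP_monomial, Derivation.leibniz, coeffDer_map,
      Derivation.leibniz_pow, coeffDer_C]
    simp
    ring

theorem exists_substP_of_coeff {P : A} {F : A[X]} (h : ∀ i, ∃ φ : ℂ[X], aeval P φ = F.coeff i) :
    ∃ W, substP P W = F := by
  choose φ hφ using h
  refine ⟨∑ i ∈ Finset.range (F.natDegree + 1), (φ i).map C * C (X ^ i), ?_⟩
  have e : ∀ ψ : ℂ[X], substP P (ψ.map C) = C (aeval P ψ) := by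
    intro ψ
    induction ψ using Polynomial.induction_on' with
    | add p q hp hq => simp only [Polynomial.map_add, map_add, hp, hq]
    | monomial n a => simp [substP, aeval_monomial]
  conv_rhs => rw [F.as_sum_range_C_mul_X_pow]
  rw [map_sum]
  refine Finset.sum_congr rfl fun i _ => ?_
  rw [map_mul, e, hφ, substP_C, Polynomial.map_pow, map_X]

theorem exists_antiderivative (φ : ℂ[X]) : ∃ ψ : ℂ[X], derivative ψ = φ := by
  induction φ using Polynomial.induction_on' with
  | add p q hp hq =>
    obtain ⟨a, rfl⟩ := hp
    obtain ⟨b, rfl⟩ := hq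
    exact ⟨a + b, derivative_add⟩
  | monomial n a =>
    refine ⟨monomial (n + 1) (a / (n + 1)), ?_⟩
    rw [derivative_monomial]
    have : (n : ℂ) + 1 ≠ 0 := by exact_mod_cast n.succ_ne_zero
    push_cast
    rw [div_mul_cancel₀ _ this]

theorem substP_monic (P : A) {Q : (ℂ[X])[X]} {p : ℕ} (hdeg : ∀ j, (Q.coeff j).natDegree ≤ p)
    (hlead : ∀ j, (Q.coeff j).coeff p = if j = 0 then 1 else 0) :
    (substP P Q).natDegree ≤ p ∧ (substP P Q).coeff p = 1 := by
  have e : substP P Q = ∑ j ∈ Finset.range (Q.natDegree + 1),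
      (Q.coeff j).map (algebraMap ℂ A) * C (P ^ j) := by
    conv_lhs => rw [Q.as_sum_range]
    rw [map_sum]
    exact Finset.sum_congr rfl fun j _ => by rw [substP_monomial, C_pow]
  rw [e]
  constructor
  · exact natDegree_sum_le_of_forall_le _ _ fun j _ =>
      (natDegree_mul_C_le _ _).trans ((natDegree_map_le).trans (hdeg j))
  · rw [finsetSum_coeff, Finset.sum_eq_single 0]
    · simp [hlead]
    · intro j _ hj
      rw [coeff_mul_C, coeff_map, hlead, if_neg hj, map_zero, zero_mul]
    · simp

namespace IsWeierstrassElement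

variable {D : Derivation ℂ A A} {P : A} {g₂ g₃ : ℂ} (hP : IsWeierstrassElement D P g₂ g₃)
include hP

theorem substP_cubic : substP P (weierstrassCubic (C g₂) (C g₃)) = C (D P) ^ 2 := by
  rw [← C_pow, hP.sq, weierstrassCubic]
  simp only [map_sub, map_mul, map_pow, map_ofNat, substP_C, substP_X, map_C]

variable [IsDomain A]

theorem second : 2 * D (D P) = 12 * P ^ 2 - algebraMap ℂ A g₂ := by
  have h := congrArg D hP.sq
  have h4 : D (4 : A) = 0 := by simpa using D.map_natCast 4
  simp only [map_sub, Derivation.leibniz, Derivation.leibniz_pow, Derivation.map_algebraMap, h4,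
    smul_eq_mul, nsmul_eq_mul] at h
  refine mul_left_cancel₀ hP.ne_zero ?_
  push_cast at h
  linear_combination h

theorem two_mul_coeffDer_coeffDer (W : (ℂ[X])[X]) :
    2 * coeffDer D (coeffDer D (substP P W)) = substP P (flowTwice (C g₂) (C g₃) W) := by
  have h := congrArg (C : A → A[X]) hP.second
  rw [coeffDer_substP, Derivation.leibniz, coeffDer_substP, coeffDer_C, flowTwice,
    derivative_weierstrassCubic]
  simp only [map_add, map_mul, map_sub, map_pow, hP.substP_cubic, substP_C, substP_X, map_ofNat,
    map_C, smul_eq_mul] at h ⊢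
  linear_combination substP P (derivative W) * h

/-- Identifies `lameThird`, up to the factor `D P`, with the equation for `F` obtained by
eliminating `G` from the commutation relations with `v = -N P`. -/
theorem substP_lameThird (N : ℕ) (W : (ℂ[X])[X]) :
    substP P (lameThird (C g₂) (C g₃) X N W) * C (D P) =
      2 * coeffDer D (coeffDer D (coeffDer D (substP P W)))
        - 8 * (X - C (-(N : A) * P)) * coeffDer D (substP P W)
        + 4 * C (D (-(N : A) * P)) * substP P W := by
  have h2 : coeffDer D (2 : A[X]) = 0 := by simpa using (coeffDer D).map_natCast 2
  have h := congrArg (coeffDer D) (hP.two_mul_coeffDer_coeffDer W)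
  rw [Derivation.leibniz, h2, coeffDer_substP D P (flowTwice _ _ _)] at h
  have hv : D (-(N : A) * P) = -(N : A) * D P := by
    rw [Derivation.leibniz, map_neg, Derivation.map_natCast]; simp
  rw [hv, coeffDer_substP D P W] at *
  rw [lameThird]
  simp only [map_add, map_mul, map_sub, map_neg, substP_C, substP_X, map_ofNat, map_natCast,
    map_X, smul_eq_mul] at h ⊢
  linear_combination -h

theorem substP_lameQuad (N : ℕ) (W : (ℂ[X])[X]) :
    substP P (lameQuad (C g₂) (C g₃) X N W) =
      coeffDer D (substP P W) ^ 2 - 2 * substP P W * coeffDer D (coeffDer D (substP P W))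
        + 4 * (X - C (-(N : A) * P)) * substP P W ^ 2 := by
  have h := hP.two_mul_coeffDer_coeffDer W
  rw [lameQuad, coeffDer_substP] at *
  simp only [map_add, map_mul, map_sub, map_neg, map_pow, substP_C, substP_X, map_ofNat,
    map_natCast, map_X, hP.substP_cubic] at h ⊢
  linear_combination substP P W * h

/-- Differentiating a relation and cancelling `D P ≠ 0` gives a relation for `W'`, of smaller
degree. By induction `W' = 0`, and a constant in `X` is mapped injectively. -/
theorem substP_injective {W : (ℂ[X])[X]} (h : substP P W = 0) : W = 0 := by
  have hinj := Polynomial.map_injective _ (algebraMap ℂ A).injective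
  induction hn : W.natDegree using Nat.strong_induction_on generalizing W with
  | _ n ih =>
    have h1 := coeffDer_substP D P W
    rw [h, map_zero] at h1
    have h2 := (mul_eq_zero.mp h1.symm).resolve_right (C_ne_zero.mpr hP.ne_zero)
    have h3 : derivative W = 0 := by
      rcases Nat.eq_zero_or_pos W.natDegree with h0 | h0
      · exact derivative_of_natDegree_zero h0
      · exact ih _ (hn ▸ natDegree_derivative_lt h0.ne') h2 rfl
    have h4 := eq_C_of_derivative_eq_zero h3
    rw [h4, substP_C] at h
    rw [h4, hinj (h.trans (Polynomial.map_zero _).symm), C_0]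

/-- The coefficient of `λ^(i+1)` in the equation expresses `8 D(F_i)` through `F_{i+1}`. If
`F_{i+1}` is a polynomial in `P`, the expression is a polynomial in `P` times `D P`, hence
integrable in `ℂ[P]`; the integration constant lies in `ℂ`. The descent starts from `F_g = 1`. -/
theorem coeff_mem_range {F : A[X]} {g N : ℕ} (hF : F.natDegree ≤ g) (h1 : F.coeff g = 1)
    (h : 2 * coeffDer D (coeffDer D (coeffDer D F)) - 8 * (X - C (-(N : A) * P)) * coeffDer D F
      + 4 * C (D (-(N : A) * P)) * F = 0) (i : ℕ) : ∃ φ : ℂ[X], aeval P φ = F.coeff i := by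
  have key : ∀ m i, g ≤ m + i → ∃ φ : ℂ[X], aeval P φ = F.coeff i := by
    intro m
    induction m with
    | zero =>
      intro i hi
      rcases eq_or_lt_of_le hi with rfl | hi
      · rw [zero_add] at h1
        exact ⟨1, by rw [map_one, h1]⟩
      · exact ⟨0, by rw [map_zero, coeff_eq_zero_of_natDegree_lt (by omega)]⟩
    | succ m ih =>
      intro i hi
      obtain ⟨φ, hφ⟩ := ih (i + 1) (by omega)
      -- The integrand is the `λ`-free part of `lameThird` at `φ`, divided by `8`.
      obtain ⟨ψ, hψ⟩ := exists_antiderivative (C 8⁻¹ * (derivative (flowTwice g₂ g₃ φ)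
        - 4 * (N : ℂ[X]) * (2 * X * derivative φ + φ)))
      have hd : ∀ χ : ℂ[X], D (aeval P χ) = aeval P (derivative χ) * D P := by
        intro χ
        rw [Derivation.map_aeval, smul_eq_mul]
      have hd2 : 2 * D (D (aeval P φ)) = aeval P (flowTwice g₂ g₃ φ) := by
        have hs : aeval P (weierstrassCubic g₂ g₃) = D P ^ 2 := by
          rw [hP.sq, weierstrassCubic]
          simp only [map_sub, map_mul, map_pow, map_ofNat, aeval_C, aeval_X]
        have hs2 : aeval P (derivative (weierstrassCubic g₂ g₃)) = 2 * D (D P) := by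
          rw [hP.second, derivative_weierstrassCubic]
          simp only [map_sub, map_mul, map_pow, map_ofNat, aeval_C, aeval_X]
        rw [hd, Derivation.leibniz, hd, flowTwice]
        simp only [map_add, map_mul, hs, hs2, map_ofNat, smul_eq_mul]
        ring
      have hd3 : 2 * D (D (D (aeval P φ))) = aeval P (derivative (flowTwice g₂ g₃ φ)) * D P := by
        have h2 : D (2 : A) = 0 := by simpa using D.map_natCast 2
        have := congrArg D hd2
        rw [Derivation.leibniz, h2, hd] at this
        simpa using this
      have hc := congrArg (fun V => coeff V (i + 1)) h
      have hv : D (-(N : A) * P) = -(N : A) * D P := by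
        rw [Derivation.leibniz, map_neg, Derivation.map_natCast]; simp
      have e : 2 * coeffDer D (coeffDer D (coeffDer D F))
          - 8 * (X - C (-(N : A) * P)) * coeffDer D F + 4 * C (D (-(N : A) * P)) * F =
          C 2 * coeffDer D (coeffDer D (coeffDer D F)) - C 8 * (X * coeffDer D F)
          + C (8 * (-(N : A) * P)) * coeffDer D F + C (4 * D (-(N : A) * P)) * F := by
        simp only [map_mul, map_ofNat]
        ring
      rw [e] at hc
      simp only [coeff_add, coeff_sub, coeff_C_mul, coeff_X_mul, coeff_coeffDer, coeff_zero,
        ← hφ] at hc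
      have h8 : (8 : A) * algebraMap ℂ A 8⁻¹ = 1 := by
        rw [← map_ofNat (algebraMap ℂ A) 8, ← map_mul, mul_inv_cancel₀ (by norm_num), map_one]
      have hz : D (F.coeff i - aeval P ψ) = 0 := by
        rw [map_sub, hd, hψ]
        simp only [map_mul, map_sub, map_add, aeval_C, map_natCast, map_ofNat, aeval_X]
        rw [hv, hd3, hd] at hc
        linear_combination -algebraMap ℂ A 8⁻¹ * hc - D (F.coeff i) * h8
      obtain ⟨c, hc⟩ := hP.const _ hz
      exact ⟨ψ + C c, by rw [map_add, aeval_C, hc]; ring⟩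
  exact key g i (Nat.le_add_right g i)

/-- The commuting operators of order `2g + 1`, in normal form. -/
theorem normalForm_of_commute {Q : (ℂ[X])[X]} {N p : ℕ}
    (hdeg : ∀ j, (Q.coeff j).natDegree ≤ p)
    (hlead : ∀ j, (Q.coeff j).coeff p = if j = 0 then 1 else 0)
    (huniq : ∀ W, lameThird (C g₂) (C g₃) X N W = 0 → ∃ q : ℂ[X], W = C q * Q)
    {H : A[X]} {g : ℕ} (hH : H.natDegree ≤ 2 * g + 1) (hH1 : H.coeff (2 * g + 1) = 1)
    (hcomm : schrOp D (-(N : A) * P) * opSum 1 (derOp D) H =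
      opSum 1 (derOp D) H * schrOp D (-(N : A) * P)) :
    p ≤ g ∧ (g = p → ∃ G, opSum 1 (derOp D) H = pairOp D (-(N : A) * P) (substP P Q) G ∧
      coeffDer D (coeffDer D (substP P Q)) + 2 * coeffDer D G = 0) := by
  have := charZero_of_injective_algebraMap (algebraMap ℂ A).injective
  obtain ⟨x, hx⟩ := hP.coord
  obtain ⟨F, G, hFG, hF, hF1⟩ := exists_pairOp_of_symbol D (-(N : A) * P) hH hH1
  rw [hFG, ← sub_eq_zero, schrOp_mul_pairOp] at hcomm
  obtain ⟨h1, h2⟩ := pairOp_eq_zero hx hcomm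
  -- Twice the derivative of the first relation minus four times the second eliminates `G`.
  have h3 : 2 * coeffDer D (coeffDer D (coeffDer D F)) - 8 * (X - C (-(N : A) * P)) * coeffDer D F
      + 4 * C (D (-(N : A) * P)) * F = 0 := by
    have hn : coeffDer D (2 : A[X]) = 0 := by simpa using (coeffDer D).map_natCast 2
    have h1' := congrArg (coeffDer D) h1
    rw [map_add, Derivation.leibniz, hn, map_zero, smul_eq_mul, smul_zero, add_zero] at h1'
    linear_combination 2 * h1' - 4 * h2
  obtain ⟨W, hW⟩ := exists_substP_of_coeff (hP.coeff_mem_range hF hF1 h3)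
  rw [← hW, ← hP.substP_lameThird] at h3
  obtain ⟨q, hq⟩ := huniq W (hP.substP_injective
    ((mul_eq_zero.mp h3).resolve_right (C_ne_zero.mpr hP.ne_zero)))
  obtain ⟨hQd, hQ1⟩ := substP_monic P hdeg hlead
  have hQm : (substP P Q).Monic := monic_of_natDegree_le_of_coeff_eq_one p hQd hQ1
  have hQn : (substP P Q).natDegree = p := le_antisymm hQd (le_natDegree_of_ne_zero (by simp [hQ1]))
  have hFm : F.Monic := monic_of_natDegree_le_of_coeff_eq_one g hF hF1
  have hFn : F.natDegree = g := le_antisymm hF (le_natDegree_of_ne_zero (by simp [hF1]))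
  have hFq : q.map (algebraMap ℂ A) * substP P Q = F := by rw [← hW, hq, map_mul, substP_C]
  have hq0 : q.map (algebraMap ℂ A) ≠ 0 := fun h => hFm.ne_zero (by rw [← hFq, h, zero_mul])
  -- Comparing degrees in `λ` in `F = q Q` gives `p ≤ g`; for `g = p` the monic factor `q` has
  -- degree zero and is `1`.
  have hn : (q.map (algebraMap ℂ A)).natDegree + p = g := by
    rw [← hFn, ← hFq, natDegree_mul hq0 hQm.ne_zero, hQn]
  refine ⟨by omega, fun hg => ⟨G, ?_, ?_⟩⟩
  all_goals
    have hqm : (q.map (algebraMap ℂ A)).Monic := hQm.of_mul_monic_right (hFq ▸ hFm)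
    rw [hqm.natDegree_eq_zero.mp (by omega), one_mul] at hFq
  · rw [hFG, hFq]
  · rw [hFq, h1]

/-- For `G = -F'/2` the part of the square without `D` is a quarter of the first integral. -/
theorem square_pairOp {Q : (ℂ[X])[X]} {N : ℕ} {S : ℂ[X]}
    (hS : lameQuad (C g₂) (C g₃) X N Q = C (C 4 * S)) {G : A[X]}
    (hG : coeffDer D (substP P Q) + 2 * G = 0) :
    substP P Q * ((X - C (-(N : A) * P)) * substP P Q + coeffDer D G) + G * G =
      S.map (algebraMap ℂ A) := by
  have := charZero_of_injective_algebraMap (algebraMap ℂ A).injective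
  have h := hP.substP_lameQuad N Q
  rw [hS, substP_C, Polynomial.map_mul, map_C, map_ofNat, map_ofNat] at h
  have hn : coeffDer D (2 : A[X]) = 0 := by simpa using (coeffDer D).map_natCast 2
  have hG' := congrArg (coeffDer D) hG
  rw [map_add, Derivation.leibniz, hn, map_zero, smul_eq_mul, smul_zero, add_zero] at hG'
  have h4 : (4 : A[X]) ≠ 0 := by norm_num
  refine mul_left_cancel₀ h4 ?_
  rw [h]
  linear_combination 2 * substP P Q * hG' + (2 * G - coeffDer D (substP P Q)) * hG

/-- The commuting operator of order `2p + 1` whose square is `S(L)`. -/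
theorem exists_commuting_symbol {Q : (ℂ[X])[X]} {N p : ℕ} {S : ℂ[X]}
    (hQ : lameThird (C g₂) (C g₃) X N Q = 0) (hdeg : ∀ j, (Q.coeff j).natDegree ≤ p)
    (hlead : ∀ j, (Q.coeff j).coeff p = if j = 0 then 1 else 0)
    (hS : lameQuad (C g₂) (C g₃) X N Q = C (C 4 * S)) :
    ∃ H : A[X], H.natDegree ≤ 2 * p + 1 ∧ H.coeff (2 * p + 1) = 1 ∧
      schrOp D (-(N : A) * P) * opSum 1 (derOp D) H =
        opSum 1 (derOp D) H * schrOp D (-(N : A) * P) ∧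
      opSum 1 (derOp D) H * opSum 1 (derOp D) H = aeval (schrOp D (-(N : A) * P)) S := by
  have := charZero_of_injective_algebraMap (algebraMap ℂ A).injective
  obtain ⟨hQd, hQ1⟩ := substP_monic P hdeg hlead
  set F := substP P Q with hF
  -- This choice solves `F'' + 2G' = 0` and also kills the `D`-part `F(F' + 2G)` of the square.
  set G : A[X] := C (algebraMap ℂ A (-1 / 2)) * coeffDer D F with hG
  have h2 : (2 : A[X]) * C (algebraMap ℂ A (-1 / 2)) = -1 := by
    rw [← map_ofNat C 2, ← map_ofNat (algebraMap ℂ A) 2, ← C_mul, ← map_mul]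
    norm_num
  have hFG : coeffDer D F + 2 * G = 0 := by
    rw [hG]
    linear_combination coeffDer D F * h2
  have hn : coeffDer D (2 : A[X]) = 0 := by simpa using (coeffDer D).map_natCast 2
  have hFG' := congrArg (coeffDer D) hFG
  rw [map_add, Derivation.leibniz, hn, map_zero, smul_eq_mul, smul_zero, add_zero] at hFG'
  have hFG'' := congrArg (coeffDer D) hFG'
  rw [map_add, Derivation.leibniz, hn, map_zero, smul_eq_mul, smul_zero, add_zero] at hFG''
  have hthird := hP.substP_lameThird N Q
  rw [hQ, map_zero, zero_mul] at hthird
  have hGd : G.natDegree ≤ p := by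
    refine (natDegree_C_mul_le _ _).trans ?_
    rw [natDegree_le_iff_coeff_eq_zero] at hQd ⊢
    intro m hm
    rw [coeff_coeffDer, hQd m hm, map_zero]
  obtain ⟨H, hH, hHd, hH1⟩ := exists_symbol_of_pairOp (D := D) (v := -(N : A) * P) hQd hQ1 hGd
  have hcomm : schrOp D (-(N : A) * P) * pairOp D (-(N : A) * P) F G =
      pairOp D (-(N : A) * P) F G * schrOp D (-(N : A) * P) := by
    have e : 2 * (X - C (-(N : A) * P)) * coeffDer D F - C (D (-(N : A) * P)) * F
        + coeffDer D (coeffDer D G) = 0 := by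
      have h4 : (4 : A[X]) ≠ 0 := by norm_num
      refine mul_left_cancel₀ h4 ?_
      linear_combination hthird + 2 * hFG''
    rw [← sub_eq_zero, schrOp_mul_pairOp, hFG', e]
    simp [pairOp]
  refine ⟨H, hHd, hH1, by rw [hH, hcomm], ?_⟩
  have e0 : F * (coeffDer D F + G) + G * F = 0 := by linear_combination F * hFG
  rw [hH, pairOp_mul_of_commute D _ hcomm rfl, e0, hP.square_pairOp hS hFG, pairOp, map_zero,
    zero_add, opSum_one_map]

/-- Commutation alone fixes `G` only up to a constant polynomial in `λ`. That the square is a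
polynomial in `L` removes its `D`-part, `F(F' + 2G) = 0`, so `G = -F'/2` and the square is
determined. -/
theorem spectral_unique {Q : (ℂ[X])[X]} {N p : ℕ} {S S' : ℂ[X]}
    (hdeg : ∀ j, (Q.coeff j).natDegree ≤ p)
    (hlead : ∀ j, (Q.coeff j).coeff p = if j = 0 then 1 else 0)
    (huniq : ∀ W, lameThird (C g₂) (C g₃) X N W = 0 → ∃ q : ℂ[X], W = C q * Q)
    (hS : lameQuad (C g₂) (C g₃) X N Q = C (C 4 * S))
    {H : A[X]} (hH : H.natDegree ≤ 2 * p + 1) (hH1 : H.coeff (2 * p + 1) = 1)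
    (hcomm : schrOp D (-(N : A) * P) * opSum 1 (derOp D) H =
      opSum 1 (derOp D) H * schrOp D (-(N : A) * P))
    (hsq : opSum 1 (derOp D) H * opSum 1 (derOp D) H = aeval (schrOp D (-(N : A) * P)) S') :
    S' = S := by
  have := charZero_of_injective_algebraMap (algebraMap ℂ A).injective
  obtain ⟨x, hx⟩ := hP.coord
  obtain ⟨G, hG, hFG⟩ := (hP.normalForm_of_commute hdeg hlead huniq hH hH1 hcomm).2 rfl
  obtain ⟨hQd, hQ1⟩ := substP_monic P hdeg hlead
  set F := substP P Q with hF
  have hF0 : F ≠ 0 := (monic_of_natDegree_le_of_coeff_eq_one p hQd hQ1).ne_zero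
  rw [hG] at hcomm hsq
  rw [pairOp_mul_of_commute D _ hcomm rfl, ← opSum_one_map] at hsq
  obtain ⟨h1, h2⟩ := pairOp_inj hx (F' := 0) (G' := S'.map (algebraMap ℂ A))
    (by rw [hsq, pairOp, map_zero, zero_add])
  have h3 : F * (coeffDer D F + 2 * G) = 0 := by linear_combination h1
  have h4 := (mul_eq_zero.mp h3).resolve_left hF0
  exact Polynomial.map_injective _ (algebraMap ℂ A).injective
    (h2.symm.trans (hP.square_pairOp hS h4))

end IsWeierstrassElement

end LameOperators

/-! ### The differential algebra of analytic functions on an open set; values outside the set are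
forgotten. -/

section AnalyticFunctions

/-- The algebra of analytic functions on `U`. -/
def analyticAlg (U : Set ℂ) : Subalgebra ℂ (U → ℂ) where
  carrier := {h | ∃ ψ : ℂ → ℂ, AnalyticOnNhd ℂ ψ U ∧ ∀ x : U, h x = ψ x}
  mul_mem' := by
    rintro a b ⟨ψ, h1, h2⟩ ⟨φ, h3, h4⟩
    exact ⟨ψ * φ, h1.mul h3, fun x => by simp [h2, h4]⟩
  add_mem' := by
    rintro a b ⟨ψ, h1, h2⟩ ⟨φ, h3, h4⟩
    exact ⟨ψ + φ, h1.add h3, fun x => by simp [h2, h4]⟩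
  algebraMap_mem' c := ⟨fun _ => c, analyticOnNhd_const, fun _ => rfl⟩

variable {U : Set ℂ}

/-- A function on the plane that restricts to the given analytic function on `U`. -/
def analyticExt (h : analyticAlg U) : ℂ → ℂ := h.2.choose

theorem analyticExt_analytic (h : analyticAlg U) : AnalyticOnNhd ℂ (analyticExt h) U :=
  h.2.choose_spec.1

theorem analyticExt_apply (h : analyticAlg U) (x : U) : analyticExt h x = h.1 x :=
  (h.2.choose_spec.2 x).symm

open Classical in
/-- The restriction of `ψ` to `U` (zero if it is not analytic). -/
def analyticRes (U : Set ℂ) (ψ : ℂ → ℂ) : analyticAlg U :=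
  if h : AnalyticOnNhd ℂ ψ U then ⟨fun x => ψ x, ψ, h, fun _ => rfl⟩ else 0

theorem analyticRes_apply {ψ : ℂ → ℂ} (h : AnalyticOnNhd ℂ ψ U) (x : U) :
    (analyticRes U ψ).1 x = ψ x := by
  rw [analyticRes, dif_pos h]

theorem analyticRes_ext (h : analyticAlg U) : analyticRes U (analyticExt h) = h := by
  ext x
  exact (analyticRes_apply (analyticExt_analytic h) x).trans (analyticExt_apply h x)

theorem analyticRes_eq_iff {ψ φ : ℂ → ℂ} (hψ : AnalyticOnNhd ℂ ψ U) (hφ : AnalyticOnNhd ℂ φ U) :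
    analyticRes U ψ = analyticRes U φ ↔ ∀ x ∈ U, ψ x = φ x := by
  constructor
  · intro h x hx
    have := congrFun (congrArg Subtype.val h) ⟨x, hx⟩
    rwa [analyticRes_apply hψ, analyticRes_apply hφ] at this
  · intro h
    ext x
    rw [analyticRes_apply hψ, analyticRes_apply hφ, h x x.2]

theorem eqOn_analyticExt_res {ψ : ℂ → ℂ} (hψ : AnalyticOnNhd ℂ ψ U) :
    U.EqOn (analyticExt (analyticRes U ψ)) ψ := fun x hx =>
  (analyticExt_apply _ ⟨x, hx⟩).trans (analyticRes_apply hψ ⟨x, hx⟩)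

theorem fun_add_analytic {ψ φ : ℂ → ℂ} (hψ : AnalyticOnNhd ℂ ψ U) (hφ : AnalyticOnNhd ℂ φ U) :
    AnalyticOnNhd ℂ (fun x => ψ x + φ x) U := hψ.add hφ

theorem fun_mul_analytic {ψ φ : ℂ → ℂ} (hψ : AnalyticOnNhd ℂ ψ U) (hφ : AnalyticOnNhd ℂ φ U) :
    AnalyticOnNhd ℂ (fun x => ψ x * φ x) U := hψ.mul hφ

theorem analyticRes_add {ψ φ : ℂ → ℂ} (hψ : AnalyticOnNhd ℂ ψ U) (hφ : AnalyticOnNhd ℂ φ U) :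
    analyticRes U (fun x => ψ x + φ x) = analyticRes U ψ + analyticRes U φ := by
  ext x
  change (analyticRes U _).1 x = (analyticRes U ψ).1 x + (analyticRes U φ).1 x
  rw [analyticRes_apply hψ, analyticRes_apply hφ, analyticRes_apply (fun_add_analytic hψ hφ)]

theorem analyticRes_mul {ψ φ : ℂ → ℂ} (hψ : AnalyticOnNhd ℂ ψ U) (hφ : AnalyticOnNhd ℂ φ U) :
    analyticRes U (fun x => ψ x * φ x) = analyticRes U ψ * analyticRes U φ := by
  ext x
  change (analyticRes U _).1 x = (analyticRes U ψ).1 x * (analyticRes U φ).1 x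
  rw [analyticRes_apply hψ, analyticRes_apply hφ, analyticRes_apply (fun_mul_analytic hψ hφ)]

theorem analyticRes_const (c : ℂ) :
    analyticRes U (fun _ => c) = algebraMap ℂ (analyticAlg U) c := by
  ext x
  exact analyticRes_apply analyticOnNhd_const x

/-- Differentiation of analytic functions. -/
def analyticDer (hU : IsOpen U) : Derivation ℂ (analyticAlg U) (analyticAlg U) :=
  Derivation.mk'
    { toFun := fun h => analyticRes U (deriv (analyticExt h))
      map_add' := fun a b => by
        have ha := analyticExt_analytic a
        have hb := analyticExt_analytic b
        rw [← analyticRes_add ha.deriv hb.deriv,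
          analyticRes_eq_iff (analyticExt_analytic _).deriv (fun_add_analytic ha.deriv hb.deriv)]
        intro x hx
        -- The chosen extensions are additive only on `U`; as `U` is open, this suffices for the
        -- derivatives there.
        have e : U.EqOn (analyticExt (a + b)) (analyticExt a + analyticExt b) := fun y hy => by
          rw [analyticExt_apply (a + b) ⟨y, hy⟩, Pi.add_apply, analyticExt_apply a ⟨y, hy⟩,
            analyticExt_apply b ⟨y, hy⟩]
          rfl
        rw [e.deriv hU hx, deriv_add (ha x hx).differentiableAt (hb x hx).differentiableAt]
      map_smul' := fun c a => by
        have ha := analyticExt_analytic a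
        rw [RingHom.id_apply, Algebra.smul_def c (analyticRes U _), ← analyticRes_const,
          ← analyticRes_mul analyticOnNhd_const ha.deriv,
          analyticRes_eq_iff (analyticExt_analytic _).deriv (fun_mul_analytic analyticOnNhd_const ha.deriv)]
        intro x hx
        have e : U.EqOn (analyticExt (c • a)) (fun y => c * analyticExt a y) := fun y hy => by
          rw [analyticExt_apply (c • a) ⟨y, hy⟩]
          exact congrArg (c * ·) (analyticExt_apply a ⟨y, hy⟩).symm
        rw [e.deriv hU hx, deriv_const_mul _ (ha x hx).differentiableAt] }
    fun a b => by
      have ha := analyticExt_analytic a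
      have hb := analyticExt_analytic b
      change analyticRes U (deriv (analyticExt (a * b))) =
        a * analyticRes U (deriv (analyticExt b)) + b * analyticRes U (deriv (analyticExt a))
      nth_rewrite 2 [← analyticRes_ext a]
      nth_rewrite 3 [← analyticRes_ext b]
      rw [← analyticRes_mul ha hb.deriv, ← analyticRes_mul hb ha.deriv,
        ← analyticRes_add (fun_mul_analytic ha hb.deriv) (fun_mul_analytic hb ha.deriv),
        analyticRes_eq_iff (analyticExt_analytic _).deriv
          (fun_add_analytic (fun_mul_analytic ha hb.deriv) (fun_mul_analytic hb ha.deriv))]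
      intro x hx
      have e : U.EqOn (analyticExt (a * b)) (analyticExt a * analyticExt b) := fun y hy => by
        rw [analyticExt_apply (a * b) ⟨y, hy⟩, Pi.mul_apply, analyticExt_apply a ⟨y, hy⟩,
          analyticExt_apply b ⟨y, hy⟩]
        rfl
      rw [e.deriv hU hx, deriv_mul (ha x hx).differentiableAt (hb x hx).differentiableAt]
      ring

theorem analyticDer_res (hU : IsOpen U) {ψ : ℂ → ℂ} (hψ : AnalyticOnNhd ℂ ψ U) :
    analyticDer hU (analyticRes U ψ) = analyticRes U (deriv ψ) :=
  (analyticRes_eq_iff (analyticExt_analytic _).deriv hψ.deriv).mpr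
    ((eqOn_analyticExt_res hψ).deriv hU)

theorem analyticDer_pow_res (hU : IsOpen U) {ψ : ℂ → ℂ} (hψ : AnalyticOnNhd ℂ ψ U) (j : ℕ) :
    (derOp (analyticDer hU) ^ j) (analyticRes U ψ) = analyticRes U (iteratedDeriv j ψ) := by
  induction j with
  | zero => simp [iteratedDeriv_zero]
  | succ j ih =>
    rw [pow_succ', Module.End.mul_apply, ih, iteratedDeriv_succ, iteratedDeriv_eq_iterate]
    exact analyticDer_res hU (hψ.iterated_deriv j)

/-- The identity theorem for analytic functions on a connected set. -/
theorem isDomain_analyticAlg (hne : U.Nonempty) (hU : IsPreconnected U) :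
    IsDomain (analyticAlg U) := by
  obtain ⟨x₀, hx₀⟩ := hne
  have : Nontrivial (analyticAlg U) := ⟨0, 1, fun h => by
    have := congrFun (congrArg Subtype.val h) ⟨x₀, hx₀⟩
    exact zero_ne_one this⟩
  have : NoZeroDivisors (analyticAlg U) := ⟨fun {a b} hab => by
    have ha := analyticExt_analytic a
    have hb := analyticExt_analytic b
    have h := ha.eq_zero_or_eq_zero_of_mul_eq_zero hb (fun x hx => by
      have := congrFun (congrArg Subtype.val hab) ⟨x, hx⟩
      rw [analyticExt_apply a ⟨x, hx⟩, analyticExt_apply b ⟨x, hx⟩]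
      exact this) hU
    refine h.imp (fun h => ?_) (fun h => ?_)
    · ext x
      exact (analyticExt_apply a x).symm.trans (h x x.2)
    · ext x
      exact (analyticExt_apply b x).symm.trans (h x x.2)⟩
  exact NoZeroDivisors.to_isDomain _

theorem exists_algebraMap_of_analyticDer (hU : IsOpen U) (hU' : IsPreconnected U)
    (h : analyticAlg U) (h0 : analyticDer hU h = 0) :
    ∃ c : ℂ, algebraMap ℂ (analyticAlg U) c = h := by
  have ha := analyticExt_analytic h
  obtain ⟨c, hc⟩ := hU.exists_is_const_of_deriv_eq_zero hU' ha.differentiableOn (fun x hx => by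
    have := congrFun (congrArg Subtype.val h0) ⟨x, hx⟩
    exact (analyticRes_apply ha.deriv ⟨x, hx⟩).symm.trans this)
  refine ⟨c, ?_⟩
  rw [← analyticRes_const, ← analyticRes_ext h, analyticRes_eq_iff analyticOnNhd_const ha]
  exact fun x hx => (hc x hx).symm

/-! ### Differential operators with analytic coefficients -/

/-- The symbol of `∑_{j ≤ n} aⱼ ∂ʲ`. -/
def opSymbol (U : Set ℂ) (a : ℕ → ℂ → ℂ) (n : ℕ) : (analyticAlg U)[X] :=
  ∑ j ∈ Finset.range (n + 1), monomial j (analyticRes U (a j))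

theorem coeff_opSymbol (a : ℕ → ℂ → ℂ) (n j : ℕ) :
    (opSymbol U a n).coeff j = if j ≤ n then analyticRes U (a j) else 0 := by
  simp only [opSymbol, finsetSum_coeff, coeff_monomial, Finset.sum_ite_eq', Finset.mem_range,
    Nat.lt_succ_iff]

theorem opSymbol_natDegree (a : ℕ → ℂ → ℂ) (n : ℕ) : (opSymbol U a n).natDegree ≤ n :=
  natDegree_le_iff_coeff_eq_zero.mpr fun j hj => by rw [coeff_opSymbol, if_neg (by omega)]

theorem opSymbol_ext {H : (analyticAlg U)[X]} {n : ℕ} (hH : H.natDegree ≤ n) :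
    opSymbol U (fun j => analyticExt (H.coeff j)) n = H := by
  ext1 j
  rw [coeff_opSymbol]
  split_ifs with h
  · exact analyticRes_ext _
  · rw [coeff_eq_zero_of_natDegree_lt (by omega)]

theorem analyticOnNhd_diffOp {a : ℕ → ℂ → ℂ} {n : ℕ}
    (ha : ∀ j ≤ n, AnalyticOnNhd ℂ (a j) U) {ψ : ℂ → ℂ} (hψ : AnalyticOnNhd ℂ ψ U) :
    AnalyticOnNhd ℂ (diffOp a n ψ) U := by
  refine Finset.analyticOnNhd_fun_sum _ fun j hj => (ha j ?_).mul ?_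
  · have := Finset.mem_range.mp hj
    omega
  · rw [iteratedDeriv_eq_iterate]
    exact hψ.iterated_deriv j

theorem opSum_opSymbol (hU : IsOpen U) {a : ℕ → ℂ → ℂ} {n : ℕ}
    (ha : ∀ j ≤ n, AnalyticOnNhd ℂ (a j) U) {ψ : ℂ → ℂ} (hψ : AnalyticOnNhd ℂ ψ U) :
    opSum 1 (derOp (analyticDer hU)) (opSymbol U a n) (analyticRes U ψ) =
      analyticRes U (diffOp a n ψ) := by
  have hi : ∀ j, AnalyticOnNhd ℂ (iteratedDeriv j ψ) U := fun j => by
    rw [iteratedDeriv_eq_iterate]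
    exact hψ.iterated_deriv j
  ext x
  rw [analyticRes_apply (analyticOnNhd_diffOp ha hψ), opSymbol, map_sum, LinearMap.sum_apply, diffOp,
    AddSubmonoidClass.coe_finsetSum, Finset.sum_apply]
  refine Finset.sum_congr rfl fun j hj => ?_
  have hj' : j ≤ n := by
    have := Finset.mem_range.mp hj
    omega
  rw [opSum_monomial, one_mul, Module.End.mul_apply, analyticDer_pow_res hU hψ]
  change (analyticRes U (a j)).1 x * (analyticRes U (iteratedDeriv j ψ)).1 x = _
  rw [analyticRes_apply (ha j hj'), analyticRes_apply (hi j)]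

variable {f : ℂ → ℂ} (hf : AnalyticOnNhd ℂ f U)
include hf

theorem analyticOnNhd_laxOp {ψ : ℂ → ℂ} (hψ : AnalyticOnNhd ℂ ψ U) :
    AnalyticOnNhd ℂ (laxOp f ψ) U := by
  refine AnalyticOnNhd.add ?_ ((analyticOnNhd_const.mul hf).mul hψ)
  rw [iteratedDeriv_eq_iterate]
  exact hψ.iterated_deriv 2

theorem schrOp_res (hU : IsOpen U) {ψ : ℂ → ℂ} (hψ : AnalyticOnNhd ℂ ψ U) :
    schrOp (analyticDer hU) (analyticRes U fun x => 2 * f x) (analyticRes U ψ) =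
      analyticRes U (laxOp f ψ) := by
  have h2 : AnalyticOnNhd ℂ (fun x => 2 * f x) U := analyticOnNhd_const.mul hf
  have hd : AnalyticOnNhd ℂ (iteratedDeriv 2 ψ) U := by
    rw [iteratedDeriv_eq_iterate]
    exact hψ.iterated_deriv 2
  rw [schrOp, ← pow_two, LinearMap.add_apply, analyticDer_pow_res hU hψ]
  change _ + analyticRes U (fun x => 2 * f x) * analyticRes U ψ = _
  rw [← analyticRes_mul h2 hψ, ← analyticRes_add hd (fun_mul_analytic h2 hψ)]
  rfl

theorem analyticOnNhd_laxOp_iterate {ψ : ℂ → ℂ} (hψ : AnalyticOnNhd ℂ ψ U) (k : ℕ) :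
    AnalyticOnNhd ℂ ((laxOp f)^[k] ψ) U := by
  induction k with
  | zero => exact hψ
  | succ k ih =>
    rw [Function.iterate_succ_apply']
    exact analyticOnNhd_laxOp hf ih

theorem schrOp_pow_res (hU : IsOpen U) {ψ : ℂ → ℂ} (hψ : AnalyticOnNhd ℂ ψ U) (k : ℕ) :
    (schrOp (analyticDer hU) (analyticRes U fun x => 2 * f x) ^ k) (analyticRes U ψ) =
      analyticRes U ((laxOp f)^[k] ψ) := by
  induction k with
  | zero => rfl
  | succ k ih =>
    rw [pow_succ', Module.End.mul_apply, ih, Function.iterate_succ_apply',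
      schrOp_res hf hU (analyticOnNhd_laxOp_iterate hf hψ k)]

theorem analyticOnNhd_polyLaxOp (S : ℂ[X]) {ψ : ℂ → ℂ} (hψ : AnalyticOnNhd ℂ ψ U) :
    AnalyticOnNhd ℂ (polyLaxOp f S ψ) U :=
  Finset.analyticOnNhd_fun_sum _ fun k _ =>
    analyticOnNhd_const.mul (analyticOnNhd_laxOp_iterate hf hψ k)

theorem aeval_schrOp_res (hU : IsOpen U) (S : ℂ[X]) {ψ : ℂ → ℂ} (hψ : AnalyticOnNhd ℂ ψ U) :
    aeval (schrOp (analyticDer hU) (analyticRes U fun x => 2 * f x)) S (analyticRes U ψ) =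
      analyticRes U (polyLaxOp f S ψ) := by
  ext x
  rw [analyticRes_apply (analyticOnNhd_polyLaxOp hf S hψ), aeval_eq_sum_range, LinearMap.sum_apply,
    polyLaxOp, AddSubmonoidClass.coe_finsetSum, Finset.sum_apply]
  refine Finset.sum_congr rfl fun k _ => ?_
  rw [LinearMap.smul_apply, schrOp_pow_res hf hU hψ]
  change S.coeff k * (analyticRes U _).1 x = _
  rw [analyticRes_apply (analyticOnNhd_laxOp_iterate hf hψ k)]

/-- Every element of the algebra is the restriction of a function analytic on `U`, so testing on all
such `ψ` is the same as equality of endomorphisms. -/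
theorem isCommutingOp_iff (hU : IsOpen U) {a : ℕ → ℂ → ℂ} {n : ℕ} :
    IsCommutingOp U f a n ↔ (∀ j ≤ n, AnalyticOnNhd ℂ (a j) U) ∧ (opSymbol U a n).coeff n = 1 ∧
      schrOp (analyticDer hU) (analyticRes U fun x => 2 * f x) *
          opSum 1 (derOp (analyticDer hU)) (opSymbol U a n) =
        opSum 1 (derOp (analyticDer hU)) (opSymbol U a n) *
          schrOp (analyticDer hU) (analyticRes U fun x => 2 * f x) := by
  have h1 : (1 : analyticAlg U) = analyticRes U fun _ => 1 := by
    rw [analyticRes_const, map_one]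
  have hm : ∀ ha : (∀ j ≤ n, AnalyticOnNhd ℂ (a j) U),
      (opSymbol U a n).coeff n = 1 ↔ ∀ x ∈ U, a n x = 1 := fun ha => by
    rw [coeff_opSymbol, if_pos le_rfl, h1, analyticRes_eq_iff (ha n le_rfl) analyticOnNhd_const]
  constructor
  · rintro ⟨ha, h, hc⟩
    refine ⟨ha, (hm ha).mpr h, LinearMap.ext fun ψ => ?_⟩
    obtain ⟨ψ, hψ, rfl⟩ : ∃ φ, AnalyticOnNhd ℂ φ U ∧ analyticRes U φ = ψ :=
      ⟨_, analyticExt_analytic ψ, analyticRes_ext ψ⟩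
    have hl := analyticOnNhd_laxOp hf hψ
    have hd := analyticOnNhd_diffOp ha hψ
    rw [Module.End.mul_apply, Module.End.mul_apply, opSum_opSymbol hU ha hψ, schrOp_res hf hU hψ,
      schrOp_res hf hU hd, opSum_opSymbol hU ha hl,
      analyticRes_eq_iff (analyticOnNhd_laxOp hf hd) (analyticOnNhd_diffOp ha hl)]
    exact fun x hx => (hc ψ hψ x hx).symm
  · rintro ⟨ha, h, hc⟩
    refine ⟨ha, (hm ha).mp h, fun ψ hψ => ?_⟩
    have hl := analyticOnNhd_laxOp hf hψ
    have hd := analyticOnNhd_diffOp ha hψ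
    have := LinearMap.congr_fun hc (analyticRes U ψ)
    rw [Module.End.mul_apply, Module.End.mul_apply, opSum_opSymbol hU ha hψ, schrOp_res hf hU hψ,
      schrOp_res hf hU hd, opSum_opSymbol hU ha hl,
      analyticRes_eq_iff (analyticOnNhd_laxOp hf hd) (analyticOnNhd_diffOp ha hl)] at this
    exact fun x hx => (this x hx).symm

theorem diffOp_sq_iff (hU : IsOpen U) {a : ℕ → ℂ → ℂ} {n : ℕ} {S : ℂ[X]}
    (ha : ∀ j ≤ n, AnalyticOnNhd ℂ (a j) U) :
    (∀ ψ : ℂ → ℂ, AnalyticOnNhd ℂ ψ U → ∀ x ∈ U,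
      diffOp a n (diffOp a n ψ) x = polyLaxOp f S ψ x) ↔
    opSum 1 (derOp (analyticDer hU)) (opSymbol U a n) *
        opSum 1 (derOp (analyticDer hU)) (opSymbol U a n) =
      aeval (schrOp (analyticDer hU) (analyticRes U fun x => 2 * f x)) S := by
  have hT := fun ψ => opSum_opSymbol hU ha (ψ := ψ)
  have hL := fun ψ => aeval_schrOp_res hf hU S (ψ := ψ)
  generalize opSum 1 (derOp (analyticDer hU)) (opSymbol U a n) = T at *
  generalize aeval (schrOp (analyticDer hU) (analyticRes U fun x => 2 * f x)) S = L at *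
  have key : ∀ ψ : ℂ → ℂ, AnalyticOnNhd ℂ ψ U → ((T * T) (analyticRes U ψ) = L (analyticRes U ψ) ↔
      ∀ x ∈ U, diffOp a n (diffOp a n ψ) x = polyLaxOp f S ψ x) := fun ψ hψ => by
    have hd := analyticOnNhd_diffOp ha hψ
    rw [Module.End.mul_apply, hT ψ hψ, hT _ hd, hL ψ hψ,
      analyticRes_eq_iff (analyticOnNhd_diffOp ha hd) (analyticOnNhd_polyLaxOp hf S hψ)]
  constructor
  · intro h
    refine LinearMap.ext fun ψ => ?_
    obtain ⟨ψ, hψ, rfl⟩ : ∃ φ, AnalyticOnNhd ℂ φ U ∧ analyticRes U φ = ψ :=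
      ⟨_, analyticExt_analytic ψ, analyticRes_ext ψ⟩
    exact (key ψ hψ).mpr (h ψ hψ)
  · intro h ψ hψ
    exact (key ψ hψ).mp (LinearMap.congr_fun h _)

end AnalyticFunctions

/-! ### The complement of the lattice, and `℘` as a Weierstrass element. -/

section RegularSet

variable (τ : UpperHalfPlane)

theorem isOpen_regularSet : IsOpen (regularSet τ) :=
  (tauPeriods τ).isClosed_lattice.isOpen_compl

/-- The lattice is countable, and removing a countable set from a real vector space of dimension two
leaves it path connected. -/
theorem isConnected_regularSet : IsConnected (regularSet τ) := by
  have : Countable (tauPeriods τ).lattice := (tauPeriods τ).latticeEquivProd.toEquiv.countable_iff.mpr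
    inferInstance
  exact (Set.Countable.isPathConnected_compl_of_one_lt_rank
    (by rw [Complex.rank_real_complex]; exact Nat.one_lt_ofNat)
    (Set.to_countable ((tauPeriods τ).lattice : Set ℂ))).isConnected

theorem analyticOnNhd_weierstrassP_regularSet :
    AnalyticOnNhd ℂ (tauPeriods τ).weierstrassP (regularSet τ) :=
  (tauPeriods τ).analyticOnNhd_weierstrassP

/-- Otherwise `℘` would be constant off the lattice, against its double pole at `0`. -/
theorem exists_derivWeierstrassP_ne_zero :
    ∃ x ∈ regularSet τ, deriv (tauPeriods τ).weierstrassP x ≠ 0 := by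
  by_contra! h
  obtain ⟨c, hc⟩ := (isOpen_regularSet τ).exists_is_const_of_deriv_eq_zero
    (isConnected_regularSet τ).isPreconnected
    (analyticOnNhd_weierstrassP_regularSet τ).differentiableOn h
  have h0 := (tauPeriods τ).order_weierstrassP 0 (zero_mem _)
  have e : (tauPeriods τ).weierstrassP =ᶠ[nhdsWithin 0 {0}ᶜ] fun _ => c := by
    filter_upwards [mem_nhdsWithin_of_mem_nhds
      ((tauPeriods τ).compl_lattice_sdiff_singleton_mem_nhds 0), self_mem_nhdsWithin] with x h1 h2
    exact hc x fun hx => h1 ⟨hx, h2⟩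
  rw [meromorphicOrderAt_congr e, meromorphicOrderAt_const] at h0
  split_ifs at h0
  · exact absurd h0 (by decide)
  · exact absurd (WithTop.coe_injective h0) (by decide)

theorem isWeierstrassElement_weierstrassP :
    IsWeierstrassElement (analyticDer (isOpen_regularSet τ))
      (analyticRes (regularSet τ) (tauPeriods τ).weierstrassP)
      (tauPeriods τ).g₂ (tauPeriods τ).g₃ := by
  have ha := analyticOnNhd_weierstrassP_regularSet τ
  refine ⟨?_, ?_, exists_algebraMap_of_analyticDer _ (isConnected_regularSet τ).isPreconnected,
    ⟨analyticRes _ id, ?_⟩⟩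
  · rw [analyticDer_res _ ha]
    ext x
    have h := (tauPeriods τ).derivWeierstrassP_sq x x.2
    rw [← PeriodPair.deriv_weierstrassP, ← analyticRes_apply ha, ← analyticRes_apply ha.deriv] at h
    exact h
  · rw [analyticDer_res _ ha]
    intro h
    obtain ⟨x, hx, hne⟩ := exists_derivWeierstrassP_ne_zero τ
    refine hne ?_
    rw [← analyticRes_apply ha.deriv ⟨x, hx⟩, h]
    rfl
  · rw [analyticDer_res (isOpen_regularSet τ) (ψ := id) analyticOnNhd_id, ← map_one (algebraMap ℂ _), ← analyticRes_const]
    congr 1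
    ext x
    simp

theorem analyticOnNhd_lameData (C : ℂ) : AnalyticOnNhd ℂ (lameData C τ) (regularSet τ) :=
  analyticOnNhd_const.mul (analyticOnNhd_weierstrassP_regularSet τ)

theorem analyticRes_two_mul_lameData (N : ℕ) :
    analyticRes (regularSet τ) (fun x => 2 * lameData (-((N : ℂ) / 2)) τ x) =
      -(N : analyticAlg (regularSet τ)) *
        analyticRes (regularSet τ) (tauPeriods τ).weierstrassP := by
  have e : (fun x => 2 * lameData (-((N : ℂ) / 2)) τ x) =
      fun x => -(N : ℂ) * (tauPeriods τ).weierstrassP x := by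
    ext x
    rw [lameData]
    ring
  rw [e, analyticRes_mul analyticOnNhd_const (analyticOnNhd_weierstrassP_regularSet τ),
    analyticRes_const, map_neg, map_natCast]

/-- The spectral curve of the Lamé operator is given by the first integral of the Lamé polynomial. -/
theorem isSpectralPolynomial_lame {Q : (ℂ[X])[X]} {N p : ℕ} {S : ℂ[X]}
    (hQ : lameThird (C (tauPeriods τ).g₂) (C (tauPeriods τ).g₃) X N Q = 0)
    (hdeg : ∀ j, (Q.coeff j).natDegree ≤ p)
    (hlead : ∀ j, (Q.coeff j).coeff p = if j = 0 then 1 else 0)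
    (huniq : ∀ W, lameThird (C (tauPeriods τ).g₂) (C (tauPeriods τ).g₃) X N W = 0 →
      ∃ q : ℂ[X], W = C q * Q)
    (hS : lameQuad (C (tauPeriods τ).g₂) (C (tauPeriods τ).g₃) X N Q = C (C 4 * S)) :
    IsSpectralPolynomial (regularSet τ) (lameData (-((N : ℂ) / 2)) τ) S ∧
      ∀ S', IsSpectralPolynomial (regularSet τ) (lameData (-((N : ℂ) / 2)) τ) S' → S' = S := by
  have := isDomain_analyticAlg (isConnected_regularSet τ).nonempty
    (isConnected_regularSet τ).isPreconnected
  have hP := isWeierstrassElement_weierstrassP τ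
  have hU := isOpen_regularSet τ
  have hf := analyticOnNhd_lameData τ (-((N : ℂ) / 2))
  have hv := analyticRes_two_mul_lameData τ N
  have hmin : ∀ g a, IsCommutingOp (regularSet τ) (lameData (-((N : ℂ) / 2)) τ) a (2 * g + 1) →
      p ≤ g := fun g a h => by
    rw [isCommutingOp_iff hf hU, hv] at h
    exact (hP.normalForm_of_commute hdeg hlead huniq (opSymbol_natDegree a _) h.2.1 h.2.2).1
  obtain ⟨H, hH, hH1, hcomm, hsq⟩ := hP.exists_commuting_symbol hQ hdeg hlead hS
  have he := opSymbol_ext hH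
  have hc : IsCommutingOp (regularSet τ) (lameData (-((N : ℂ) / 2)) τ)
      (fun j => analyticExt (H.coeff j)) (2 * p + 1) := by
    rw [isCommutingOp_iff hf hU, hv, he]
    exact ⟨fun j _ => analyticExt_analytic _, hH1, hcomm⟩
  refine ⟨⟨p, fun j => analyticExt (H.coeff j), hc, ?_, ?_⟩, ?_⟩
  · rw [diffOp_sq_iff hf hU fun j _ => analyticExt_analytic _, hv, he]
    exact hsq
  · rintro g hg ⟨a, ha⟩
    exact absurd (hmin g a ha) (by omega)
  · rintro S' ⟨g, a, ha, hsq', hg⟩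
    -- Minimality of `g`, tested on the operator of order `2p + 1` just built, gives `g ≤ p`.
    have hpg : g = p := le_antisymm (not_lt.mp fun h => hg p h ⟨_, hc⟩) (hmin g a ha)
    subst hpg
    rw [isCommutingOp_iff hf hU, hv] at ha
    rw [diffOp_sq_iff hf hU ha.1, hv] at hsq'
    exact hP.spectral_unique hdeg hlead huniq hS (opSymbol_natDegree a _) ha.2.1 ha.2.2 hsq'

end RegularSet

/-! ### Square roots of power series. -/

section SquareRoot

/-- The coefficients of the square root of a power series with constant coefficient `1`. -/
def sqrtCoeff (s : PowerSeries ℂ) : ℕ → ℂ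
  | 0 => 1
  | n + 1 => (PowerSeries.coeff (n + 1) s
      - ∑ i : Fin n, sqrtCoeff s (i + 1) * sqrtCoeff s (n - i)) / 2
  termination_by n => n
  decreasing_by all_goals omega

/-- The coefficient of degree `n + 1` of `σ ^ 2` is `2σ_{n+1}` plus terms in earlier coefficients,
so it can be solved for. -/
theorem exists_powerSeries_sqrt {s : PowerSeries ℂ} (hs : PowerSeries.constantCoeff s = 1) :
    ∃ σ : PowerSeries ℂ, PowerSeries.constantCoeff σ = 1 ∧ σ ^ 2 = s := by
  have h0 : sqrtCoeff s 0 = 1 := by rw [sqrtCoeff]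
  refine ⟨PowerSeries.mk (sqrtCoeff s), ?_, ?_⟩
  · rw [← PowerSeries.coeff_zero_eq_constantCoeff_apply, PowerSeries.coeff_mk, h0]
  · ext n
    rw [pow_two, PowerSeries.coeff_mul, Finset.Nat.sum_antidiagonal_eq_sum_range_succ_mk]
    simp only [PowerSeries.coeff_mk]
    cases n with
    | zero => simp [h0, hs]
    | succ n =>
      rw [Finset.sum_range_succ, Finset.sum_range_succ']
      have e : ∀ i, n + 1 - (i + 1) = n - i := fun i => by omega
      have hrec := sqrtCoeff.eq_2 s n
      rw [← Finset.sum_range fun i => sqrtCoeff s (i + 1) * sqrtCoeff s (n - i)] at hrec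
      simp only [e, Nat.sub_self, Nat.sub_zero, h0, hrec]
      ring

end SquareRoot

/-! ### Substitution of derivatives of `f`, and coefficientwise differentiation. -/

section Evaluation

variable {f : ℂ → ℂ} {U : Set ℂ}

/-- Substituting `f⁽ⁱ⁾(x)` for `uᵢ` turns the formal derivation `∂` into `d/dx`. -/
theorem hasDerivAt_eval_jet (hf : AnalyticOnNhd ℂ f U) (q : DiffPoly) {x : ℂ} (hx : x ∈ U) :
    HasDerivAt (fun y => MvPolynomial.eval (fun i : ℕ => iteratedDeriv i f y) q)
      (MvPolynomial.eval (fun i : ℕ => iteratedDeriv i f x) (diffPolyD q)) x := by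
  induction q using MvPolynomial.induction_on with
  | C a => simpa [diffPolyD] using hasDerivAt_const x a
  | add p q hp hq => simpa using hp.fun_add hq
  | mul_X p i hp =>
    have hX : HasDerivAt (iteratedDeriv i f) (iteratedDeriv (i + 1) f x) x := by
      rw [iteratedDeriv_succ]
      refine DifferentiableAt.hasDerivAt ?_
      rw [iteratedDeriv_eq_iterate]
      exact (hf.iterated_deriv i x hx).differentiableAt
    have h := hp.mul hX
    rw [Derivation.leibniz, diffPolyD_X]
    simp only [map_mul, map_add, smul_eq_mul, MvPolynomial.eval_X]
    refine h.congr_deriv ?_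
    ring

/-- The coefficient of `λ⁻ⁿ` in the value of `W` at `y`. -/
def evalCoeff (W : (PowerSeries ℂ)[X]) (n : ℕ) (y : ℂ) : ℂ :=
  PowerSeries.coeff n (W.eval (PowerSeries.C y))

theorem hasDerivAt_evalCoeff (W : (PowerSeries ℂ)[X]) (n : ℕ) (y : ℂ) :
    HasDerivAt (evalCoeff W n) (evalCoeff (derivative W) n y) y := by
  unfold evalCoeff
  induction W using Polynomial.induction_on' with
  | add p q hp hq => simpa using hp.fun_add hq
  | monomial k a =>
    have e : ∀ (a : PowerSeries ℂ) (k : ℕ) (y : ℂ),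
        PowerSeries.coeff n ((monomial k a).eval (PowerSeries.C y)) =
          PowerSeries.coeff n a * y ^ k := fun a k y => by
      rw [eval_monomial, ← map_pow, PowerSeries.coeff_mul_C]
    rw [derivative_monomial]
    simp only [e]
    have := (hasDerivAt_pow k y).const_mul (PowerSeries.coeff n a)
    refine this.congr_deriv ?_
    rw [← map_natCast (PowerSeries.C : ℂ →+* _) k, PowerSeries.coeff_mul_C]
    ring

end Evaluation

/-! ### The quadratic equation determines `b`. -/

section Uniqueness

variable (τ : UpperHalfPlane)

theorem two_mul_deriv_deriv_weierstrassP {x : ℂ} (hx : x ∈ regularSet τ) :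
    2 * deriv (deriv (tauPeriods τ).weierstrassP) x =
      12 * (tauPeriods τ).weierstrassP x ^ 2 - (tauPeriods τ).g₂ := by
  have := isDomain_analyticAlg (isConnected_regularSet τ).nonempty
    (isConnected_regularSet τ).isPreconnected
  have ha := analyticOnNhd_weierstrassP_regularSet τ
  have h := (isWeierstrassElement_weierstrassP τ).second
  rw [analyticDer_res _ ha, analyticDer_res _ ha.deriv] at h
  have h' := congrFun (congrArg Subtype.val h) ⟨x, hx⟩
  rw [← analyticRes_apply ha.deriv.deriv ⟨x, hx⟩, ← analyticRes_apply ha ⟨x, hx⟩]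
  exact h'

theorem deriv_weierstrassP_sq {x : ℂ} (hx : x ∈ regularSet τ) :
    deriv (tauPeriods τ).weierstrassP x ^ 2 = 4 * (tauPeriods τ).weierstrassP x ^ 3
      - (tauPeriods τ).g₂ * (tauPeriods τ).weierstrassP x - (tauPeriods τ).g₃ := by
  rw [PeriodPair.deriv_weierstrassP]
  exact (tauPeriods τ).derivWeierstrassP_sq x hx

/-- A polynomial in `℘` whose coefficients are power series in `λ⁻¹` and that satisfies the
quadratic equation of `b` is `b`. -/
theorem eval_bCoeff_eq {γ : (PowerSeries ℂ)[X]} {N : ℕ}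
    (h0 : ∀ y, PowerSeries.constantCoeff (γ.eval (PowerSeries.C y)) = 1)
    (hγ : C PowerSeries.X * (derivative γ ^ 2 * weierstrassCubic (PowerSeries.C (tauPeriods τ).g₂)
        (PowerSeries.C (tauPeriods τ).g₃) - γ * flowTwice (PowerSeries.C (tauPeriods τ).g₂)
        (PowerSeries.C (tauPeriods τ).g₃) γ)
      + 4 * (1 + C PowerSeries.X * ((N : (PowerSeries ℂ)[X]) * X)) * γ ^ 2 = 4)
    (n : ℕ) {x : ℂ} (hx : x ∈ regularSet τ) :
    MvPolynomial.eval (fun i : ℕ => iteratedDeriv i (lameData (-((N : ℂ) / 2)) τ) x) (bCoeff n) =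
      evalCoeff γ n ((tauPeriods τ).weierstrassP x) := by
  have hU := isOpen_regularSet τ
  have ha := analyticOnNhd_weierstrassP_regularSet τ
  have hf := analyticOnNhd_lameData τ (-((N : ℂ) / 2))
  set P := (tauPeriods τ).weierstrassP
  have hP' : ∀ y ∈ regularSet τ, HasDerivAt P (deriv P y) y := fun y hy =>
    (ha y hy).differentiableAt.hasDerivAt
  have hP'' : ∀ y ∈ regularSet τ, HasDerivAt (deriv P) (deriv (deriv P) y) y := fun y hy =>
    (ha.deriv y hy).differentiableAt.hasDerivAt
  have hE : ∀ (W : (PowerSeries ℂ)[X]) (i : ℕ), ∀ y ∈ regularSet τ, HasDerivAt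
      (fun y => evalCoeff W i (P y)) (evalCoeff (derivative W) i (P y) * deriv P y) y :=
    fun W i y hy => (hasDerivAt_evalCoeff W i (P y)).comp y (hP' y hy)
  -- The recursion for `bCoeff` involves derivatives of earlier coefficients, so the equality is
  -- needed on the whole open set, where it can be differentiated.
  induction n using Nat.strong_induction_on generalizing x with
  | _ n ih =>
    cases n with
    | zero =>
      rw [bCoeff, map_one, evalCoeff, PowerSeries.coeff_zero_eq_constantCoeff_apply, h0]
    | succ n =>
      have d0 : ∀ i, i ≤ n → ∀ y ∈ regularSet τ,
          MvPolynomial.eval (fun i : ℕ => iteratedDeriv i (lameData (-((N : ℂ) / 2)) τ) y)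
            (bCoeff i) = evalCoeff γ i (P y) := fun i hi y hy => ih i (by omega) hy
      have d1 : ∀ i, i ≤ n → ∀ y ∈ regularSet τ,
          MvPolynomial.eval (fun i : ℕ => iteratedDeriv i (lameData (-((N : ℂ) / 2)) τ) y)
            (diffPolyD (bCoeff i)) = evalCoeff (derivative γ) i (P y) * deriv P y := by
        intro i hi y hy
        refine (hasDerivAt_eval_jet hf (bCoeff i) hy).unique ((hE γ i y hy).congr_of_eventuallyEq ?_)
        filter_upwards [hU.mem_nhds hy] with z hz
        exact d0 i hi z hz
      have d2 : ∀ i, i ≤ n → ∀ y ∈ regularSet τ,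
          2 * MvPolynomial.eval (fun i : ℕ => iteratedDeriv i (lameData (-((N : ℂ) / 2)) τ) y)
            (diffPolyD (diffPolyD (bCoeff i))) =
          evalCoeff (flowTwice (PowerSeries.C (tauPeriods τ).g₂)
            (PowerSeries.C (tauPeriods τ).g₃) γ) i (P y) := by
        intro i hi y hy
        rw [(hasDerivAt_eval_jet hf (diffPolyD (bCoeff i)) hy).unique
          (((hE (derivative γ) i y hy).mul (hP'' y hy)).congr_of_eventuallyEq (by
            filter_upwards [hU.mem_nhds hy] with z hz
            exact d1 i hi z hz))]
        have e1 := deriv_weierstrassP_sq τ hy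
        have e2 := two_mul_deriv_deriv_weierstrassP τ hy
        have e3 : (flowTwice (PowerSeries.C (tauPeriods τ).g₂)
            (PowerSeries.C (tauPeriods τ).g₃) γ).eval (PowerSeries.C (P y)) =
            (derivative (derivative γ)).eval (PowerSeries.C (P y)) *
              PowerSeries.C (2 * (4 * P y ^ 3 - (tauPeriods τ).g₂ * P y - (tauPeriods τ).g₃))
            + (derivative γ).eval (PowerSeries.C (P y)) *
              PowerSeries.C (12 * P y ^ 2 - (tauPeriods τ).g₂) := by
          rw [flowTwice, derivative_weierstrassCubic, weierstrassCubic]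
          simp only [eval_add, eval_mul, eval_sub, eval_pow, eval_X, eval_C, eval_ofNat, map_sub,
            map_mul, map_pow, map_ofNat]
          ring
        rw [evalCoeff, evalCoeff, evalCoeff, e3, map_add, PowerSeries.coeff_mul_C,
          PowerSeries.coeff_mul_C, ← e1, ← e2]
        ring
      have hrec := congrArg (MvPolynomial.eval
        (fun i : ℕ => iteratedDeriv i (lameData (-((N : ℂ) / 2)) τ) x)) (bCoeff.eq_2 n)
      -- The coefficient of `λ^{-(n+1)}` in the quadratic equation is the recursion of `bCoeff`, up
      -- to the factor `8`.
      have hγ' := congrArg (fun V => PowerSeries.coeff (n + 1) (V.eval (PowerSeries.C (P x)))) hγ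
      set F := flowTwice (PowerSeries.C (tauPeriods τ).g₂) (PowerSeries.C (tauPeriods τ).g₃) γ
      have hcub : (weierstrassCubic (PowerSeries.C (tauPeriods τ).g₂)
          (PowerSeries.C (tauPeriods τ).g₃)).eval (PowerSeries.C (P x)) =
          PowerSeries.C (deriv P x ^ 2) := by
        rw [deriv_weierstrassP_sq τ hx, weierstrassCubic]
        simp only [eval_mul, eval_sub, eval_pow, eval_X, eval_C, eval_ofNat, map_sub,
          map_mul, map_pow, map_ofNat]
        rfl
      have hγ2 : (C PowerSeries.X * (derivative γ ^ 2 * weierstrassCubic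
          (PowerSeries.C (tauPeriods τ).g₂) (PowerSeries.C (tauPeriods τ).g₃) - γ * F)
          + 4 * (1 + C PowerSeries.X * ((N : (PowerSeries ℂ)[X]) * X)) * γ ^ 2).eval
            (PowerSeries.C (P x)) =
          PowerSeries.X * ((derivative γ).eval (PowerSeries.C (P x)) *
            (derivative γ).eval (PowerSeries.C (P x)) * PowerSeries.C (deriv P x ^ 2)
            - γ.eval (PowerSeries.C (P x)) * F.eval (PowerSeries.C (P x))
            + γ.eval (PowerSeries.C (P x)) * γ.eval (PowerSeries.C (P x)) *
              PowerSeries.C (4 * N * P x))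
          + γ.eval (PowerSeries.C (P x)) * γ.eval (PowerSeries.C (P x)) * PowerSeries.C 4 := by
        simp only [eval_add, eval_mul, eval_sub, eval_pow, eval_X, eval_C, eval_ofNat, eval_one,
          eval_natCast, hcub, map_mul, map_ofNat, map_natCast]
        ring
      have h4 : PowerSeries.coeff (n + 1) ((4 : (PowerSeries ℂ)[X]).eval
          (PowerSeries.C (P x))) = 0 := by
        rw [eval_ofNat, ← map_ofNat (PowerSeries.C : ℂ →+* PowerSeries ℂ) 4, PowerSeries.coeff_C,
          if_neg (Nat.succ_ne_zero n)]
      simp only [hγ2, h4] at hγ'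
      rw [map_add, PowerSeries.coeff_succ_X_mul, map_add, map_sub, PowerSeries.coeff_mul_C,
        PowerSeries.coeff_mul_C, PowerSeries.coeff_mul_C] at hγ'
      simp only [PowerSeries.coeff_mul, Finset.Nat.sum_antidiagonal_eq_sum_range_succ_mk] at hγ'
      have hc : ∀ (W : (PowerSeries ℂ)[X]) (i : ℕ),
          PowerSeries.coeff i (W.eval (PowerSeries.C (P x))) = evalCoeff W i (P x) :=
        fun _ _ => rfl
      have hg0 : evalCoeff γ 0 (P x) = 1 := by
        rw [evalCoeff, PowerSeries.coeff_zero_eq_constantCoeff_apply, h0]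
      -- Both end terms of the convolution equal the unknown coefficient, because the zeroth
      -- coefficient is `1`.
      have hsplit : ∑ i ∈ Finset.range (n + 1).succ,
          evalCoeff γ i (P x) * evalCoeff γ (n + 1 - i) (P x) =
          ∑ i ∈ Finset.range n, evalCoeff γ (i + 1) (P x) * evalCoeff γ (n - i) (P x)
            + 2 * evalCoeff γ (n + 1) (P x) := by
        have e : ∀ i, n + 1 - (i + 1) = n - i := fun i => by omega
        rw [Finset.sum_range_succ, Finset.sum_range_succ']
        simp only [e, Nat.sub_self, Nat.sub_zero, hg0]
        ring
      simp only [hc, hsplit] at hγ'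
      have hs1 : ∀ i : Fin (n + 1), MvPolynomial.eval
          (fun i : ℕ => iteratedDeriv i (lameData (-((N : ℂ) / 2)) τ) x)
          (MvPolynomial.C (1 / 4 : ℂ) * (bCoeff i * diffPolyD (diffPolyD (bCoeff (n - i))))
          - MvPolynomial.C (1 / 8 : ℂ) * (diffPolyD (bCoeff i) * diffPolyD (bCoeff (n - i)))
          + MvPolynomial.X 0 * (bCoeff i * bCoeff (n - i))) =
          1 / 8 * (evalCoeff γ i (P x) * evalCoeff F (n - i) (P x))
          - 1 / 8 * deriv P x ^ 2 * (evalCoeff (derivative γ) i (P x)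
            * evalCoeff (derivative γ) (n - i) (P x))
          - N / 2 * P x * (evalCoeff γ i (P x) * evalCoeff γ (n - i) (P x)) := fun i => by
        have hi : (i : ℕ) ≤ n := by omega
        simp only [map_add, map_sub, map_mul, MvPolynomial.eval_C, MvPolynomial.eval_X,
          d0 _ hi x hx, d1 _ hi x hx, d0 _ (Nat.sub_le n i) x hx, d1 _ (Nat.sub_le n i) x hx,
          ← d2 _ (Nat.sub_le n i) x hx, iteratedDeriv_zero, lameData]
        ring
      have hs2 : ∀ i : Fin n, MvPolynomial.eval
          (fun i : ℕ => iteratedDeriv i (lameData (-((N : ℂ) / 2)) τ) x)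
          (bCoeff (i + 1) * bCoeff (n - i)) =
          evalCoeff γ (i + 1) (P x) * evalCoeff γ (n - i) (P x) := fun i => by
        rw [map_mul, d0 _ (by omega) x hx, d0 _ (Nat.sub_le n i) x hx]
      rw [map_sub, map_mul, MvPolynomial.eval_C, map_sum, map_sum, Finset.sum_congr rfl fun i _ => hs1 i,
        Finset.sum_congr rfl fun i _ => hs2 i, Finset.sum_sub_distrib, Finset.sum_sub_distrib,
        ← Finset.mul_sum, ← Finset.mul_sum, ← Finset.mul_sum,
        ← Finset.sum_range fun i => evalCoeff γ i (P x) * evalCoeff F (n - i) (P x),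
        ← Finset.sum_range fun i => evalCoeff (derivative γ) i (P x)
            * evalCoeff (derivative γ) (n - i) (P x),
        ← Finset.sum_range fun i => evalCoeff γ i (P x) * evalCoeff γ (n - i) (P x),
        ← Finset.sum_range fun i => evalCoeff γ (i + 1) (P x) * evalCoeff γ (n - i) (P x)] at hrec
      rw [hrec]
      linear_combination (-1 / 8) * hγ'

theorem basicMatrixResolvent_apply : basicMatrixResolvent 0 1 = bSeries := by
  rw [existsUnique_basicMatrixResolvent.unique basicMatrixResolvent_spec
    isBasicMatrixResolvent_resolventOf]
  simp [resolventOf]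

theorem bAt_eq {γ : (PowerSeries ℂ)[X]} {N : ℕ}
    (h0 : ∀ y, PowerSeries.constantCoeff (γ.eval (PowerSeries.C y)) = 1)
    (hγ : C PowerSeries.X * (derivative γ ^ 2 * weierstrassCubic (PowerSeries.C (tauPeriods τ).g₂)
        (PowerSeries.C (tauPeriods τ).g₃) - γ * flowTwice (PowerSeries.C (tauPeriods τ).g₂)
        (PowerSeries.C (tauPeriods τ).g₃) γ)
      + 4 * (1 + C PowerSeries.X * ((N : (PowerSeries ℂ)[X]) * X)) * γ ^ 2 = 4)
    {x : ℂ} (hx : x ∈ regularSet τ) :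
    bAt (lameData (-((N : ℂ) / 2)) τ) x = HahnSeries.ofPowerSeries ℤ ℂ
      (γ.eval (PowerSeries.C ((tauPeriods τ).weierstrassP x))) := by
  rw [bAt, basicMatrixResolvent_apply]
  ext k
  rw [HahnSeries.map_coeff, PowerSeries.coeff_coe]
  split_ifs with hk
  · rw [bSeries_coeff_neg k hk, map_zero]
  · lift k to ℕ using by omega
    rw [bSeries_coeff]
    exact eval_bCoeff_eq τ h0 hγ k hx

end Uniqueness

/-! ### Polynomials in `λ` as Laurent series in `λ⁻¹`. -/

section LaurentSeries

theorem ofPowerSeries_coe (b : ℂ[X]) : HahnSeries.ofPowerSeries ℤ ℂ (b : PowerSeries ℂ) =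
    aeval (HahnSeries.single (1 : ℤ) (1 : ℂ) : LaurentSeries ℂ) b := by
  induction b using Polynomial.induction_on' with
  | add p q hp hq => rw [Polynomial.coe_add, map_add, map_add, hp, hq]
  | monomial n a =>
    rw [← C_mul_X_pow_eq_monomial, Polynomial.coe_mul, Polynomial.coe_pow, Polynomial.coe_X,
      Polynomial.coe_C, map_mul, map_pow, HahnSeries.ofPowerSeries_C, HahnSeries.ofPowerSeries_X,
      map_mul, map_pow, aeval_X, aeval_C]
    rw [LaurentSeries.algebraMap_apply]

theorem single_one_mul_lam :
    (HahnSeries.single (1 : ℤ) (1 : ℂ) : LaurentSeries ℂ) * lam ℂ = 1 := by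
  simp [lam]

theorem lam_ne_zero : lam ℂ ≠ 0 := right_ne_zero_of_mul_eq_one single_one_mul_lam

/-- Reversing coefficients is `a ↦ λ⁻ᵖ a(λ)`, read as a polynomial in `λ⁻¹`. -/
theorem ofPowerSeries_reflect {a : ℂ[X]} {p : ℕ} (ha : a.natDegree ≤ p) :
    HahnSeries.ofPowerSeries ℤ ℂ (reflect p a : PowerSeries ℂ) =
      (HahnSeries.single (1 : ℤ) (1 : ℂ) : LaurentSeries ℂ) ^ p * aeval (lam ℂ) a := by
  have hr : (reflect p a).natDegree < p + 1 := by
    refine Nat.lt_succ_of_le (natDegree_le_iff_coeff_eq_zero.mpr fun j hj => ?_)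
    rw [coeff_reflect, revAt_eq_self_of_lt hj, coeff_eq_zero_of_natDegree_lt (by omega)]
  rw [ofPowerSeries_coe, aeval_def, aeval_def, eval₂_eq_sum_range' _ hr,
    eval₂_eq_sum_range' _ (Nat.lt_succ_of_le ha), Finset.mul_sum, ← Finset.sum_range_reflect]
  refine Finset.sum_congr rfl fun i hi => ?_
  have hi' : i ≤ p := by
    have := Finset.mem_range.mp hi
    omega
  have e : p + 1 - 1 - i = p - i := by omega
  rw [e, coeff_reflect, revAt_le (Nat.sub_le _ _), Nat.sub_sub_self hi', mul_left_comm]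
  congr 1
  nth_rewrite 2 [← Nat.sub_add_cancel hi']
  rw [pow_add, mul_assoc, ← mul_pow, single_one_mul_lam, one_pow, mul_one]

theorem leadingCoeff_ofPowerSeries {σ : PowerSeries ℂ} (hσ : PowerSeries.constantCoeff σ = 1) :
    (HahnSeries.ofPowerSeries ℤ ℂ σ).leadingCoeff = 1 := by
  have h0 : (HahnSeries.ofPowerSeries ℤ ℂ σ).coeff 0 = 1 := by
    rw [PowerSeries.coeff_coe]
    simpa using hσ
  have hne : HahnSeries.ofPowerSeries ℤ ℂ σ ≠ 0 := fun h => by simp [h] at h0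
  have ho : (HahnSeries.ofPowerSeries ℤ ℂ σ).order = 0 := by
    refine le_antisymm (HahnSeries.order_le_of_coeff_ne_zero (by simp [h0])) ?_
    rw [HahnSeries.le_order_iff_forall hne]
    intro j hj
    rw [PowerSeries.coeff_coe, if_pos hj]
  rw [HahnSeries.leadingCoeff_eq, ho, h0]

theorem IsSeriesSqrt.ne_zero {r F : LaurentSeries ℂ} (h : IsSeriesSqrt r F) : r ≠ 0 := by
  obtain ⟨-, c, hc, hl⟩ := h
  rw [← HahnSeries.leadingCoeff_ne_zero, hl]
  exact_mod_cast hc.ne'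

theorem IsSeriesSqrt.natCast_mul {r F : LaurentSeries ℂ} (h : IsSeriesSqrt r F) {n : ℕ}
    (hn : 0 < n) : IsSeriesSqrt (n * r) (n ^ 2 * F) := by
  obtain ⟨h2, c, hc, hl⟩ := h
  refine ⟨by rw [mul_pow, h2], n * c, by positivity, ?_⟩
  rw [HahnSeries.leadingCoeff_mul, hl, ← map_natCast (HahnSeries.C : ℂ →+* LaurentSeries ℂ) n,
    HahnSeries.C_apply, HahnSeries.leadingCoeff_of_single]
  push_cast
  rfl

/-- The Lamé polynomial lives in `ℂ[λ][X]`, while `evalXLam` expects `ℂ[X][λ]`. -/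
theorem evalXLam_swap (q : (ℂ[X])[X]) (y : ℂ) : evalXLam (Bivariate.swap q) y =
    (q.map (aeval (lam ℂ)).toRingHom).eval (HahnSeries.C y) := by
  rw [evalXLam]
  induction q using Polynomial.induction_on' with
  | add p q hp hq => simp only [map_add, Polynomial.map_add, hp, hq, eval_add]
  | monomial n a =>
    induction a using Polynomial.induction_on' with
    | add p q hp hq => simp only [map_add, Polynomial.map_add, hp, hq, eval_add]
    | monomial m a =>
      have e : HahnSeries.C y = algebraMap ℂ (LaurentSeries ℂ) y :=
        (LaurentSeries.algebraMap_apply ℂ y).symm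
      rw [Bivariate.swap_monomial_monomial, map_monomial, map_monomial, aeval_monomial,
        eval_monomial]
      change algebraMap ℂ (LaurentSeries ℂ) (eval y (monomial n a)) * lam ℂ ^ m =
        aeval (lam ℂ) (monomial m a) * HahnSeries.C y ^ n
      rw [eval_monomial, aeval_monomial, map_mul, map_pow, e]
      ring

theorem coeff_coeff_swap (q : (ℂ[X])[X]) (i j : ℕ) :
    ((Bivariate.swap q).coeff i).coeff j = (q.coeff j).coeff i := by
  induction q using Polynomial.induction_on' with
  | add p q hp hq => simp only [map_add, coeff_add, hp, hq]
  | monomial n a =>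
    induction a using Polynomial.induction_on' with
    | add p q hp hq => simp only [map_add, coeff_add, hp, hq]
    | monomial m a =>
      rw [Bivariate.swap_monomial_monomial]
      simp only [coeff_monomial]
      split_ifs <;> simp_all [coeff_monomial]

theorem swap_monic {q : (ℂ[X])[X]} {p : ℕ} (hdeg : ∀ j, (q.coeff j).natDegree ≤ p)
    (hlead : ∀ j, (q.coeff j).coeff p = if j = 0 then 1 else 0) :
    (Bivariate.swap q).Monic ∧ (Bivariate.swap q).natDegree = p := by
  have h1 : (Bivariate.swap q).natDegree ≤ p := by
    refine natDegree_le_iff_coeff_eq_zero.mpr fun i hi => ?_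
    ext j
    rw [coeff_coeff_swap, coeff_eq_zero_of_natDegree_lt ((hdeg j).trans_lt hi), coeff_zero]
  have h2 : (Bivariate.swap q).coeff p = 1 := by
    ext j
    rw [coeff_coeff_swap, hlead, coeff_one]
  exact ⟨monic_of_natDegree_le_of_coeff_eq_one p h1 h2,
    le_antisymm h1 (le_natDegree_of_ne_zero (by simp [h2]))⟩

end LaurentSeries

/-- Division by `ℓ = λ` leaves only `t = λ⁻¹`, so the equation makes sense for power series in `t`.
-/
theorem lameQuad_normalized {R : Type*} [CommRing R] {g₂ g₃ ℓ t : R} {N : ℕ} {W : R[X]}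
    (ht : t * ℓ = 1) (h : lameQuad g₂ g₃ ℓ N W = C (4 * ℓ)) :
    C t * (derivative W ^ 2 * weierstrassCubic g₂ g₃ - W * flowTwice g₂ g₃ W)
      + 4 * (1 + C t * ((N : R[X]) * X)) * W ^ 2 = 4 := by
  rw [lameQuad, C_mul, C_ofNat] at h
  have ht' : (C t : R[X]) * C ℓ = 1 := by rw [← C_mul, ht, C_1]
  linear_combination C t * h + (4 - 4 * W ^ 2) * ht'

/-! ### The series `b` from the Lamé polynomial. -/

section Lame

variable (τ : UpperHalfPlane)

/-- If `q` has the first integral `4S(λ)`, then `√(S/λ) b(λ, x) = q(λ, ℘(x))`. -/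
theorem exists_sqrt_mul_bAt {q : (ℂ[X])[X]} {N p : ℕ} {S : ℂ[X]}
    (hdeg : ∀ j, (q.coeff j).natDegree ≤ p)
    (hlead : ∀ j, (q.coeff j).coeff p = if j = 0 then 1 else 0)
    (hS : lameQuad (C (tauPeriods τ).g₂) (C (tauPeriods τ).g₃) X N q = C (C 4 * S)) :
    ∃ r : LaurentSeries ℂ, IsSeriesSqrt r (aeval (lam ℂ) S / lam ℂ) ∧
      ∀ x ∈ regularSet τ, r * bAt (lameData (-((N : ℂ) / 2)) τ) x =
        evalXLam (Bivariate.swap q) ((tauPeriods τ).weierstrassP x) := by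
  -- That the first integral of `q` is free of `X` already forces `lameThird` to vanish at `q`.
  have hSmd : S.Monic ∧ S.natDegree = 2 * p + 1 := by
    have hq0 : q ≠ 0 := fun h => by simpa [h] using hlead 0
    have h3 := derivative_lameQuad (C (tauPeriods τ).g₂) (C (tauPeriods τ).g₃) X N q
    rw [hS, derivative_C] at h3
    obtain ⟨S', hS', h⟩ := exists_lameQuad_eq _ _ p
      ((mul_eq_zero.mp h3.symm).resolve_left (neg_ne_zero.mpr hq0)) hdeg hlead
    rwa [← mul_left_cancel₀ (C_ne_zero.mpr (by norm_num : (4 : ℂ) ≠ 0))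
      (C_injective (hS'.symm.trans hS))]
  obtain ⟨hSm, hSd⟩ := hSmd
  -- `σ² = λ^{-(2p+1)} S`, a power series in `λ⁻¹` with constant term `1`; hence `λ^p σ` is the root
  -- of `S/λ`.
  obtain ⟨σ, hσ, hσS⟩ := exists_powerSeries_sqrt (s := (reflect (2 * p + 1) S : PowerSeries ℂ)) (by
    rw [← PowerSeries.coeff_zero_eq_constantCoeff_apply, Polynomial.coeff_coe, coeff_reflect,
      revAt_le (Nat.zero_le _), Nat.sub_zero, ← hSd]
    exact hSm)
  set t : LaurentSeries ℂ := HahnSeries.single (1 : ℤ) (1 : ℂ) with ht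
  set ι : PowerSeries ℂ →+* LaurentSeries ℂ := HahnSeries.ofPowerSeries ℤ ℂ with hι
  have htl : t * lam ℂ = 1 := single_one_mul_lam
  have htlp : t ^ p * lam ℂ ^ p = 1 := by rw [← mul_pow, htl, one_pow]
  have hσσ : σ * σ⁻¹ = 1 := PowerSeries.mul_inv_cancel σ (by rw [hσ]; exact one_ne_zero)
  have hισ : ι σ * ι σ⁻¹ = 1 := by rw [← map_mul, hσσ, map_one]
  have hισ2 : ι σ ^ 2 = t ^ (2 * p + 1) * aeval (lam ℂ) S := by
    rw [← map_pow, hσS, hι, ofPowerSeries_reflect hSd.le]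
  set r : LaurentSeries ℂ := lam ℂ ^ p * ι σ with hr
  have hr2 : r ^ 2 * lam ℂ = aeval (lam ℂ) S := by
    have htl2 : t ^ (2 * p + 1) * lam ℂ ^ (2 * p + 1) = 1 := by rw [← mul_pow, htl, one_pow]
    rw [hr, mul_pow, hισ2]
    linear_combination aeval (lam ℂ) S * htl2
  have hrs : IsSeriesSqrt r (aeval (lam ℂ) S / lam ℂ) := by
    refine ⟨by rw [eq_div_iff lam_ne_zero, hr2], 1, one_pos, ?_⟩
    rw [hr, HahnSeries.leadingCoeff_mul, hι, leadingCoeff_ofPowerSeries hσ, lam,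
      HahnSeries.single_pow, HahnSeries.leadingCoeff_of_single]
    simp
  refine ⟨r, hrs, fun x hx => ?_⟩
  -- The candidate for `b`: the quotient of `q` by `λ^p σ`, formed within power series in `λ⁻¹`.
  set γ : (PowerSeries ℂ)[X] := ∑ j ∈ Finset.range (q.natDegree + 1),
    monomial j (σ⁻¹ * (reflect p (q.coeff j) : PowerSeries ℂ)) with hγ
  have hγq : C r * γ.map ι = q.map (aeval (lam ℂ)).toRingHom := by
    conv_rhs => rw [q.as_sum_range]
    rw [hγ, Polynomial.map_sum, Polynomial.map_sum, Finset.mul_sum]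
    refine Finset.sum_congr rfl fun j _ => ?_
    rw [map_monomial, map_monomial, C_mul_monomial, map_mul ι, hι, ofPowerSeries_reflect (hdeg j),
      ← hι, hr]
    congr 1
    change _ = aeval (lam ℂ) (q.coeff j)
    linear_combination (ι σ * ι σ⁻¹ * aeval (lam ℂ) (q.coeff j)) * htlp
      + aeval (lam ℂ) (q.coeff j) * hισ
  have h0 : ∀ y, PowerSeries.constantCoeff (γ.eval (PowerSeries.C y)) = 1 := by
    intro y
    have hσ' : PowerSeries.constantCoeff σ⁻¹ = 1 := by
      have := congrArg PowerSeries.constantCoeff hσσ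
      rwa [map_mul, hσ, one_mul, map_one] at this
    rw [hγ, eval_finsetSum, map_sum, Finset.sum_eq_single 0]
    · rw [eval_monomial, pow_zero, mul_one, map_mul, hσ', one_mul,
        ← PowerSeries.coeff_zero_eq_constantCoeff_apply, Polynomial.coeff_coe, coeff_reflect,
        revAt_le (Nat.zero_le _), Nat.sub_zero, hlead, if_pos rfl]
    · intro j _ hj
      rw [eval_monomial, map_mul, map_mul, ← PowerSeries.coeff_zero_eq_constantCoeff_apply,
        ← PowerSeries.coeff_zero_eq_constantCoeff_apply, Polynomial.coeff_coe, coeff_reflect,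
        revAt_le (Nat.zero_le _), Nat.sub_zero, hlead, if_neg hj]
      simp
    · simp
  -- The first integral is homogeneous quadratic, so `q = rγ` and `S = r²λ` give the value `4λ` at
  -- `γ`.
  have hquad : lameQuad (HahnSeries.C (tauPeriods τ).g₂) (HahnSeries.C (tauPeriods τ).g₃) (lam ℂ) N
      (γ.map ι) = C (4 * lam ℂ) := by
    have h := congrArg (Polynomial.map (aeval (lam ℂ)).toRingHom) hS
    rw [map_lameQuad, ← hγq, lameQuad_C_mul, map_C] at h
    simp only [AlgHom.toRingHom_eq_coe, RingHom.coe_coe, aeval_C, aeval_X, map_mul,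
      LaurentSeries.algebraMap_apply] at h
    have hr0 : (C (r ^ 2) : (LaurentSeries ℂ)[X]) ≠ 0 := C_ne_zero.mpr (pow_ne_zero 2 hrs.ne_zero)
    refine mul_left_cancel₀ hr0 (h.trans ?_)
    rw [← hr2, ← C_mul, ← C_mul]
    congr 1
    rw [map_ofNat]
    ring
  have hmap : Function.Injective (Polynomial.map ι) :=
    Polynomial.map_injective _ HahnSeries.ofPowerSeries_injective
  rw [bAt_eq τ h0 (hmap ?_) hx, evalXLam_swap, ← hγq, eval_mul, eval_C, ← hι,
    ← HahnSeries.ofPowerSeries_C (Γ := ℤ), ← hι, eval_map, eval₂_at_apply]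
  have e2 : ι (PowerSeries.C (tauPeriods τ).g₂) = HahnSeries.C (tauPeriods τ).g₂ :=
    HahnSeries.ofPowerSeries_C _
  have e3 : ι (PowerSeries.C (tauPeriods τ).g₃) = HahnSeries.C (tauPeriods τ).g₃ :=
    HahnSeries.ofPowerSeries_C _
  have eX : ι PowerSeries.X = t := HahnSeries.ofPowerSeries_X
  simp only [Polynomial.map_add, Polynomial.map_mul, Polynomial.map_sub, Polynomial.map_pow, map_C,
    map_X, Polynomial.map_one, Polynomial.map_natCast, Polynomial.map_ofNat, map_flowTwice,
    map_weierstrassCubic, ← derivative_map, e2, e3, eX]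
  exact lameQuad_normalized htl hquad

end Lame

/-! ### The Lamé polynomials and their first integrals for `p = 1, 2, 3`. -/

section SmallDegree

variable {R : Type*} [CommRing R] (a b ℓ : R)

/-- Writing `g₂ = 4a` and `g₃ = 4b` avoids denominators, and the identity holds over any commutative
ring. -/
theorem lameQuad_one : lameQuad (4 * a) (4 * b) ℓ 2 (C ℓ - X) =
    C (4 * (ℓ ^ 3 - a * ℓ - b)) := by
  rw [lameQuad, flowTwice, derivative_weierstrassCubic, weierstrassCubic]
  simp only [derivative_sub, derivative_C, derivative_X, derivative_one, C_mul, C_sub, C_pow,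
    zero_sub, derivative_neg, map_ofNat, Nat.cast_ofNat]
  ring

theorem lameQuad_two : lameQuad (4 * a) (4 * b) ℓ 6
    (C (ℓ ^ 2 - 9 * a) - C (3 * ℓ) * X + C 9 * X ^ 2) =
      C (4 * ((ℓ ^ 2 - 12 * a) * (ℓ ^ 3 - 9 * a * ℓ + 27 * b))) := by
  rw [lameQuad, flowTwice, derivative_weierstrassCubic, weierstrassCubic]
  simp only [derivative_sub, derivative_add, derivative_mul, derivative_pow, derivative_C,
    derivative_X, derivative_one, derivative_zero, derivative_ofNat, C_mul, C_sub,
    C_add, C_pow, C_1, map_ofNat, Nat.cast_ofNat, Nat.cast_one, Nat.reduceSub]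
  ring

theorem lameQuad_three : lameQuad (4 * a) (4 * b) ℓ 12
    (C (ℓ ^ 3 - 60 * a * ℓ + 225 * b) + C (225 * a - 6 * ℓ ^ 2) * X + C (45 * ℓ) * X ^ 2
      - C 225 * X ^ 3) =
      C (4 * (ℓ * (ℓ ^ 6 - 126 * a * ℓ ^ 4 + 594 * b * ℓ ^ 3 + 4185 * a ^ 2 * ℓ ^ 2
        - 36450 * a * b * ℓ - 13500 * a ^ 3 + 91125 * b ^ 2))) := by
  rw [lameQuad, flowTwice, derivative_weierstrassCubic, weierstrassCubic]
  simp only [derivative_sub, derivative_add, derivative_mul, derivative_pow, derivative_C,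
    derivative_X, derivative_one, derivative_zero, derivative_ofNat, C_mul, C_sub,
    C_add, C_pow, C_1, map_ofNat, Nat.cast_ofNat, Nat.cast_one, Nat.reduceSub]
  ring

end SmallDegree

/-! ### The explicit formulas for `b`. -/

section ExplicitFormulas

variable (τ : UpperHalfPlane)

theorem serG₂_eq : serG₂ τ = 4 * HahnSeries.C ((tauPeriods τ).g₂ / 4) := by
  rw [serG₂, ← map_ofNat (HahnSeries.C : ℂ →+* LaurentSeries ℂ) 4, ← map_mul]
  congr 1
  ring

theorem serG₃_eq : serG₃ τ = 4 * HahnSeries.C ((tauPeriods τ).g₃ / 4) := by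
  rw [serG₃, ← map_ofNat (HahnSeries.C : ℂ →+* LaurentSeries ℂ) 4, ← map_mul]
  congr 1
  ring

theorem four_mul_C_div (g : ℂ) : (4 : ℂ[X]) * C (g / 4) = C g := by
  rw [← map_ofNat C 4, ← C_mul]
  congr 1
  ring

theorem aeval_lam_C (c : ℂ) : aeval (lam ℂ) (C c) = HahnSeries.C c := by
  rw [aeval_C, LaurentSeries.algebraMap_apply]

theorem bAt_lame_one : ∃ s : LaurentSeries ℂ,
    IsSeriesSqrt s ((4 * lam ℂ ^ 3 - serG₂ τ * lam ℂ - serG₃ τ) / lam ℂ) ∧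
      ∀ x ∈ regularSet τ, bAt (lameData (-1) τ) x = 2 * (lam ℂ - serP τ x) / s := by
  have hq := lameQuad_one (C ((tauPeriods τ).g₂ / 4)) (C ((tauPeriods τ).g₃ / 4)) X
  rw [four_mul_C_div, four_mul_C_div, ← map_ofNat C 4] at hq
  obtain ⟨r, hr, hb⟩ := exists_sqrt_mul_bAt τ (p := 1) (fun j => by
      rcases j with _ | _ | j <;> simp [coeff_X, coeff_C]) (fun j => by
      rcases j with _ | _ | j <;> simp [coeff_X, coeff_C, coeff_one]) hq
  -- The radicand in the formula is `4S/λ`, so its root is `2r`.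
  refine ⟨(2 : ℕ) * r, ?_, fun x hx => ?_⟩
  · convert hr.natCast_mul (n := 2) (by norm_num) using 1
    rw [serG₂_eq, serG₃_eq, ← mul_div_assoc]
    congr 1
    simp only [map_sub, map_mul, map_pow, aeval_X, aeval_lam_C]
    push_cast
    ring
  · have h := hb x hx
    rw [evalXLam_swap, show -(((2 : ℕ) : ℂ) / 2) = -1 by norm_num] at h
    rw [eq_div_iff (hr.natCast_mul (n := 2) (by norm_num)).ne_zero]
    simp only [Polynomial.map_sub, map_C, map_X, eval_sub, eval_C, eval_X,
      AlgHom.toRingHom_eq_coe, RingHom.coe_coe, aeval_X] at h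
    rw [serP]
    push_cast
    linear_combination 2 * h

theorem bAt_lame_two : ∃ s : LaurentSeries ℂ,
    IsSeriesSqrt s ((lam ℂ ^ 2 - 3 * serG₂ τ)
      * (4 * lam ℂ ^ 3 - 9 * serG₂ τ * lam ℂ + 27 * serG₃ τ) / lam ℂ) ∧
      ∀ x ∈ regularSet τ, bAt (lameData (-3) τ) x =
        1 / 2 * (4 * lam ℂ ^ 2 - 12 * serP τ x * lam ℂ + 36 * serP τ x ^ 2 - 9 * serG₂ τ) / s := by
  have hq := lameQuad_two (C ((tauPeriods τ).g₂ / 4)) (C ((tauPeriods τ).g₃ / 4)) X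
  rw [four_mul_C_div, four_mul_C_div, ← map_ofNat C 4] at hq
  obtain ⟨r, hr, hb⟩ := exists_sqrt_mul_bAt τ (p := 2) (fun j => by
      rcases j with _ | _ | _ | j <;>
        simp only [coeff_add, coeff_sub, coeff_C_mul, coeff_X, coeff_X_pow, coeff_C,
          show ∀ j, j + 1 + 1 + 1 ≠ 2 by omega] <;>
        norm_num <;> compute_degree!) (fun j => by
      rcases j with _ | _ | _ | j <;>
        (simp only [coeff_add, coeff_sub, coeff_C_mul, coeff_X, coeff_X_pow, coeff_C,
          show ∀ j, j + 1 + 1 + 1 ≠ 2 by omega]; norm_num [coeff_X, coeff_C])) hq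
  refine ⟨(2 : ℕ) * r, ?_, fun x hx => ?_⟩
  · convert hr.natCast_mul (n := 2) (by norm_num) using 1
    rw [serG₂_eq, serG₃_eq, ← mul_div_assoc]
    congr 1
    simp only [map_sub, map_add, map_mul, map_pow, map_ofNat, aeval_X, aeval_lam_C]
    push_cast
    ring
  · have h := hb x hx
    rw [evalXLam_swap, show -(((6 : ℕ) : ℂ) / 2) = -3 by norm_num] at h
    rw [eq_div_iff (hr.natCast_mul (n := 2) (by norm_num)).ne_zero]
    simp only [Polynomial.map_sub, Polynomial.map_add, Polynomial.map_mul, Polynomial.map_pow,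
      map_C, map_X, eval_sub, eval_add, eval_mul, eval_pow, eval_C, eval_X,
      AlgHom.toRingHom_eq_coe, RingHom.coe_coe, aeval_X, map_sub, map_mul, map_pow, map_ofNat,
      Polynomial.map_ofNat, eval_ofNat, aeval_lam_C] at h
    rw [serP, serG₂_eq]
    have h2 : (1 / 2 : LaurentSeries ℂ) * 2 = 1 := by
      have := charZero_of_injective_algebraMap (algebraMap ℂ (LaurentSeries ℂ)).injective
      norm_num
    push_cast
    linear_combination 2 * h - 2 * (lam ℂ ^ 2 - 9 * HahnSeries.C ((tauPeriods τ).g₂ / 4)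
      - 3 * lam ℂ * HahnSeries.C ((tauPeriods τ).weierstrassP x)
      + 9 * HahnSeries.C ((tauPeriods τ).weierstrassP x) ^ 2) * h2

theorem bAt_lame_three : ∃ s : LaurentSeries ℂ,
    IsSeriesSqrt s
      (16 * lam ℂ ^ 6 - 504 * serG₂ τ * lam ℂ ^ 4 + 2376 * serG₃ τ * lam ℂ ^ 3
        + 4185 * serG₂ τ ^ 2 * lam ℂ ^ 2 - 36450 * serG₂ τ * serG₃ τ * lam ℂ
        - 3375 * serG₂ τ ^ 3 + 91125 * serG₃ τ ^ 2) ∧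
      ∀ x ∈ regularSet τ, bAt (lameData (-6) τ) x =
        (4 * lam ℂ ^ 3 - 24 * serP τ x * lam ℂ ^ 2 + 60 * (3 * serP τ x ^ 2 - serG₂ τ) * lam ℂ
          - 900 * serP τ x ^ 3 + 225 * serG₂ τ * serP τ x + 225 * serG₃ τ) / s := by
  have hq := lameQuad_three (C ((tauPeriods τ).g₂ / 4)) (C ((tauPeriods τ).g₃ / 4)) X
  rw [four_mul_C_div, four_mul_C_div, ← map_ofNat C 4] at hq
  obtain ⟨r, hr, hb⟩ := exists_sqrt_mul_bAt τ (p := 3) (fun j => by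
      rcases j with _ | _ | _ | _ | j <;>
        simp only [coeff_add, coeff_sub, coeff_C_mul, coeff_X, coeff_X_pow, coeff_C,
          show ∀ j, j + 1 + 1 + 1 + 1 ≠ 2 by omega,
          show ∀ j, j + 1 + 1 + 1 + 1 ≠ 3 by omega] <;>
        norm_num <;> compute_degree!) (fun j => by
      rcases j with _ | _ | _ | _ | j <;>
        simp only [coeff_add, coeff_sub, coeff_C_mul, coeff_X, coeff_X_pow, coeff_C,
          show ∀ j, j + 1 + 1 + 1 + 1 ≠ 2 by omega,
          show ∀ j, j + 1 + 1 + 1 + 1 ≠ 3 by omega] <;>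
        norm_num [coeff_X, coeff_C]) hq
  -- Here `λ` divides `S`, and the radicand is the polynomial `16S/λ`.
  refine ⟨(4 : ℕ) * r, ?_, fun x hx => ?_⟩
  · convert hr.natCast_mul (n := 4) (by norm_num) using 1
    rw [serG₂_eq, serG₃_eq, map_mul, aeval_X, mul_div_cancel_left₀ _ lam_ne_zero]
    simp only [map_sub, map_add, map_mul, map_pow, map_ofNat, aeval_X, aeval_lam_C]
    push_cast
    ring
  · have h := hb x hx
    rw [evalXLam_swap, show -(((12 : ℕ) : ℂ) / 2) = -6 by norm_num] at h
    rw [eq_div_iff (hr.natCast_mul (n := 4) (by norm_num)).ne_zero]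
    simp only [Polynomial.map_sub, Polynomial.map_add, Polynomial.map_mul, Polynomial.map_pow,
      map_C, map_X, eval_sub, eval_add, eval_mul, eval_pow, eval_C, eval_X,
      AlgHom.toRingHom_eq_coe, RingHom.coe_coe, aeval_X, map_sub, map_add, map_mul, map_pow,
      map_ofNat, Polynomial.map_ofNat, eval_ofNat, aeval_lam_C] at h
    rw [serP, serG₂_eq, serG₃_eq]
    push_cast
    linear_combination 4 * h

end ExplicitFormulas

end KdVLame

end

theorem theorem9 (τ : UpperHalfPlane) :
    (∀ p : ℕ, ∃ S : Polynomial ℂ,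
      KdVLame.IsSpectralPolynomial (KdVLame.regularSet τ)
        (KdVLame.lameData (-((p : ℂ) * (p + 1) / 2)) τ) S ∧
      (∀ S' : Polynomial ℂ, KdVLame.IsSpectralPolynomial (KdVLame.regularSet τ)
        (KdVLame.lameData (-((p : ℂ) * (p + 1) / 2)) τ) S' → S' = S) ∧
      S.Monic ∧ S.natDegree = 2 * p + 1 ∧
      ∃ r : LaurentSeries ℂ,
        KdVLame.IsSeriesSqrt r (Polynomial.aeval (KdVLame.lam ℂ) S / KdVLame.lam ℂ) ∧
        ∃ Q : Polynomial (Polynomial ℂ),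
          Q.Monic ∧ Q.natDegree = p ∧ (Polynomial.Bivariate.swap Q).natDegree = p ∧
          ∀ x ∈ KdVLame.regularSet τ,
            r * KdVLame.bAt (KdVLame.lameData (-((p : ℂ) * (p + 1) / 2)) τ) x =
              KdVLame.evalXLam Q ((KdVLame.tauPeriods τ).weierstrassP x)) ∧
    -- `p = 1`, `C = -1`
    (∃ s : LaurentSeries ℂ, KdVLame.IsSeriesSqrt s ((4 * KdVLame.lam ℂ ^ 3 - KdVLame.serG₂ τ * KdVLame.lam ℂ - KdVLame.serG₃ τ) / KdVLame.lam ℂ) ∧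
        ∀ x ∈ KdVLame.regularSet τ,
          KdVLame.bAt (KdVLame.lameData (-1) τ) x = 2 * (KdVLame.lam ℂ - KdVLame.serP τ x) / s) ∧
    -- `p = 2`, `C = -3`
    (∃ s : LaurentSeries ℂ, KdVLame.IsSeriesSqrt s
          ((KdVLame.lam ℂ ^ 2 - 3 * KdVLame.serG₂ τ) * (4 * KdVLame.lam ℂ ^ 3 - 9 * KdVLame.serG₂ τ * KdVLame.lam ℂ + 27 * KdVLame.serG₃ τ) / KdVLame.lam ℂ) ∧
        ∀ x ∈ KdVLame.regularSet τ,
          KdVLame.bAt (KdVLame.lameData (-3) τ) x =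
            1 / 2 * (4 * KdVLame.lam ℂ ^ 2 - 12 * KdVLame.serP τ x * KdVLame.lam ℂ + 36 * KdVLame.serP τ x ^ 2 - 9 * KdVLame.serG₂ τ) / s) ∧
    -- `p = 3`, `C = -6`
    (∃ s : LaurentSeries ℂ, KdVLame.IsSeriesSqrt s
          (16 * KdVLame.lam ℂ ^ 6 - 504 * KdVLame.serG₂ τ * KdVLame.lam ℂ ^ 4 + 2376 * KdVLame.serG₃ τ * KdVLame.lam ℂ ^ 3 + 4185 * KdVLame.serG₂ τ ^ 2 * KdVLame.lam ℂ ^ 2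
            - 36450 * KdVLame.serG₂ τ * KdVLame.serG₃ τ * KdVLame.lam ℂ - 3375 * KdVLame.serG₂ τ ^ 3 + 91125 * KdVLame.serG₃ τ ^ 2) ∧
        ∀ x ∈ KdVLame.regularSet τ,
          KdVLame.bAt (KdVLame.lameData (-6) τ) x =
            (4 * KdVLame.lam ℂ ^ 3 - 24 * KdVLame.serP τ x * KdVLame.lam ℂ ^ 2 + 60 * (3 * KdVLame.serP τ x ^ 2 - KdVLame.serG₂ τ) * KdVLame.lam ℂ - 900 * KdVLame.serP τ x ^ 3
              + 225 * KdVLame.serG₂ τ * KdVLame.serP τ x + 225 * KdVLame.serG₃ τ) / s) := by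
  refine ⟨fun p => ?_, KdVLame.bAt_lame_one τ, KdVLame.bAt_lame_two τ, KdVLame.bAt_lame_three τ⟩
  -- The lemmas use `C = -N/2` with a natural number `N`.
  have hN : ((p : ℂ) * (p + 1) / 2) = ((p * (p + 1) : ℕ) : ℂ) / 2 := by push_cast; ring
  rw [hN]
  obtain ⟨Q, hQ, hQd, hdeg, hlead, huniq⟩ :=
    KdVLame.exists_lamePolynomial (KdVLame.tauPeriods τ).g₂ (KdVLame.tauPeriods τ).g₃ p
  obtain ⟨S, hS, hSm, hSd⟩ := KdVLame.exists_lameQuad_eq _ _ p hQ hdeg hlead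
  obtain ⟨h1, h2⟩ := KdVLame.isSpectralPolynomial_lame τ hQ hdeg hlead huniq hS
  obtain ⟨r, hr, hb⟩ := KdVLame.exists_sqrt_mul_bAt τ hdeg hlead hS
  obtain ⟨hm, hd⟩ := KdVLame.swap_monic hdeg hlead
  exact ⟨S, h1, h2, hSm, hSd, r, hr, Polynomial.Bivariate.swap Q, hm, hd,
    by rw [Polynomial.Bivariate.swap_swap_apply, hQd], hb⟩
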